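/- **Notation.** Let $c\in\mathbb C\setminus\{0\}$, let $m,n\ge 0$ be integers, $N=m+n-1$. Put $c_{[i]}=c$ for $i\le m$, $c_{[i]}=-c$ for $i>m$, and $$g_{[i]}(u,v)=\frac{c_{[i]}}{u-v},\qquad f_{[i]}(u,v)=1+g_{[i]}(u,v),\qquad \gamma_i=g_{[i]}\ \text{ if } i=m,\quad \gamma_i=f_{[i]}\ \text{ if } i\neq m .$$ Let $\bar s=(\bar s^1,\dots,\bar s^N)$, $\bar t=(\bar t^1,\dots,\bar t^N)$ be finite labelled sets of complex parameters with $\#\bar s^\nu=\#\bar t^\nu$ for all $\nu$, and put $\bar s^0=\bar t^0=\bar s^{N+1}=\bar t^{N+1}=\emptyset$. A function of one or two sets of parameters denotes the product (double product) of its values over these sets; empty products are $1$. We write $\bar s^\mu_i=\bar s^\mu\setminus\{s^\mu_i\}$, $\bar t^\mu_k=\bar t^\mu\setminus\{t^\mu_k\}$. **The highest coefficient.** $Z^{m|n}(\bar s|\bar t)$ is the function defined recursively as follows. (a) $Z^{m|n}=1$ if $m+n\le 1$, and $Z^{1|1}(\bar s|\bar t)=g_{[1]}(\bar s^1,\bar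 t^1)$. (b) In all other cases, if $\bar s^1=\bar t^1=\emptyset$, then $Z^{m|n}(\bar s|\bar t)=Z^{m'|n'}(\bar s^2,\dots,\bar s^N|\bar t^2,\dots,\bar t^N)$, where $(m',n')=(m-1,n)$ for $m>0$ and $(m',n')=(0,n-1)$ for $m=0$. (c) In all other cases, if $\bar s^1\ne\emptyset$, let $\bar s^1_{\rm I}$ consist of the element of $\bar s^1$ with the least label. Then $$ Z^{m|n}(\bar s|\bar t)=\sum_{\rho=2}^{N+1}\sum Z^{m|n}\bigl(\{\bar s^\sigma_{\rm II}\}_1^{\rho-1},\{\bar s^\sigma\}_\rho^N\big|\{\bar t^\sigma_{\rm II}\}_1^{\rho-1},\{\bar t^\sigma\}_\rho^N\bigr)\left(\frac{g_{[1]}(\bar s^1_{\rm II},\bar s^1_{\rm I})}{f_{[1]}(\bar s^1_{\rm II},\bar s^1_{\rm I})}\right)^{\delta_{m,1}} \frac{g_{[2]}(\bar t^1_{\rm I},\bar s^1_{\rm I})\,\gamma_1(\bar t^1_{\rm I},\bar t^1_{\rm II})\,f_{[1]}(\bar t^1_{\rm II},\bar s^1_{\rm I})}{f_{[\rho]}(\bar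 s^\rho,\bar s^{\rho-1}_{\rm I})} $$ $$ \times\prod_{\nu=2}^{\rho-1}\frac{g_{[\nu+1]}(\bar t^\nu_{\rm I},\bar t^{\nu-1}_{\rm I})\,g_{[\nu]}(\bar s^\nu_{\rm I},\bar s^{\nu-1}_{\rm I})\,\gamma_\nu(\bar t^\nu_{\rm I},\bar t^\nu_{\rm II})\,\gamma_\nu(\bar s^\nu_{\rm II},\bar s^\nu_{\rm I})}{f_{[\nu]}(\bar s^\nu,\bar s^{\nu-1}_{\rm I})\,f_{[\nu]}(\bar t^\nu_{\rm I},\bar t^{\nu-1})}, $$ where the inner sum is over the partitions $\bar t^\sigma\Rightarrow\{\bar t^\sigma_{\rm I},\bar t^\sigma_{\rm II}\}$, $1\le\sigma\le\rho-1$, and $\bar s^\sigma\Rightarrow\{\bar s^\sigma_{\rm I},\bar s^\sigma_{\rm II}\}$, $2\le\sigma\le\rho-1$, with $\#\bar t^\sigma_{\rm I}=\#\bar s^\sigma_{\rm I}=1$. **Proposition.** Let $1\le\mu\le N$, $s^\mu_i\in\bar s^\mu$, $t^\mu_k\in\bar t^\mu$. 1. Suppose that any two distinct members of the family of all parameters other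 than $s^\mu_i$ differ neither by $0$ nor by $\pm c$. Then, as a function of $s^\mu_i$ in a punctured neighbourhood of $t^\mu_k$, $$ Z^{m|n}(\bar s|\bar t)= g_{[\mu+1]}(t_k^\mu,s_i^\mu)\,\frac{\gamma_{\mu}(\bar t_k^\mu,t_k^\mu)\,\gamma_{\mu}(s_i^\mu,\bar s_i^\mu)}{f_{[\mu+1]}(\bar t^{\mu+1},t^{\mu}_k)\,f_{[\mu]}(s^{\mu}_i,\bar s^{\mu-1})}\,Z^{m|n}(\bar s\setminus \{s_i^\mu\}|\bar t\setminus \{t_k^\mu\})+reg, $$ where $reg$ is analytic at $s^\mu_i=t^\mu_k$. 2. For generic parameters, that is, outside the zero set of some nonzero polynomial in the parameters, $Z^{m|n}(\bar s|\bar t)$ as a function of $s^\mu_i$ has a pole of order exactly one at $s^\mu_i=t^\mu_k$. -/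

import Mathlib

open Filter Topology

namespace BetheHC

/-! Colours are numbered `1, …, N` with `N = m + n - 1`.  The Bethe parameters of colour `ν` are the
families `s ν a`, `a ∈ A ν`, and `t ν b`, `b ∈ B ν`, where `A ν`, `B ν` are finite sets of labels;
a subset of the parameters is given by a smaller set of labels. -/

section
variable {K : Type*} [Field K]

/-- The graded constant `c_[i]`: `c` for `i ≤ m` and `-c` for `i > m`. -/
def cg (c : K) (m i : ℕ) : K := if i ≤ m then c else -c

/-- `g_[i](u,v) = c_[i] / (u - v)`. -/
def g (c : K) (m i : ℕ) (u v : K) : K := cg c m i / (u - v)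

/-- `f_[i](u,v) = 1 + g_[i](u,v)`. -/
def f (c : K) (m i : ℕ) (u v : K) : K := 1 + g c m i u v

/-- `γ_i` is `g_[i]` for `i = m` and `f_[i]` otherwise. -/
def gam (c : K) (m i : ℕ) (u v : K) : K := if i = m then g c m i u v else f c m i u v

end

/-- Extend a labelling of the colours `σ < ρ` by `0`. -/
def extend (ρ : ℕ) (p : Fin ρ → ℕ) : ℕ → ℕ := fun ν => if h : ν < ρ then p ⟨ν, h⟩ else 0

theorem extend_injective (ρ : ℕ) : Function.Injective (extend ρ) := by
  intro p q hpq
  funext σ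
  have := congrFun hpq (σ : ℕ)
  simpa [extend] using this

/-- All ways to choose one label `p σ ∈ X σ` for every colour `a ≤ σ < ρ`
(with `p σ = 0` for the other `σ`). -/
def choices (a ρ : ℕ) (X : ℕ → Finset ℕ) : Finset (ℕ → ℕ) :=
  (Fintype.piFinset fun σ : Fin ρ => if a ≤ (σ : ℕ) then X σ else {0}).map
    ⟨extend ρ, extend_injective ρ⟩

theorem mem_choices {a ρ : ℕ} {X : ℕ → Finset ℕ} {p : ℕ → ℕ} :
    p ∈ choices a ρ X ↔
      (∀ σ, a ≤ σ → σ < ρ → p σ ∈ X σ) ∧ (∀ σ, ¬ (a ≤ σ ∧ σ < ρ) → p σ = 0) := by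
  rw [choices, Finset.mem_map]
  constructor
  · rintro ⟨q, hq, rfl⟩
    rw [Fintype.mem_piFinset] at hq
    refine ⟨fun σ h1 h2 => ?_, fun σ h => ?_⟩
    · have := hq ⟨σ, h2⟩
      simpa [extend, h1, h2] using this
    · by_cases h2 : σ < ρ
      · have h1 : ¬ a ≤ σ := fun h1 => h ⟨h1, h2⟩
        have := hq ⟨σ, h2⟩
        simpa [extend, h1, h2] using this
      · simp [extend, h2]
  · rintro ⟨h1, h2⟩
    refine ⟨fun σ => p σ, ?_, ?_⟩
    · rw [Fintype.mem_piFinset]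
      intro σ
      split_ifs with h
      · exact h1 σ h σ.2
      · simpa using h2 σ (fun h' => h h'.1)
    · funext ν
      by_cases h : ν < ρ
      · simp [extend, h]
      · simpa [extend, h] using (h2 ν (fun h' => h h'.2)).symm

/-- Remove the label `p σ` from `X σ` for the colours `1 ≤ σ < ρ`. -/
def remove (ρ : ℕ) (X : ℕ → Finset ℕ) (p : ℕ → ℕ) : ℕ → Finset ℕ :=
  fun σ => if 1 ≤ σ ∧ σ < ρ then (X σ).erase (p σ) else X σ

section
variable {K : Type*} [Field K]

/-- The coefficient of one term of the recursion for the highest coefficient.  The one-element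
parts `s̄^σ_I`, `t̄^σ_I` (`1 ≤ σ < ρ`) carry the labels `p σ`, `q σ`; the complementary parts
`s̄^σ_II`, `t̄^σ_II` carry the labels `(A σ).erase (p σ)`, `(B σ).erase (q σ)`. -/
def weight (c : K) (m : ℕ) (s t : ℕ → ℕ → K) (A B : ℕ → Finset ℕ) (ρ : ℕ) (p q : ℕ → ℕ) : K :=
  (if m = 1 then
      (∏ a ∈ (A 1).erase (p 1), g c m 1 (s 1 a) (s 1 (p 1))) /
        ∏ a ∈ (A 1).erase (p 1), f c m 1 (s 1 a) (s 1 (p 1))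
    else 1) *
  (g c m 2 (t 1 (q 1)) (s 1 (p 1)) *
      (∏ b ∈ (B 1).erase (q 1), gam c m 1 (t 1 (q 1)) (t 1 b)) *
      (∏ b ∈ (B 1).erase (q 1), f c m 1 (t 1 b) (s 1 (p 1))) /
    ∏ a ∈ A ρ, f c m ρ (s ρ a) (s (ρ - 1) (p (ρ - 1)))) *
  ∏ ν ∈ Finset.Ico 2 ρ,
    (g c m (ν + 1) (t ν (q ν)) (t (ν - 1) (q (ν - 1))) *
        g c m ν (s ν (p ν)) (s (ν - 1) (p (ν - 1))) *
        (∏ b ∈ (B ν).erase (q ν), gam c m ν (t ν (q ν)) (t ν b)) *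
        (∏ a ∈ (A ν).erase (p ν), gam c m ν (s ν a) (s ν (p ν)))) /
      ((∏ a ∈ A ν, f c m ν (s ν a) (s (ν - 1) (p (ν - 1)))) *
        ∏ b ∈ B (ν - 1), f c m ν (t ν (q ν)) (t (ν - 1) b))

/-- The highest coefficient `Z^{m|n}(s̄|t̄)`.
* `m + n ≤ 1`: there are no parameters and the value is `1`.
* `m = n = 1`: the double product `g(s̄,t̄)`.
* `s̄¹ ≠ ∅`: the recursion.  The part `s̄¹_I` is the parameter with the least label `x`, and the sum
  runs over `ρ = k + 2 ∈ {2, …, N + 1}`, over `s̄^σ_I` for `2 ≤ σ < ρ` and over `t̄^σ_I` for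
  `1 ≤ σ < ρ`.
* `s̄¹ = ∅`: the first colour is dropped; this gives `Z^{m-1|n}` for `m > 0`, `Z^{0|n-1}` for `m = 0`.

For `m = 0` all gradings are odd, so that the formulas are those of `gl(n)` with `-c` for `c`. -/
def Z (c : K) (m n : ℕ) (s t : ℕ → ℕ → K) (A B : ℕ → Finset ℕ) : K :=
  if m + n ≤ 1 then 1
  else if m = 1 ∧ n = 1 then ∏ a ∈ A 1, ∏ b ∈ B 1, g c m 1 (s 1 a) (t 1 b)
  else if h : (A 1).Nonempty then
    let x := (A 1).min' h
    ∑ k ∈ Finset.range (m + n - 1),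
      ∑ p ∈ choices 2 (k + 2) A, ∑ q ∈ choices 1 (k + 2) B,
        weight c m s t A B (k + 2) (Function.update p 1 x) q *
          Z c m n s t (remove (k + 2) A (Function.update p 1 x)) (remove (k + 2) B q)
  else
    Z c (m - 1) (if m = 0 then n - 1 else n) (fun ν => s (ν + 1)) (fun ν => t (ν + 1))
      (fun ν => A (ν + 1)) (fun ν => B (ν + 1))
termination_by (m + n, (A 1).card)
decreasing_by
  · apply Prod.Lex.right
    have : remove (k + 2) A (Function.update p 1 x) 1 = (A 1).erase x := by simp [remove]
    rw [this]
    exact Finset.card_erase_lt_of_mem (Finset.min'_mem _ _)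
  · apply Prod.Lex.left
    split_ifs <;> omega

/-- The coefficient
`g_[μ+1](y,z) γ_μ(t̄^μ_k,y) γ_μ(z,s̄^μ_i) / (f_[μ+1](t̄^{μ+1},y) f_[μ](z,s̄^{μ-1}))`,
where `y = t^μ_k` and `z` is the value of the parameter `s^μ_i`. -/
def resFactor (c : K) (m : ℕ) (s t : ℕ → ℕ → K) (A B : ℕ → Finset ℕ) (μ i k : ℕ) (z : K) : K :=
  g c m (μ + 1) (t μ k) z *
    ((∏ b ∈ (B μ).erase k, gam c m μ (t μ b) (t μ k)) *
      (∏ a ∈ (A μ).erase i, gam c m μ z (s μ a))) /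
    ((∏ b ∈ B (μ + 1), f c m (μ + 1) (t (μ + 1) b) (t μ k)) *
      ∏ a ∈ A (μ - 1), f c m μ z (s (μ - 1) a))

/-- `u` and `v` differ neither by `0` nor by `±c`. -/
def Sep (c u v : K) : Prop := u - v ≠ 0 ∧ u - v ≠ c ∧ u - v ≠ -c

/-- Any two of the parameters `s ν a` (`a ∈ A ν`), `t ν b` (`b ∈ B ν`) are separated. -/
def Generic (c : K) (s t : ℕ → ℕ → K) (A B : ℕ → Finset ℕ) : Prop :=
  (∀ ν, ∀ a ∈ A ν, ∀ ν', ∀ a' ∈ A ν', (ν, a) ≠ (ν', a') → Sep c (s ν a) (s ν' a')) ∧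
  (∀ ν, ∀ b ∈ B ν, ∀ ν', ∀ b' ∈ B ν', (ν, b) ≠ (ν', b') → Sep c (t ν b) (t ν' b')) ∧
  (∀ ν, ∀ a ∈ A ν, ∀ ν', ∀ b ∈ B ν', Sep c (s ν a) (t ν' b))

/-- Remove the label `i` of colour `μ`. -/
def del (A : ℕ → Finset ℕ) (μ i : ℕ) : ℕ → Finset ℕ := Function.update A μ ((A μ).erase i)

/-- Give the parameter with colour `μ` and label `i` the value `z`. -/
def setParam (s : ℕ → ℕ → K) (μ i : ℕ) (z : K) : ℕ → ℕ → K :=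
  Function.update s μ (Function.update (s μ) i z)

end

end BetheHC

/-!
The recursion for the highest coefficient removes one parameter `s^σ_I` and one parameter `t^σ_I` of
each colour `1 ≤ σ < ρ`.  It is a sum over paths through the colours `1, 2, …`, whose weight is a
product of factors that connect neighbouring colours; `pathSum` is this sum, and `recRHS` is the
right-hand side of the recursion in terms of it, with an arbitrary parameter `s^1_x` in the place of
the one with the least label.

*Residues.*  Suppose that `s^μ_i` and `t^μ_k` collide.  An empty first colour can be dropped, so let
the first colour be nonempty.  If there is a parameter `s^1_x` other than
`s^μ_i`, the recursion for this parameter exhibits the pole: only the terms in which neither `s^μ_i`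
nor `t^μ_k` is removed are singular, their residues are known by induction on the number of
parameters, and the factors of the path that involve `s^μ_i` or `t^μ_k` combine with the residues of
the smaller coefficients to the expected prefactor (`hasRes_pathSum`, `residue_coefficient`).  If
`s^μ_i = s^1_i` is the only parameter of the first colour, the recursion has the explicit factor
`g_2(t^1_k, s^1_i)`, and the claim is about a sum over the paths that start at colour `1` with equal
values of the two parameters.  Two facts are thus needed:

* the recursion holds for every `x`, not only for the least label (`Z_eq_recRHS`);
* a sum over paths that start with equal values `y` is a simple multiple of the highest coefficient
  (`fprod_sub_mul_Z`, `pathSum_virtual`).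

*Two paths.* Both facts are proved by applying the recursion twice, which leads to sums over pairs
of paths.  Such a sum depends on the order in which the two paths are taken, but in a controlled
way: if the starting values `x, x'` are interchanged, or `y, y'`, it varies as an affine function of
`x y + x' y' - κ (x + y')` (`Exchange`, `twoPath_exchange`).  This property passes from one colour
to the previous one because the sum over the four ways to connect two pairs of values with two pairs
of values preserves it (`exchange_pair`), also across the colour `m`, where the sign of `κ` changes.
Given the property, the two facts become rational identities in the parameters of the first colour
(`startPair_symm`, `startPair_star`).

*Order of the pole.* The highest coefficient is a rational function of the parameters
(`isRational_Z`), and it does not vanish identically, as by induction it has a pole whose residue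
does not vanish identically (`exists_generic_Z_ne_zero`).  Hence the residue is nonzero outside the
zero set of a polynomial.
-/

namespace BetheHC

/-! ### Sums over paths -/

section
variable {K : Type*} [Field K]

/-- `γ_ν(t^ν_b, t̄^ν_b)`, where `t̄^ν_b` are the parameters of colour `ν` other than `t^ν_b`. -/
def gamL (c : K) (m : ℕ) (t : ℕ → ℕ → K) (ν : ℕ) (B : ℕ → Finset ℕ) (b : ℕ) : K :=
  ∏ b' ∈ (B ν).erase b, gam c m ν (t ν b) (t ν b')

/-- `γ_ν(s̄^ν_a, s^ν_a)`, where `s̄^ν_a` are the parameters of colour `ν` other than `s^ν_a`. -/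
def gamR (c : K) (m : ℕ) (s : ℕ → ℕ → K) (ν : ℕ) (A : ℕ → Finset ℕ) (a : ℕ) : K :=
  ∏ a' ∈ (A ν).erase a, gam c m ν (s ν a') (s ν a)

/-- `f_ν(s̄^ν, u)`. -/
def fprod (c : K) (m : ℕ) (s : ℕ → ℕ → K) (ν : ℕ) (A : ℕ → Finset ℕ) (u : K) : K :=
  ∏ a ∈ A ν, f c m ν (s ν a) u

/-- `1 / f_{ν+1}(w, t̄^ν)`. -/
def lowerWt (c : K) (m : ℕ) (t : ℕ → ℕ → K) (ν : ℕ) (B : ℕ → Finset ℕ) (w : K) : K :=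
  ∏ b ∈ B ν, (f c m (ν + 1) w (t ν b))⁻¹

/-- The sum over all ways in which a path that has reached colour `ν`, with `s^ν_I = u` and
`t^ν_I = v`, continues through at most `d` further colours; at each of them it removes one label
from `A` and one from `B`, and `Φ` is evaluated at the labels that remain.  The function `h` is the
weight `1 / f_{ν+1}(·, t̄^ν)` of the colour that has been reached last. -/
def pathSum (c : K) (m : ℕ) (s t : ℕ → ℕ → K) : ℕ → ℕ → K → K → (K → K) →
    ((ℕ → Finset ℕ) → (ℕ → Finset ℕ) → K) → (ℕ → Finset ℕ) → (ℕ → Finset ℕ) → K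
  | 0, ν, u, _, _, Φ, A, B => (fprod c m s (ν + 1) A u)⁻¹ * Φ A B
  | d + 1, ν, u, v, h, Φ, A, B => (fprod c m s (ν + 1) A u)⁻¹ *
      (Φ A B + ∑ a ∈ A (ν + 1), ∑ b ∈ B (ν + 1),
        (g c m (ν + 2) (t (ν + 1) b) v * g c m (ν + 1) (s (ν + 1) a) u *
          gamL c m t (ν + 1) B b * gamR c m s (ν + 1) A a * h (t (ν + 1) b)) *
        pathSum c m s t d (ν + 1) (s (ν + 1) a) (t (ν + 1) b) (lowerWt c m t (ν + 1) B) Φ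
          (del A (ν + 1) a) (del B (ν + 1) b))

/-- `A'`, `B'` arise from `A`, `B` by removing equally many labels of each colour above `ν`.  These
are the labels at which a sum over paths that have reached colour `ν` evaluates `Φ`. -/
structure Below (ν : ℕ) (A B A' B' : ℕ → Finset ℕ) : Prop where
  eqA : ∀ σ ≤ ν, A' σ = A σ
  eqB : ∀ σ ≤ ν, B' σ = B σ
  subA : ∀ σ, A' σ ⊆ A σ
  subB : ∀ σ, B' σ ⊆ B σ
  card : ∀ σ, (A' σ).card + (B σ).card = (A σ).card + (B' σ).card

theorem Below.refl (ν : ℕ) (A B : ℕ → Finset ℕ) : Below ν A B A B :=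
  ⟨fun _ _ => rfl, fun _ _ => rfl, fun _ => subset_rfl, fun _ => subset_rfl, fun _ => rfl⟩

@[simp] theorem del_same (A : ℕ → Finset ℕ) (μ i : ℕ) : del A μ i μ = (A μ).erase i := by
  simp [del]

theorem del_of_ne (A : ℕ → Finset ℕ) {μ ν : ℕ} (i : ℕ) (h : ν ≠ μ) : del A μ i ν = A ν := by
  simp [del, h]

theorem del_subset (A : ℕ → Finset ℕ) (μ i ν : ℕ) : del A μ i ν ⊆ A ν := by
  by_cases h : ν = μ
  · subst h; simpa using Finset.erase_subset _ _
  · rw [del_of_ne _ _ h]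

theorem mem_del {A : ℕ → Finset ℕ} {μ i ν a : ℕ} :
    a ∈ del A μ i ν ↔ a ∈ A ν ∧ ¬ (ν = μ ∧ a = i) := by
  by_cases h : ν = μ
  · subst h; simp [and_comm]
  · simp [del_of_ne _ _ h, h]

theorem del_comm (A : ℕ → Finset ℕ) (μ i ν j : ℕ) :
    del (del A μ i) ν j = del (del A ν j) μ i := by
  funext σ; ext a; simp only [mem_del]; tauto

theorem card_del_add_one {A : ℕ → Finset ℕ} {μ i : ℕ} (h : i ∈ A μ) :
    (del A μ i μ).card + 1 = (A μ).card := by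
  simpa using Finset.card_erase_add_one h

theorem card_del_eq {A B : ℕ → Finset ℕ} (h : ∀ σ, (A σ).card = (B σ).card) {μ i k : ℕ}
    (hi : i ∈ A μ) (hk : k ∈ B μ) (σ : ℕ) : (del A μ i σ).card = (del B μ k σ).card := by
  by_cases hσ : σ = μ
  · subst hσ
    have := card_del_add_one hi
    have := card_del_add_one hk
    have := h σ
    omega
  · rw [del_of_ne _ _ hσ, del_of_ne _ _ hσ, h]

theorem Below.step {ν : ℕ} {A B A' B' : ℕ → Finset ℕ} {a b : ℕ} (ha : a ∈ A (ν + 1))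
    (hb : b ∈ B (ν + 1)) (h : Below (ν + 1) (del A (ν + 1) a) (del B (ν + 1) b) A' B') :
    Below ν A B A' B' where
  eqA σ hσ := by rw [h.eqA σ (by omega), del_of_ne _ _ (by omega)]
  eqB σ hσ := by rw [h.eqB σ (by omega), del_of_ne _ _ (by omega)]
  subA σ := (h.subA σ).trans (del_subset _ _ _ _)
  subB σ := (h.subB σ).trans (del_subset _ _ _ _)
  card σ := by
    have h1 := h.card σ
    by_cases hσ : σ = ν + 1
    · subst hσ
      have := card_del_add_one ha
      have := card_del_add_one hb
      omega
    · simpa [del_of_ne _ _ hσ] using h1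

theorem Below.card_eq {ν : ℕ} {A B A' B' : ℕ → Finset ℕ} (h : Below ν A B A' B')
    (hc : ∀ σ, (A σ).card = (B σ).card) (σ : ℕ) : (A' σ).card = (B' σ).card := by
  have := h.card σ
  have := hc σ
  omega

variable {c : K} {m : ℕ} {s t s' t' : ℕ → ℕ → K}

/-- A sum over paths from colour `ν` involves only parameters of higher colours, the values of `h`
at the parameters of the next colour, and the values of `Φ` at labels that the paths leave. -/
theorem pathSum_congr {d : ℕ} : ∀ {ν : ℕ} {u v : K} {h h' : K → K}
    {Φ Φ' : (ℕ → Finset ℕ) → (ℕ → Finset ℕ) → K} {A B : ℕ → Finset ℕ},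
    (∀ σ, ν < σ → ∀ a ∈ A σ, s σ a = s' σ a) → (∀ σ, ν < σ → ∀ b ∈ B σ, t σ b = t' σ b) →
    (∀ b ∈ B (ν + 1), h (t (ν + 1) b) = h' (t (ν + 1) b)) →
    (∀ A' B', Below ν A B A' B' → Φ A' B' = Φ' A' B') →
    pathSum c m s t d ν u v h Φ A B = pathSum c m s' t' d ν u v h' Φ' A B := by
  induction d with
  | zero =>
    intro ν u v h h' Φ Φ' A B hs ht hh hΦ
    simp only [pathSum, fprod]
    rw [hΦ A B (Below.refl _ _ _), Finset.prod_congr rfl fun a ha => by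
      rw [hs (ν + 1) (by omega) a ha]]
  | succ d ih =>
    intro ν u v h h' Φ Φ' A B hs ht hh hΦ
    have hs1 := hs (ν + 1) (by omega)
    have ht1 := ht (ν + 1) (by omega)
    simp only [pathSum]
    have e1 : fprod c m s (ν + 1) A u = fprod c m s' (ν + 1) A u :=
      Finset.prod_congr rfl fun a ha => by rw [hs1 a ha]
    rw [e1, hΦ A B (Below.refl _ _ _)]
    congr 2
    refine Finset.sum_congr rfl fun a ha => Finset.sum_congr rfl fun b hb => ?_
    have e2 : gamL c m t (ν + 1) B b = gamL c m t' (ν + 1) B b :=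
      Finset.prod_congr rfl fun b' hb' => by
        rw [ht1 b hb, ht1 b' (Finset.mem_of_mem_erase hb')]
    have e3 : gamR c m s (ν + 1) A a = gamR c m s' (ν + 1) A a :=
      Finset.prod_congr rfl fun a' ha' => by
        rw [hs1 a ha, hs1 a' (Finset.mem_of_mem_erase ha')]
    rw [hh b hb, e2, e3, ← hs1 a ha, ← ht1 b hb]
    congr 1
    apply ih
    · intro σ hσ a' ha'
      exact hs σ (by omega) a' (del_subset _ _ _ _ ha')
    · intro σ hσ a' ha'
      exact ht σ (by omega) a' (del_subset _ _ _ _ ha')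
    · intro b' hb'
      exact Finset.prod_congr rfl fun b hb => by rw [ht1 b hb]
    · intro A' B' hAB
      exact hΦ A' B' (hAB.step ha hb)

theorem pathSum_congr_right {d ν : ℕ} {u v : K} {h : K → K}
    {Φ Φ' : (ℕ → Finset ℕ) → (ℕ → Finset ℕ) → K} {A B : ℕ → Finset ℕ}
    (hΦ : ∀ A' B', Below ν A B A' B' → Φ A' B' = Φ' A' B') :
    pathSum c m s t d ν u v h Φ A B = pathSum c m s t d ν u v h Φ' A B :=
  pathSum_congr (fun _ _ _ _ => rfl) (fun _ _ _ _ => rfl) (fun _ _ => rfl) hΦ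

theorem pathSum_add {d : ℕ} : ∀ {ν : ℕ} {u v : K} {h : K → K}
    (Φ Φ' : (ℕ → Finset ℕ) → (ℕ → Finset ℕ) → K) (A B : ℕ → Finset ℕ),
    pathSum c m s t d ν u v h (fun A' B' => Φ A' B' + Φ' A' B') A B =
      pathSum c m s t d ν u v h Φ A B + pathSum c m s t d ν u v h Φ' A B := by
  induction d with
  | zero => intros; simp only [pathSum]; ring
  | succ d ih =>
    intros
    simp only [pathSum, ih, mul_add, Finset.sum_add_distrib]
    ring

theorem pathSum_mul {d : ℕ} : ∀ {ν : ℕ} {u v : K} {h : K → K} (x : K)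
    (Φ : (ℕ → Finset ℕ) → (ℕ → Finset ℕ) → K) (A B : ℕ → Finset ℕ),
    pathSum c m s t d ν u v h (fun A' B' => x * Φ A' B') A B =
      x * pathSum c m s t d ν u v h Φ A B := by
  induction d with
  | zero => intros; simp only [pathSum]; ring
  | succ d ih =>
    intros
    simp only [pathSum, ih, mul_add, Finset.mul_sum]
    congr 1
    · ring
    · exact Finset.sum_congr rfl fun a _ => Finset.sum_congr rfl fun b _ => by ring

theorem pathSum_sum {ι : Type*} {d ν : ℕ} {u v : K} {h : K → K} (S : Finset ι)
    (Φ : ι → (ℕ → Finset ℕ) → (ℕ → Finset ℕ) → K) (A B : ℕ → Finset ℕ) :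
    pathSum c m s t d ν u v h (fun A' B' => ∑ i ∈ S, Φ i A' B') A B =
      ∑ i ∈ S, pathSum c m s t d ν u v h (Φ i) A B := by
  classical
  induction S using Finset.induction_on with
  | empty =>
    simpa using pathSum_mul (c := c) (m := m) (s := s) (t := t) (d := d) (ν := ν)
      (u := u) (v := v) (h := h) 0 (fun _ _ => 0) A B
  | insert i S hi ih => simp only [Finset.sum_insert hi, pathSum_add, ih]

/-- The removal of labels of colours that the paths have passed may be postponed. -/
theorem pathSum_del {d : ℕ} : ∀ {ν σ : ℕ} {u v : K} {h : K → K}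
    (Φ : (ℕ → Finset ℕ) → (ℕ → Finset ℕ) → K) (A B : ℕ → Finset ℕ) (a b : ℕ), σ ≤ ν →
    pathSum c m s t d ν u v h (fun A' B' => Φ (del A' σ a) (del B' σ b)) A B =
      pathSum c m s t d ν u v h Φ (del A σ a) (del B σ b) := by
  induction d with
  | zero =>
    intro ν σ u v h Φ A B a b hσ
    simp only [pathSum, fprod]
    rw [del_of_ne A a (show ν + 1 ≠ σ by omega)]
  | succ d ih =>
    intro ν σ u v h Φ A B a b hσ
    simp only [pathSum, fprod, gamL, gamR]
    rw [del_of_ne A a (show ν + 1 ≠ σ by omega), del_of_ne B b (show ν + 1 ≠ σ by omega)]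
    congr 2
    refine Finset.sum_congr rfl fun a' ha => Finset.sum_congr rfl fun b' hb => ?_
    rw [ih _ _ _ _ _ (show σ ≤ ν + 1 by omega), del_comm A, del_comm B]
    congr 2
    funext w
    simp only [lowerWt, del_of_ne B b (show ν + 1 ≠ σ by omega)]

end

/-! ### The recursion as a sum over paths -/

section choices

theorem choices_of_le {a ρ : ℕ} (h : ρ ≤ a) (X : ℕ → Finset ℕ) :
    choices a ρ X = {fun _ => 0} := by
  ext p
  rw [mem_choices, Finset.mem_singleton]
  constructor
  · rintro ⟨-, h2⟩
    funext σ
    exact h2 σ (by omega)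
  · rintro rfl
    exact ⟨fun σ _ _ => by omega, fun _ _ => rfl⟩

/-- Choose the label of the lowest colour first. -/
theorem sum_choices {M : Type*} [AddCommMonoid M] {a ρ : ℕ} (h : a < ρ) (X : ℕ → Finset ℕ)
    (G : (ℕ → ℕ) → M) :
    ∑ p ∈ choices a ρ X, G p =
      ∑ x ∈ X a, ∑ p ∈ choices (a + 1) ρ X, G (Function.update p a x) := by
  rw [← Finset.sum_product']
  refine Finset.sum_nbij' (fun p => (p a, Function.update p a 0))
    (fun y => Function.update y.2 a y.1) ?_ ?_ ?_ ?_ ?_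
  · intro p hp
    rw [mem_choices] at hp
    rw [Finset.mem_product, mem_choices]
    refine ⟨hp.1 a le_rfl h, fun σ h1 h2 => ?_, fun σ h1 => ?_⟩
    · dsimp only
      rw [Function.update_of_ne (by omega)]
      exact hp.1 σ (by omega) h2
    · by_cases hσ : σ = a
      · subst hσ; simp
      · dsimp only
        rw [Function.update_of_ne hσ]
        exact hp.2 σ (by omega)
  · rintro ⟨x, p⟩ hp
    rw [Finset.mem_product, mem_choices] at hp
    rw [mem_choices]
    refine ⟨fun σ h1 h2 => ?_, fun σ h1 => ?_⟩
    · by_cases hσ : σ = a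
      · subst hσ; simpa using hp.1
      · dsimp only
        rw [Function.update_of_ne hσ]
        exact hp.2.1 σ (by omega) h2
    · dsimp only
      rw [Function.update_of_ne (by omega)]
      exact hp.2.2 σ (by omega)
  · intro p _
    simp
  · rintro ⟨x, p⟩ hp
    rw [Finset.mem_product, mem_choices] at hp
    have h0 : p a = 0 := hp.2.2 a (by omega)
    simp [← h0]
  · intro p _
    simp

end choices

section
variable {K : Type*} [Field K] {c : K} {m : ℕ} {s t : ℕ → ℕ → K}

/-- Remove the label `p σ` from `X σ` for the colours `ν < σ ≤ ν + k`. -/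
def removeAbove (ν k : ℕ) (X : ℕ → Finset ℕ) (p : ℕ → ℕ) : ℕ → Finset ℕ :=
  fun σ => if ν < σ ∧ σ ≤ ν + k then (X σ).erase (p σ) else X σ

/-- The factor of colour `ν` in the weight of a path, without the denominator
`f_ν(s̄^ν, s^{ν-1}_I)`. -/
def stepWt (c : K) (m : ℕ) (s t : ℕ → ℕ → K) (A B : ℕ → Finset ℕ) (p q : ℕ → ℕ) (ν : ℕ) : K :=
  g c m (ν + 1) (t ν (q ν)) (t (ν - 1) (q (ν - 1))) *
    g c m ν (s ν (p ν)) (s (ν - 1) (p (ν - 1))) *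
    gamL c m t ν B (q ν) * gamR c m s ν A (p ν) * lowerWt c m t (ν - 1) B (t ν (q ν))

/-- The weight of a path from colour `ν` to colour `ν + k` with the labels `p`, `q`. -/
def pathWt (c : K) (m : ℕ) (s t : ℕ → ℕ → K) (A B : ℕ → Finset ℕ) (ν k : ℕ) (p q : ℕ → ℕ) : K :=
  (∏ σ ∈ Finset.Ico (ν + 1) (ν + k + 1),
      ((fprod c m s σ A (s (σ - 1) (p (σ - 1))))⁻¹ * stepWt c m s t A B p q σ)) *
    (fprod c m s (ν + k + 1) A (s (ν + k) (p (ν + k))))⁻¹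

theorem pathWt_zero (A B : ℕ → Finset ℕ) (ν : ℕ) (p q : ℕ → ℕ) :
    pathWt c m s t A B ν 0 p q = (fprod c m s (ν + 1) A (s ν (p ν)))⁻¹ := by
  simp [pathWt]

theorem pathWt_succ (A B : ℕ → Finset ℕ) (ν k : ℕ) (p q : ℕ → ℕ) :
    pathWt c m s t A B ν (k + 1) p q =
      (fprod c m s (ν + 1) A (s ν (p ν)))⁻¹ * stepWt c m s t A B p q (ν + 1) *
        pathWt c m s t A B (ν + 1) k p q := by
  rw [pathWt, Finset.prod_eq_prod_Ico_succ_bot (by omega), pathWt]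
  rw [show ν + (k + 1) + 1 = ν + 1 + k + 1 by omega, show ν + (k + 1) = ν + 1 + k by omega]
  simp only [Nat.add_sub_cancel]
  ring

theorem pathWt_congr {A B : ℕ → Finset ℕ} {ν k : ℕ} {p q p' q' : ℕ → ℕ}
    (hp : ∀ σ, ν ≤ σ → p σ = p' σ) (hq : ∀ σ, ν ≤ σ → q σ = q' σ) :
    pathWt c m s t A B ν k p q = pathWt c m s t A B ν k p' q' := by
  unfold pathWt
  rw [hp (ν + k) (by omega)]
  congr 1
  refine Finset.prod_congr rfl fun σ hσ => ?_
  rw [Finset.mem_Ico] at hσ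
  simp only [stepWt]
  rw [hp σ (by omega), hq σ (by omega), hp (σ - 1) (by omega), hq (σ - 1) (by omega)]

/-- `pathSum` written as a sum over all paths.  The weights refer to the labels `A₀`, `B₀` that are
present before anything has been removed. -/
theorem pathSum_eq_sum {d : ℕ} : ∀ {ν : ℕ} {x y : ℕ} {A B A₀ B₀ : ℕ → Finset ℕ}
    (Φ : (ℕ → Finset ℕ) → (ℕ → Finset ℕ) → K),
    (∀ σ, ν < σ → A σ = A₀ σ) → (∀ σ, ν < σ → B σ = B₀ σ) →
    pathSum c m s t d ν (s ν x) (t ν y) (lowerWt c m t ν B₀) Φ A B =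
      ∑ k ∈ Finset.range (d + 1), ∑ p ∈ choices (ν + 1) (ν + k + 1) A₀,
        ∑ q ∈ choices (ν + 1) (ν + k + 1) B₀,
          pathWt c m s t A₀ B₀ ν k (Function.update p ν x) (Function.update q ν y) *
            Φ (removeAbove ν k A p) (removeAbove ν k B q) := by
  have hrem0 : ∀ (ν : ℕ) (X : ℕ → Finset ℕ) p, removeAbove ν 0 X p = X := by
    intro ν X p
    funext σ
    simp only [removeAbove]
    rw [if_neg (by omega)]
  have hf : ∀ (ν : ℕ) (A A₀ : ℕ → Finset ℕ) u, A (ν + 1) = A₀ (ν + 1) →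
      fprod c m s (ν + 1) A u = fprod c m s (ν + 1) A₀ u := by
    intro ν A A₀ u h
    simp only [fprod, h]
  induction d with
  | zero =>
    intro ν x y A B A₀ B₀ Φ hA hB
    simp only [zero_add, Finset.range_one, Finset.sum_singleton, add_zero,
      choices_of_le le_rfl, pathSum, hrem0, pathWt_zero, Function.update_self]
    rw [hf ν A A₀ _ (hA _ (by omega))]
  | succ d ih =>
    intro ν x y A B A₀ B₀ Φ hA hB
    simp only [pathSum]
    rw [Finset.sum_range_succ', add_zero, choices_of_le le_rfl, choices_of_le le_rfl,
      Finset.sum_singleton, Finset.sum_singleton, hrem0, hrem0, pathWt_zero,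
      Function.update_self, add_comm (∑ k ∈ Finset.range (d + 1), _)]
    rw [hf ν A A₀ _ (hA _ (by omega)), mul_add]
    congr 1
    have hA1 := hA (ν + 1) (by omega)
    have hB1 := hB (ν + 1) (by omega)
    -- the first step of a path of positive length is split off
    have key : ∀ k, ∑ p ∈ choices (ν + 1) (ν + (k + 1) + 1) A₀,
        ∑ q ∈ choices (ν + 1) (ν + (k + 1) + 1) B₀,
          pathWt c m s t A₀ B₀ ν (k + 1) (Function.update p ν x) (Function.update q ν y) *
            Φ (removeAbove ν (k + 1) A p) (removeAbove ν (k + 1) B q) =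
        ∑ a ∈ A₀ (ν + 1), ∑ b ∈ B₀ (ν + 1),
          ((fprod c m s (ν + 1) A₀ (s ν x))⁻¹ *
            (g c m (ν + 2) (t (ν + 1) b) (t ν y) * g c m (ν + 1) (s (ν + 1) a) (s ν x) *
            gamL c m t (ν + 1) B₀ b * gamR c m s (ν + 1) A₀ a *
            lowerWt c m t ν B₀ (t (ν + 1) b))) *
          ∑ p ∈ choices (ν + 1 + 1) (ν + 1 + k + 1) A₀,
            ∑ q ∈ choices (ν + 1 + 1) (ν + 1 + k + 1) B₀,
              pathWt c m s t A₀ B₀ (ν + 1) k (Function.update p (ν + 1) a)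
                (Function.update q (ν + 1) b) *
              Φ (removeAbove (ν + 1) k (del A (ν + 1) a) p)
                (removeAbove (ν + 1) k (del B (ν + 1) b) q) := by
      intro k
      rw [show ν + (k + 1) + 1 = ν + 1 + k + 1 by omega, sum_choices (by omega)]
      refine Finset.sum_congr rfl fun a ha => ?_
      simp only [sum_choices (show ν + 1 < ν + 1 + k + 1 by omega)]
      rw [Finset.sum_comm]
      refine Finset.sum_congr rfl fun b hb => ?_
      rw [Finset.mul_sum]
      refine Finset.sum_congr rfl fun p hp => ?_
      rw [Finset.mul_sum]
      refine Finset.sum_congr rfl fun q hq => ?_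
      rw [pathWt_succ, ← mul_assoc]
      have hr : ∀ (X : ℕ → Finset ℕ) (p : ℕ → ℕ) a,
          removeAbove ν (k + 1) X (Function.update p (ν + 1) a) =
            removeAbove (ν + 1) k (del X (ν + 1) a) p := by
        intro X p a
        funext σ
        simp only [removeAbove]
        by_cases h : σ = ν + 1
        · subst h
          rw [if_pos (by omega), if_neg (by omega)]
          simp
        · rw [Function.update_of_ne h, del_of_ne _ _ h]
          by_cases h2 : ν + 1 < σ ∧ σ ≤ ν + 1 + k
          · rw [if_pos (by omega), if_pos h2]
          · rw [if_neg (by omega), if_neg h2]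
      rw [hr, hr]
      congr 2
      · simp [stepWt]
      · apply pathWt_congr
        · intro σ hσ
          rw [Function.update_of_ne (by omega)]
        · intro σ hσ
          rw [Function.update_of_ne (by omega)]
    simp only [key]
    rw [Finset.mul_sum, hA1, hB1]
    conv_rhs => rw [Finset.sum_comm]
    refine Finset.sum_congr rfl fun a ha => ?_
    conv_rhs => rw [Finset.sum_comm]
    rw [Finset.mul_sum]
    refine Finset.sum_congr rfl fun b hb => ?_
    have e1 : lowerWt c m t (ν + 1) B = lowerWt c m t (ν + 1) B₀ := by
      funext w; simp only [lowerWt, hB1]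
    have e2 : gamL c m t (ν + 1) B b = gamL c m t (ν + 1) B₀ b := by simp only [gamL, hB1]
    have e3 : gamR c m s (ν + 1) A a = gamR c m s (ν + 1) A₀ a := by simp only [gamR, hA1]
    rw [← Finset.mul_sum, e1, e2, e3, ih (A₀ := A₀) (B₀ := B₀), ← mul_assoc]
    · intro σ hσ
      rw [del_of_ne _ _ (by omega), hA _ (by omega)]
    · intro σ hσ
      rw [del_of_ne _ _ (by omega), hB _ (by omega)]

/-- The factor of the recursion that is present only for `m = 1`. -/
def oddFactor (c : K) (m : ℕ) (s : ℕ → ℕ → K) (A : ℕ → Finset ℕ) (x : ℕ) : K :=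
  ∏ a ∈ (A 1).erase x, if m = 1 then g c m 1 (s 1 a) (s 1 x) / f c m 1 (s 1 a) (s 1 x) else 1

/-- `g_2(t_b, u) γ_1(t_b, t̄_b) f_1(t̄_b, u)` for the parameters `t` of colour `1`. -/
def startWt (c : K) (m : ℕ) (t : ℕ → ℕ → K) (B : ℕ → Finset ℕ) (b : ℕ) (u : K) : K :=
  g c m 2 (t 1 b) u * gamL c m t 1 B b * ∏ b' ∈ (B 1).erase b, f c m 1 (t 1 b') u

/-- The right-hand side of the recursion for the parameter with label `x` of colour `1`. -/
def recRHS (c : K) (m n : ℕ) (s t : ℕ → ℕ → K) (A B : ℕ → Finset ℕ) (x : ℕ) : K :=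
  oddFactor c m s A x * ∑ b ∈ B 1, startWt c m t B b (s 1 x) *
    pathSum c m s t (m + n - 2) 1 (s 1 x) (t 1 b) (lowerWt c m t 1 B) (Z c m n s t)
      (del A 1 x) (del B 1 b)

/-- The defining recursion, written as a sum over paths. -/
theorem Z_eq_recRHS_min {n : ℕ} {A B : ℕ → Finset ℕ} (hmn : 2 ≤ m + n) (h11 : ¬ (m = 1 ∧ n = 1))
    (h : (A 1).Nonempty) : Z c m n s t A B = recRHS c m n s t A B ((A 1).min' h) := by
  rw [Z, if_neg (by omega), if_neg h11, dif_pos h, recRHS]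
  set x := (A 1).min' h
  simp only
  -- write both sides as sums over the number of colours visited and over the chosen labels
  have e : ∀ b ∈ B 1, startWt c m t B b (s 1 x) *
      pathSum c m s t (m + n - 2) 1 (s 1 x) (t 1 b) (lowerWt c m t 1 B) (Z c m n s t)
      (del A 1 x) (del B 1 b) = startWt c m t B b (s 1 x) * ∑ k ∈ Finset.range (m + n - 2 + 1),
        ∑ p ∈ choices (1 + 1) (1 + k + 1) A, ∑ q ∈ choices (1 + 1) (1 + k + 1) B,
          pathWt c m s t A B 1 k (Function.update p 1 x) (Function.update q 1 b) *
            Z c m n s t (removeAbove 1 k (del A 1 x) p) (removeAbove 1 k (del B 1 b) q) := by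
    intro b _
    rw [pathSum_eq_sum (A₀ := A) (B₀ := B)]
    · intro σ hσ
      rw [del_of_ne _ _ (by omega)]
    · intro σ hσ
      rw [del_of_ne _ _ (by omega)]
  rw [Finset.sum_congr rfl e]
  simp only [Finset.mul_sum]
  rw [show m + n - 2 + 1 = m + n - 1 by omega]
  conv_rhs => rw [Finset.sum_comm]
  refine Finset.sum_congr rfl fun k _ => ?_
  conv_rhs => rw [Finset.sum_comm, show 1 + k + 1 = k + 2 by omega]
  refine Finset.sum_congr rfl fun p _ => ?_
  rw [sum_choices (by omega)]
  refine Finset.sum_congr rfl fun b hb => Finset.sum_congr rfl fun q _ => ?_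
  have hr : ∀ (X : ℕ → Finset ℕ) (p : ℕ → ℕ) a,
      remove (k + 2) X (Function.update p 1 a) = removeAbove 1 k (del X 1 a) p := by
    intro X p a
    funext σ
    simp only [remove, removeAbove]
    by_cases h : σ = 1
    · subst h
      rw [if_pos (by omega), if_neg (by omega)]
      simp
    · rw [Function.update_of_ne h, del_of_ne _ _ h]
      by_cases h2 : 1 < σ ∧ σ ≤ 1 + k
      · rw [if_pos (by omega), if_pos h2]
      · rw [if_neg (by omega), if_neg h2]
  -- compare the weights factor by factor
  rw [hr, hr, ← mul_assoc, ← mul_assoc]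
  congr 1
  rw [weight, oddFactor, startWt, pathWt]
  simp only [Function.update_self]
  have e1 : (if m = 1 then (∏ a ∈ (A 1).erase x, g c m 1 (s 1 a) (s 1 x)) /
      ∏ a ∈ (A 1).erase x, f c m 1 (s 1 a) (s 1 x) else 1) =
      ∏ a ∈ (A 1).erase x, if m = 1 then g c m 1 (s 1 a) (s 1 x) / f c m 1 (s 1 a) (s 1 x)
        else 1 := by
    split_ifs <;> simp
  rw [e1, show k + 2 - 1 = 1 + k by omega, show 1 + k + 1 = k + 2 by omega, show 1 + 1 = 2 by rfl]
  have e2 : ∀ P Q : ℕ → ℕ, ∏ ν ∈ Finset.Ico 2 (k + 2),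
      (g c m (ν + 1) (t ν (Q ν)) (t (ν - 1) (Q (ν - 1))) *
        g c m ν (s ν (P ν)) (s (ν - 1) (P (ν - 1))) *
        (∏ b ∈ (B ν).erase (Q ν), gam c m ν (t ν (Q ν)) (t ν b)) *
        (∏ a ∈ (A ν).erase (P ν), gam c m ν (s ν a) (s ν (P ν)))) /
      ((∏ a ∈ A ν, f c m ν (s ν a) (s (ν - 1) (P (ν - 1)))) *
        ∏ b ∈ B (ν - 1), f c m ν (t ν (Q ν)) (t (ν - 1) b)) =
      ∏ σ ∈ Finset.Ico 2 (k + 2), ((fprod c m s σ A (s (σ - 1) (P (σ - 1))))⁻¹ *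
        stepWt c m s t A B P Q σ) := by
    intro P Q
    refine Finset.prod_congr rfl fun ν hν => ?_
    rw [Finset.mem_Ico] at hν
    simp only [stepWt, lowerWt, fprod, gamL, gamR, Finset.prod_inv_distrib]
    rw [show ν - 1 + 1 = ν by omega, div_eq_mul_inv, mul_inv]
    ring
  rw [e2]
  simp only [gamL, fprod]
  rw [div_eq_mul_inv]
  ring

end

/-! ### Separated parameters and the exchange property -/

section
variable {K : Type*}

/-- `(x, x')` is `(u, u')` or `(u', u)`. -/
def Swap (u u' x x' : K) : Prop := (x = u ∧ x' = u') ∨ (x = u' ∧ x' = u)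

theorem Swap.refl (u u' : K) : Swap u u' u u' := Or.inl ⟨rfl, rfl⟩

theorem Swap.swap (u u' : K) : Swap u u' u' u := Or.inr ⟨rfl, rfl⟩

theorem Swap.forall {u u' x x' : K} (h : Swap u u' x x') {p : K → Prop} (hu : p u) (hu' : p u') :
    p x ∧ p x' := by
  rcases h with ⟨rfl, rfl⟩ | ⟨rfl, rfl⟩
  · exact ⟨hu, hu'⟩
  · exact ⟨hu', hu⟩

end

section
variable {K : Type*} [Field K] {c : K} {m : ℕ}

theorem cg_self (c : K) (m : ℕ) : cg c m m = c := by simp [cg]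

theorem cg_succ_self (c : K) (m : ℕ) : cg c m (m + 1) = -c := by simp [cg]

theorem cg_succ {m i : ℕ} (c : K) (h : i ≠ m) : cg c m (i + 1) = cg c m i := by
  unfold cg
  by_cases h1 : i ≤ m
  · rw [if_pos h1, if_pos (by omega)]
  · rw [if_neg h1, if_neg (by omega)]

theorem cg_eq_or (c : K) (m i : ℕ) : cg c m i = c ∨ cg c m i = -c := by
  unfold cg; split_ifs <;> simp

theorem cg_ne_zero (hc : c ≠ 0) (m i : ℕ) : cg c m i ≠ 0 := by
  rcases cg_eq_or c m i with h | h <;> simp [h, hc]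

theorem Sep.symm {u v : K} (h : Sep c u v) : Sep c v u := by
  obtain ⟨h1, h2, h3⟩ := h
  refine ⟨fun h => h1 ?_, fun h => h3 ?_, fun h => h2 ?_⟩
  · linear_combination -h
  · linear_combination -h
  · linear_combination -h

theorem Sep.ne {u v : K} (h : Sep c u v) : u ≠ v := sub_ne_zero.mp h.1

theorem Sep.sub_add_ne {u v : K} (h : Sep c u v) (m i : ℕ) : u - v + cg c m i ≠ 0 := by
  intro h0
  rcases cg_eq_or c m i with h1 | h1
  · exact h.2.2 (by rw [h1] at h0; linear_combination h0)
  · exact h.2.1 (by rw [h1] at h0; linear_combination h0)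

theorem f_eq {u v : K} (h : u - v ≠ 0) (i : ℕ) :
    f c m i u v = (u - v + cg c m i) / (u - v) := by
  rw [f, g]; field_simp

theorem Sep.f_ne {u v : K} (h : Sep c u v) (m i : ℕ) : f c m i u v ≠ 0 := by
  rw [f_eq h.1]
  exact div_ne_zero (h.sub_add_ne m i) h.1

theorem Sep.g_ne (hc : c ≠ 0) {u v : K} (h : Sep c u v) (m i : ℕ) : g c m i u v ≠ 0 :=
  div_ne_zero (cg_ne_zero hc m i) h.1

theorem Sep.gam_ne (hc : c ≠ 0) {u v : K} (h : Sep c u v) (m i : ℕ) : gam c m i u v ≠ 0 := by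
  unfold gam
  split_ifs
  · exact h.g_ne hc m i
  · exact h.f_ne m i

/-- On the four points obtained from `(u, u', v, v')` by exchanging `u` with `u'` or `v` with `v'`,
the function `F` is an affine function of `x y + x' y' - κ (x + y')`.  Sums over two paths have this
property in their starting values. -/
def Exchange (κ u u' v v' : K) (F : K → K → K → K → K) : Prop :=
  ∃ α β, ∀ x x' y y', Swap u u' x x' → Swap v v' y y' →
    F x x' y y' = α + β * (x * y + x' * y' - κ * (x + y'))

theorem Exchange.add {κ u u' v v' : K} {F G : K → K → K → K → K} (hF : Exchange κ u u' v v' F)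
    (hG : Exchange κ u u' v v' G) :
    Exchange κ u u' v v' fun x x' y y' => F x x' y y' + G x x' y y' := by
  obtain ⟨α, β, h⟩ := hF
  obtain ⟨α', β', h'⟩ := hG
  refine ⟨α + α', β + β', fun x x' y y' hx hy => ?_⟩
  dsimp only
  rw [h _ _ _ _ hx hy, h' _ _ _ _ hx hy]
  ring

theorem Exchange.const_mul {κ u u' v v' : K} {F : K → K → K → K → K} (r : K)
    (hF : Exchange κ u u' v v' F) :
    Exchange κ u u' v v' fun x x' y y' => r * F x x' y y' := by
  obtain ⟨α, β, h⟩ := hF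
  refine ⟨r * α, r * β, fun x x' y y' hx hy => ?_⟩
  dsimp only
  rw [h _ _ _ _ hx hy]
  ring

theorem Exchange.const (κ u u' v v' r : K) : Exchange κ u u' v v' fun _ _ _ _ => r :=
  ⟨r, 0, fun x x' y y' _ _ => by ring⟩

theorem Exchange.sum {ι : Type*} {κ u u' v v' : K} {F : ι → K → K → K → K → K} {S : Finset ι}
    (hF : ∀ i ∈ S, Exchange κ u u' v v' (F i)) :
    Exchange κ u u' v v' fun x x' y y' => ∑ i ∈ S, F i x x' y y' := by
  classical
  induction S using Finset.induction_on with
  | empty => simpa using Exchange.const κ u u' v v' 0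
  | insert i S hi ih =>
    simp only [Finset.sum_insert hi]
    exact (hF i (by simp)).add (ih fun j hj => hF j (by simp [hj]))

theorem Exchange.congr {κ u u' v v' : K} {F G : K → K → K → K → K} (hF : Exchange κ u u' v v' F)
    (h : ∀ x x' y y', Swap u u' x x' → Swap v v' y y' → G x x' y y' = F x x' y y') :
    Exchange κ u u' v v' G := by
  obtain ⟨α, β, h'⟩ := hF
  exact ⟨α, β, fun x x' y y' hx hy => by rw [h _ _ _ _ hx hy, h' _ _ _ _ hx hy]⟩

/-- The numerator for two paths of which exactly one continues, to the values `a`, `b`. -/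
theorem exchange_one (κ u u' v v' a b : K) : Exchange κ u u' v v' fun x x' y y' =>
    (a - x) * (b - y + κ) + (b - y') * (a - x' + κ) := by
  refine ⟨2 * a * b - a * (v + v') - b * (u + u') + κ * (a + b), 1, fun x x' y y' hx hy => ?_⟩
  rcases hx with ⟨rfl, rfl⟩ | ⟨rfl, rfl⟩ <;> rcases hy with ⟨rfl, rfl⟩ | ⟨rfl, rfl⟩ <;> ring

/-- The factor for two paths that go from `x` to `p` and from `x'` to `q`, cleared of the
denominator `(p - x) (p - x') (q - x) (q - x')`, which is symmetric in `x` and `x'`. -/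
def halfTerm (c : K) (m i : ℕ) (p q x x' : K) : K :=
  gam c m i q p * (q - x) * (p - x' + cg c m i)

/-- The function `F` is determined by two constants.  In terms of these, the sum over the four ways
to connect the values depends on the weight `w` only through the sums `q0`, `r0` and the first
moments `q1`, `r1` of `w` over the two arrangements. -/
theorem exchange_pair_aux {κ κ₁ u u' v v' a a' b b' : K} {w : K → K → K → K → K}
    (q0 q1 r0 r1 : K → K → K) (hq0 : ∀ x x', w a a' x x' + w a' a x x' = q0 x x')
    (hq1 : ∀ x x', a * w a a' x x' + a' * w a' a x x' = q1 x x')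
    (hr0 : ∀ x x', w b b' x x' + w b' b x x' = r0 x x')
    (hr1 : ∀ x x', b * w b b' x x' + b' * w b' b x x' = r1 x x')
    {F : K → K → K → K → K} (hF : Exchange κ₁ a a' b b' F)
    (h : ∀ α β, Exchange κ u u' v v' fun x x' y y' =>
      α * (q0 x x' * r0 y' y) + β * ((b + b' - κ₁) * q1 x x' * r0 y' y +
      (a + a' - κ₁) * q0 x x' * r1 y' y - 2 * q1 x x' * r1 y' y)) :
    Exchange κ u u' v v' fun x x' y y' =>
      w a a' x x' * w b' b y' y * F a a' b b' + w a' a x x' * w b' b y' y * F a' a b b' +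
      w a a' x x' * w b b' y' y * F a a' b' b + w a' a x x' * w b b' y' y * F a' a b' b := by
  obtain ⟨α, β, hα⟩ := hF
  refine (h α β).congr fun x x' y y' _ _ => ?_
  rw [hα _ _ _ _ (Swap.refl _ _) (Swap.refl _ _), hα _ _ _ _ (Swap.swap _ _) (Swap.refl _ _),
    hα _ _ _ _ (Swap.refl _ _) (Swap.swap _ _), hα _ _ _ _ (Swap.swap _ _) (Swap.swap _ _),
    ← hq0, ← hq1, ← hr0, ← hr1]
  ring

/-- Sum and first moment of `halfTerm` over the two arrangements, at the colour `m`. -/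
theorem halfTerm_odd {p q : K} (x x' : K) (h : p - q ≠ 0) :
    halfTerm c m m p q x x' + halfTerm c m m q p x x' = c * (x - x' + c) ∧
    p * halfTerm c m m p q x x' + q * halfTerm c m m q p x x' =
      c * (-(p * q) + (p + q) * x - x * x' + c * x) := by
  simp only [halfTerm, gam, if_true, g, cg_self]
  rw [show q - p = -(p - q) by ring]
  constructor <;> field_simp <;> ring

/-- Sum and first moment of `halfTerm` over the two arrangements, at the colours other than `m`. -/
theorem halfTerm_even {i : ℕ} (hi : i ≠ m) {p q : K} (x x' : K) (h : p - q ≠ 0) :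
    halfTerm c m i p q x x' + halfTerm c m i q p x x' =
      2 * p * q - (p + q) * (x + x') + 2 * x * x' +
      cg c m i * (p + q) - cg c m i * (x + x') + cg c m i ^ 2 ∧
    p * halfTerm c m i p q x x' + q * halfTerm c m i q p x x' =
      p * q * (p + q + cg c m i) + (p + q - cg c m i) * x * x' +
      (2 * p * q - (p + q) ^ 2 + cg c m i ^ 2) * x - 2 * p * q * x' := by
  simp only [halfTerm, gam, if_neg hi, f, g]
  rw [show q - p = -(p - q) by ring]
  constructor <;> field_simp <;> ring

theorem exchange_odd [CharZero K] (c u u' v v' a a' b b' α β : K) :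
    Exchange c u u' v v' fun x x' y y' =>
    α * (c * (x - x' + c) * (c * (y' - y + c))) +
      β * ((b + b' - -c) * (c * (-(a * a') + (a + a') * x - x * x' + c * x)) * (c * (y' - y + c)) +
      (a + a' - -c) * (c * (x - x' + c)) * (c * (-(b * b') + (b + b') * y' - y' * y + c * y')) -
      2 * (c * (-(a * a') + (a + a') * x - x * x' + c * x)) *
        (c * (-(b * b') + (b + b') * y' - y' * y + c * y'))) := by
  -- the constant is the average of the function over the permutations of the values, minus that of
  -- the other term
  refine ⟨c ^ 2 * (α * c ^ 2 + β * (
      (b + b' + c) * c * (-(a * a') - u * u' + (a + a' + c) * (u + u') / 2) +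
      (a + a' + c) * c * (-(b * b') - v * v' + (b + b' + c) * (v + v') / 2) -
      2 * (-(a * a') - u * u' + (a + a' + c) * (u + u') / 2) *
        (-(b * b') - v * v' + (b + b' + c) * (v + v') / 2))) -
      c ^ 2 * (-2 * α - (b + b' + c) * (a + a' + c) * β) *
        ((u + u') * (v + v') / 2 - c * (u + u' + v + v') / 2),
    c ^ 2 * (-2 * α - (b + b' + c) * (a + a' + c) * β), fun x x' y y' hx hy => ?_⟩
  rcases hx with ⟨rfl, rfl⟩ | ⟨rfl, rfl⟩ <;> rcases hy with ⟨rfl, rfl⟩ | ⟨rfl, rfl⟩ <;> ring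

theorem exchange_even [CharZero K] (κ u u' v v' a a' b b' α β : K) :
    Exchange κ u u' v v' fun x x' y y' =>
    α * ((2 * a * a' - (a + a') * (x + x') + 2 * x * x' + κ * (a + a') - κ * (x + x') + κ ^ 2) *
      (2 * b * b' - (b + b') * (y' + y) + 2 * y' * y + κ * (b + b') - κ * (y' + y) + κ ^ 2)) +
    β * ((b + b' - κ) * (a * a' * (a + a' + κ) + (a + a' - κ) * x * x' +
      (2 * a * a' - (a + a') ^ 2 + κ ^ 2) * x - 2 * a * a' * x') *
      (2 * b * b' - (b + b') * (y' + y) + 2 * y' * y + κ * (b + b') - κ * (y' + y) + κ ^ 2) +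
      (a + a' - κ) *
      (2 * a * a' - (a + a') * (x + x') + 2 * x * x' + κ * (a + a') - κ * (x + x') + κ ^ 2) *
      (b * b' * (b + b' + κ) + (b + b' - κ) * y' * y +
      (2 * b * b' - (b + b') ^ 2 + κ ^ 2) * y' - 2 * b * b' * y) -
      2 * (a * a' * (a + a' + κ) + (a + a' - κ) * x * x' +
      (2 * a * a' - (a + a') ^ 2 + κ ^ 2) * x - 2 * a * a' * x') *
      (b * b' * (b + b' + κ) + (b + b' - κ) * y' * y +
      (2 * b * b' - (b + b') ^ 2 + κ ^ 2) * y' - 2 * b * b' * y)) := by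
  -- the averages of the sums and moments over the permutations of the values
  set A0 := 2 * a * a' - (a + a') * (u + u') + 2 * u * u' + κ * (a + a') - κ * (u + u') + κ ^ 2
    with hA0
  set B0 := 2 * b * b' - (b + b') * (v + v') + 2 * v * v' + κ * (b + b') - κ * (v + v') + κ ^ 2
    with hB0
  set A1 := a * a' * (a + a' + κ) + (a + a' - κ) * u * u' + (κ ^ 2 - (a + a') ^ 2) * (u + u') / 2
    with hA1
  set B1 := b * b' * (b + b' + κ) + (b + b' - κ) * v * v' + (κ ^ 2 - (b + b') ^ 2) * (v + v') / 2
    with hB1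
  refine ⟨α * (A0 * B0) + β * ((b + b' - κ) * A1 * B0 + (a + a' - κ) * A0 * B1 - 2 * A1 * B1) -
      (κ ^ 2 - (a - a') ^ 2) * (κ ^ 2 - (b - b') ^ 2) * β *
        ((u + u') * (v + v') / 2 - κ * (u + u' + v + v') / 2),
    (κ ^ 2 - (a - a') ^ 2) * (κ ^ 2 - (b - b') ^ 2) * β, fun x x' y y' hx hy => ?_⟩
  rw [hA0, hB0, hA1, hB1]
  rcases hx with ⟨rfl, rfl⟩ | ⟨rfl, rfl⟩ <;> rcases hy with ⟨rfl, rfl⟩ | ⟨rfl, rfl⟩ <;> ring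

/-- The exchange property passes from one colour to the previous one: the sum over the four ways in
which two paths can go on to the values `a, a'` and `b, b'` has the property in the starting values
if the continuation `F` has it in `a, a'` and `b, b'`. -/
theorem exchange_pair [CharZero K] {i : ℕ} {a a' b b' : K} (u u' v v' : K)
    (ha : a - a' ≠ 0) (hb : b - b' ≠ 0)
    {F : K → K → K → K → K} (hF : Exchange (cg c m (i + 1)) a a' b b' F) :
    Exchange (cg c m i) u u' v v' fun x x' y y' =>
      halfTerm c m i a a' x x' * halfTerm c m i b' b y' y * F a a' b b' +
      halfTerm c m i a' a x x' * halfTerm c m i b' b y' y * F a' a b b' +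
      halfTerm c m i a a' x x' * halfTerm c m i b b' y' y * F a a' b' b +
      halfTerm c m i a' a x x' * halfTerm c m i b b' y' y * F a' a b' b := by
  by_cases him : i = m
  · subst him
    refine exchange_pair_aux _ _ _ _ (fun x x' => (halfTerm_odd x x' ha).1)
      (fun x x' => (halfTerm_odd x x' ha).2) (fun x x' => (halfTerm_odd x x' hb).1)
      (fun x x' => (halfTerm_odd x x' hb).2) hF fun α β => ?_
    rw [cg_succ_self, cg_self]
    exact exchange_odd ..
  · refine exchange_pair_aux _ _ _ _ (fun x x' => (halfTerm_even him x x' ha).1)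
      (fun x x' => (halfTerm_even him x x' ha).2) (fun x x' => (halfTerm_even him x x' hb).1)
      (fun x x' => (halfTerm_even him x x' hb).2) hF fun α β => ?_
    rw [cg_succ c him]
    exact exchange_even ..

end

/-! ### Two paths -/

section
variable {K : Type*} [Field K] {c : K} {m : ℕ} {s t : ℕ → ℕ → K}

/-- Any two parameters of the family are separated. -/
def SepFam (c : K) (s : ℕ → ℕ → K) (A : ℕ → Finset ℕ) : Prop :=
  ∀ ν, ∀ a ∈ A ν, ∀ ν', ∀ a' ∈ A ν', (ν, a) ≠ (ν', a') → Sep c (s ν a) (s ν' a')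

theorem SepFam.mono {A A' : ℕ → Finset ℕ} (h : SepFam c s A) (hA : ∀ ν, A' ν ⊆ A ν) :
    SepFam c s A' :=
  fun ν a ha ν' a' ha' hne => h ν a (hA _ ha) ν' a' (hA _ ha') hne

theorem SepFam.del {A : ℕ → Finset ℕ} (h : SepFam c s A) (μ i : ℕ) : SepFam c s (del A μ i) :=
  h.mono fun ν => del_subset A μ i ν

theorem SepFam.of_ne {A : ℕ → Finset ℕ} (h : SepFam c s A) {ν a a' : ℕ} (ha : a ∈ A ν)
    (ha' : a' ∈ A ν) (hne : a ≠ a') : Sep c (s ν a) (s ν a') :=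
  h ν a ha ν a' ha' (by simpa using hne)

/-- The sum over two paths of which the first starts with the values `u`, `v` of colour `ν` and the
second with `u'`, `v'`.  The function `H` is the contribution to `1 / f_{ν+1}(·, t̄^ν)` of the
labels that neither path has removed.  Both `v` and `v'` contribute to this weight for the first
path, but only `v'` for the second one, since the first path has already removed its label. -/
def twoPath (c : K) (m : ℕ) (s t : ℕ → ℕ → K) (d ν : ℕ) (H : K → K)
    (Φ : (ℕ → Finset ℕ) → (ℕ → Finset ℕ) → K) (A B : ℕ → Finset ℕ) (u u' v v' : K) : K :=
  pathSum c m s t d ν u v (fun w => H w * (f c m (ν + 1) w v)⁻¹ * (f c m (ν + 1) w v')⁻¹)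
    (fun A' B' => pathSum c m s t d ν u' v' (fun w => H w * (f c m (ν + 1) w v')⁻¹) Φ A' B') A B

theorem lowerWt_del {B : ℕ → Finset ℕ} {ν b : ℕ} (hb : b ∈ B ν) (w : K) :
    lowerWt c m t ν B w = lowerWt c m t ν (del B ν b) w * (f c m (ν + 1) w (t ν b))⁻¹ := by
  simp only [lowerWt, del_same]
  rw [Finset.prod_erase_mul _ _ hb]

theorem fprod_del {A : ℕ → Finset ℕ} {ν a : ℕ} (ha : a ∈ A ν) (u : K) :
    fprod c m s ν A u = fprod c m s ν (del A ν a) u * f c m ν (s ν a) u := by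
  simp only [fprod, del_same]
  rw [Finset.prod_erase_mul _ _ ha]

theorem gamL_del {B : ℕ → Finset ℕ} {ν b b' : ℕ} (hb : b' ∈ B ν) (hne : b ≠ b') :
    gamL c m t ν B b = gam c m ν (t ν b) (t ν b') * gamL c m t ν (del B ν b') b := by
  simp only [gamL, del_same]
  rw [Finset.erase_right_comm]
  exact (Finset.mul_prod_erase _ (fun x => gam c m ν (t ν b) (t ν x)) (by simp [hb, hne.symm])).symm

theorem gamR_del {A : ℕ → Finset ℕ} {ν a a' : ℕ} (ha : a' ∈ A ν) (hne : a ≠ a') :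
    gamR c m s ν A a = gam c m ν (s ν a') (s ν a) * gamR c m s ν (del A ν a') a := by
  simp only [gamR, del_same]
  rw [Finset.erase_right_comm]
  exact (Finset.mul_prod_erase _ (fun x => gam c m ν (s ν x) (s ν a)) (by simp [ha, hne.symm])).symm

/-- The coefficient of the terms of `twoPath` in which exactly one of the paths continues. -/
def oneCoef (c : K) (m i : ℕ) (a b x x' y y' : K) : K :=
  g c m (i + 1) b y' * g c m i a x' * (f c m i b y')⁻¹ +
    g c m (i + 1) b y * g c m i a x * (f c m i b y)⁻¹ * (f c m i b y')⁻¹ * f c m i a x'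

/-- The coefficient of the terms of `twoPath` in which both paths continue. -/
def pairCoef (c : K) (m i : ℕ) (a a' b b' x x' y y' : K) : K :=
  g c m (i + 1) b y * g c m i a x * (f c m i b y)⁻¹ * (f c m i b y')⁻¹ * f c m i a x' *
    (g c m (i + 1) b' y' * g c m i a' x' * (f c m i b' y')⁻¹)

/-- A path followed by a second one, each of which has already removed its label of colour `ν`. -/
theorem pathSum_pathSum_del {d ν : ℕ} {u u' : K} (Φ : (ℕ → Finset ℕ) → (ℕ → Finset ℕ) → K)
    (A : ℕ → Finset ℕ) {B : ℕ → Finset ℕ} (a a' : ℕ) {b b' : ℕ} (hb : b ∈ B ν)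
    (hb' : b' ∈ (B ν).erase b) :
    pathSum c m s t d ν u (t ν b) (lowerWt c m t ν B) (fun A' B' =>
      pathSum c m s t d ν u' (t ν b') (lowerWt c m t ν (del B ν b)) Φ (del A' ν a') (del B' ν b'))
      (del A ν a) (del B ν b) =
    twoPath c m s t d ν (lowerWt c m t ν (del (del B ν b) ν b')) Φ (del (del A ν a) ν a')
      (del (del B ν b) ν b') u u' (t ν b) (t ν b') := by
  rw [pathSum_del (fun A' B' => pathSum c m s t d ν u' (t ν b')
    (lowerWt c m t ν (del B ν b)) Φ A' B') _ _ _ _ le_rfl, twoPath]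
  have hb'2 : b' ∈ del B ν b ν := by simpa using hb'
  have e1 : lowerWt c m t ν (del B ν b) = fun w => lowerWt c m t ν (del (del B ν b) ν b') w *
      (f c m (ν + 1) w (t ν b'))⁻¹ := funext fun w => lowerWt_del hb'2 w
  have e2 : lowerWt c m t ν B = fun w => lowerWt c m t ν (del (del B ν b) ν b') w *
      (f c m (ν + 1) w (t ν b))⁻¹ * (f c m (ν + 1) w (t ν b'))⁻¹ :=
    funext fun w => by rw [lowerWt_del hb, lowerWt_del hb'2]; ring
  rw [← e1, ← e2]

/-- The next step of two paths: neither of them continues, or exactly one, or both. -/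
theorem twoPath_succ {d ν : ℕ} {H : K → K} {Φ : (ℕ → Finset ℕ) → (ℕ → Finset ℕ) → K}
    {A B : ℕ → Finset ℕ} {u u' v v' : K}
    (hu' : ∀ a ∈ A (ν + 1), f c m (ν + 1) (s (ν + 1) a) u' ≠ 0) :
    twoPath c m s t (d + 1) ν H Φ A B u u' v v' =
      (fprod c m s (ν + 1) A u)⁻¹ * (fprod c m s (ν + 1) A u')⁻¹ *
      (Φ A B + (∑ a ∈ A (ν + 1), ∑ b ∈ B (ν + 1),
        (gamL c m t (ν + 1) B b * gamR c m s (ν + 1) A a * H (t (ν + 1) b)) *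
        pathSum c m s t d (ν + 1) (s (ν + 1) a) (t (ν + 1) b) (lowerWt c m t (ν + 1) B) Φ
          (del A (ν + 1) a) (del B (ν + 1) b) *
        oneCoef c m (ν + 1) (s (ν + 1) a) (t (ν + 1) b) u u' v v') +
      ∑ a ∈ A (ν + 1), ∑ a' ∈ (A (ν + 1)).erase a, ∑ b ∈ B (ν + 1), ∑ b' ∈ (B (ν + 1)).erase b,
        (gamL c m t (ν + 1) B b * gamL c m t (ν + 1) (del B (ν + 1) b) b' *
          (gamR c m s (ν + 1) A a * gamR c m s (ν + 1) (del A (ν + 1) a) a') *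
          (H (t (ν + 1) b) * H (t (ν + 1) b'))) *
        pairCoef c m (ν + 1) (s (ν + 1) a) (s (ν + 1) a') (t (ν + 1) b) (t (ν + 1) b') u u' v v' *
        twoPath c m s t d (ν + 1) (lowerWt c m t (ν + 1) (del (del B (ν + 1) b) (ν + 1) b')) Φ
          (del (del A (ν + 1) a) (ν + 1) a') (del (del B (ν + 1) b) (ν + 1) b')
          (s (ν + 1) a) (s (ν + 1) a') (t (ν + 1) b) (t (ν + 1) b')) := by
  have hP : ∀ a ∈ A (ν + 1), (fprod c m s (ν + 1) (del A (ν + 1) a) u')⁻¹ =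
      (fprod c m s (ν + 1) A u')⁻¹ * f c m (ν + 1) (s (ν + 1) a) u' := by
    intro a ha
    rw [fprod_del ha, mul_inv, inv_mul_cancel_right₀ (hu' a ha)]
  -- the second path, seen after the first one has removed `a` and `b`
  have key : ∀ a ∈ A (ν + 1), ∀ b ∈ B (ν + 1),
      pathSum c m s t d (ν + 1) (s (ν + 1) a) (t (ν + 1) b) (lowerWt c m t (ν + 1) B)
        (fun A' B' => pathSum c m s t (d + 1) ν u' v'
          (fun w => H w * (f c m (ν + 1) w v')⁻¹) Φ A' B')
        (del A (ν + 1) a) (del B (ν + 1) b) =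
      (fprod c m s (ν + 1) A u')⁻¹ * f c m (ν + 1) (s (ν + 1) a) u' *
      (pathSum c m s t d (ν + 1) (s (ν + 1) a) (t (ν + 1) b) (lowerWt c m t (ν + 1) B) Φ
        (del A (ν + 1) a) (del B (ν + 1) b) +
      ∑ a' ∈ (A (ν + 1)).erase a, ∑ b' ∈ (B (ν + 1)).erase b,
        (g c m (ν + 2) (t (ν + 1) b') v' * g c m (ν + 1) (s (ν + 1) a') u' *
          gamL c m t (ν + 1) (del B (ν + 1) b) b' * gamR c m s (ν + 1) (del A (ν + 1) a) a' *
          (H (t (ν + 1) b') * (f c m (ν + 1) (t (ν + 1) b') v')⁻¹)) *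
        twoPath c m s t d (ν + 1) (lowerWt c m t (ν + 1) (del (del B (ν + 1) b) (ν + 1) b')) Φ
          (del (del A (ν + 1) a) (ν + 1) a') (del (del B (ν + 1) b) (ν + 1) b')
          (s (ν + 1) a) (s (ν + 1) a') (t (ν + 1) b) (t (ν + 1) b')) := by
    intro a ha b hb
    rw [← hP a ha]
    have e : ∀ A' B', Below (ν + 1) (del A (ν + 1) a) (del B (ν + 1) b) A' B' →
        pathSum c m s t (d + 1) ν u' v' (fun w => H w * (f c m (ν + 1) w v')⁻¹) Φ A' B' =
        (fprod c m s (ν + 1) (del A (ν + 1) a) u')⁻¹ * (Φ A' B' +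
          ∑ a' ∈ (A (ν + 1)).erase a, ∑ b' ∈ (B (ν + 1)).erase b,
          (g c m (ν + 2) (t (ν + 1) b') v' * g c m (ν + 1) (s (ν + 1) a') u' *
          gamL c m t (ν + 1) (del B (ν + 1) b) b' * gamR c m s (ν + 1) (del A (ν + 1) a) a' *
          (H (t (ν + 1) b') * (f c m (ν + 1) (t (ν + 1) b') v')⁻¹)) *
          pathSum c m s t d (ν + 1) (s (ν + 1) a') (t (ν + 1) b')
            (lowerWt c m t (ν + 1) (del B (ν + 1) b)) Φ
            (del A' (ν + 1) a') (del B' (ν + 1) b')) := by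
      intro A' B' h
      have hA := h.eqA (ν + 1) le_rfl
      have hB := h.eqB (ν + 1) le_rfl
      have h1 : fprod c m s (ν + 1) A' u' = fprod c m s (ν + 1) (del A (ν + 1) a) u' := by
        simp only [fprod, hA]
      have h2 : gamL c m t (ν + 1) B' = gamL c m t (ν + 1) (del B (ν + 1) b) := by
        funext; simp only [gamL, hB]
      have h3 : gamR c m s (ν + 1) A' = gamR c m s (ν + 1) (del A (ν + 1) a) := by
        funext; simp only [gamR, hA]
      have h4 : lowerWt c m t (ν + 1) B' = lowerWt c m t (ν + 1) (del B (ν + 1) b) := by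
        funext; simp only [lowerWt, hB]
      rw [pathSum, h1, h2, h3, h4, hA, hB, del_same, del_same]
    rw [pathSum_congr_right e, pathSum_mul, pathSum_add, pathSum_sum]
    congr 2
    refine Finset.sum_congr rfl fun a' ha' => ?_
    rw [pathSum_sum]
    refine Finset.sum_congr rfl fun b' hb' => ?_
    rw [pathSum_mul]
    congr 1
    exact pathSum_pathSum_del Φ A a a' hb hb'
  have e0 : pathSum c m s t (d + 1) ν u' v' (fun w => H w * (f c m (ν + 1) w v')⁻¹) Φ A B =
      (fprod c m s (ν + 1) A u')⁻¹ *
      (Φ A B + ∑ a ∈ A (ν + 1), ∑ b ∈ B (ν + 1),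
        (g c m (ν + 2) (t (ν + 1) b) v' * g c m (ν + 1) (s (ν + 1) a) u' *
          gamL c m t (ν + 1) B b * gamR c m s (ν + 1) A a *
          (H (t (ν + 1) b) * (f c m (ν + 1) (t (ν + 1) b) v')⁻¹)) *
        pathSum c m s t d (ν + 1) (s (ν + 1) a) (t (ν + 1) b) (lowerWt c m t (ν + 1) B) Φ
          (del A (ν + 1) a) (del B (ν + 1) b)) := by rw [pathSum]
  rw [twoPath, pathSum, e0, mul_assoc]
  congr 1
  rw [mul_add, mul_add, mul_add, add_assoc, add_assoc]
  congr 1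
  simp only [Finset.mul_sum]
  rw [← Finset.sum_add_distrib, ← Finset.sum_add_distrib]
  refine Finset.sum_congr rfl fun a ha => ?_
  conv_rhs => rw [Finset.sum_comm]
  rw [← Finset.sum_add_distrib, ← Finset.sum_add_distrib]
  refine Finset.sum_congr rfl fun b hb => ?_
  rw [key a ha b hb]
  simp only [mul_add, Finset.mul_sum]
  rw [← add_assoc]
  congr 1
  · simp only [oneCoef]; ring
  · refine Finset.sum_congr rfl fun a' ha' => Finset.sum_congr rfl fun b' hb' => ?_
    simp only [pairCoef]; ring

/-- Up to a factor that is symmetric in `x, x'` and in `y, y'`, the coefficient `oneCoef` is the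
function of `exchange_one`. -/
theorem oneCoef_eq {i : ℕ} {a b x x' y y' : K} (hx : Sep c a x) (hx' : Sep c a x')
    (hy : Sep c b y) (hy' : Sep c b y') :
    oneCoef c m i a b x x' y y' = cg c m (i + 1) * cg c m i *
      ((b - y + cg c m i) * (b - y' + cg c m i) * (a - x) * (a - x'))⁻¹ *
      ((a - x) * (b - y + cg c m i) + (b - y') * (a - x' + cg c m i)) := by
  have h1 := hx.1
  have h2 := hx'.1
  have h3 := hy.1
  have h4 := hy'.1
  have h5 := hy.sub_add_ne m i
  have h6 := hy'.sub_add_ne m i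
  rw [oneCoef, f_eq h3, f_eq h4, f_eq h2, g, g, g, g]
  field_simp

/-- Up to a factor that is symmetric in `x, x'` and in `y, y'`, the coefficient `pairCoef` is a
product of two functions `halfTerm`. -/
theorem pairCoef_eq {i : ℕ} {a a' b b' x x' y y' : K} (hx : Sep c a x) (hx' : Sep c a x')
    (hax : Sep c a' x) (hax' : Sep c a' x')
    (hy : Sep c b y) (hy' : Sep c b y') (hby : Sep c b' y) (hby' : Sep c b' y') :
    gam c m i b b' * gam c m i a' a * pairCoef c m i a a' b b' x x' y y' =
      cg c m (i + 1) ^ 2 * cg c m i ^ 2 *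
      ((b - y + cg c m i) * (b - y' + cg c m i) * (b' - y + cg c m i) * (b' - y' + cg c m i) *
        ((a - x) * (a - x') * (a' - x) * (a' - x')))⁻¹ *
      (halfTerm c m i a a' x x' * halfTerm c m i b' b y' y) := by
  have h1 := hx.1
  have h2 := hx'.1
  have h3 := hy.1
  have h4 := hy'.1
  have h5 := hy.sub_add_ne m i
  have h6 := hy'.sub_add_ne m i
  have h7 := hax.1
  have h8 := hax'.1
  have h9 := hby.1
  have h10 := hby'.1
  have h11 := hby.sub_add_ne m i
  have h12 := hby'.sub_add_ne m i
  rw [pairCoef, f_eq h3, f_eq h4, f_eq h2, f_eq h10, g, g, g, g, halfTerm, halfTerm]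
  field_simp

theorem sum_pair_swap {M : Type*} [AddCommMonoid M] (S : Finset ℕ) (X : ℕ → ℕ → M) :
    ∑ a ∈ S, ∑ a' ∈ S.erase a, X a a' = ∑ a ∈ S, ∑ a' ∈ S.erase a, X a' a := by
  rw [Finset.sum_sigma', Finset.sum_sigma']
  refine Finset.sum_nbij' (fun p => ⟨p.2, p.1⟩) (fun p => ⟨p.2, p.1⟩) ?_ ?_ ?_ ?_ ?_
  · rintro ⟨a, b⟩ h
    simp only [Finset.mem_sigma, Finset.mem_erase] at h ⊢
    exact ⟨h.2.2, Ne.symm h.2.1, h.1⟩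
  · rintro ⟨a, b⟩ h
    simp only [Finset.mem_sigma, Finset.mem_erase] at h ⊢
    exact ⟨h.2.2, Ne.symm h.2.1, h.1⟩
  · intros; rfl
  · intros; rfl
  · intros; rfl

/-- For a sum over ordered pairs of labels it suffices to have the exchange property for the sums
over the four orders of two pairs of labels. -/
theorem Exchange.sum_pairs [CharZero K] {κ u u' v v' : K} {S T : Finset ℕ}
    {X : ℕ → ℕ → ℕ → ℕ → K → K → K → K → K}
    (h : ∀ a ∈ S, ∀ a' ∈ S, a ≠ a' → ∀ b ∈ T, ∀ b' ∈ T, b ≠ b' →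
      Exchange κ u u' v v' fun x x' y y' => X a a' b b' x x' y y' + X a' a b b' x x' y y' +
        X a a' b' b x x' y y' + X a' a b' b x x' y y') :
    Exchange κ u u' v v' fun x x' y y' => ∑ a ∈ S, ∑ a' ∈ S.erase a, ∑ b ∈ T, ∑ b' ∈ T.erase b,
      X a a' b b' x x' y y' := by
  have h1 := Exchange.const_mul (4 : K)⁻¹ (Exchange.sum (S := S) fun a ha =>
    Exchange.sum (S := S.erase a) fun a' ha' => Exchange.sum (S := T) fun b hb =>
    Exchange.sum (S := T.erase b) fun b' hb' => h a ha a' (Finset.mem_of_mem_erase ha')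
      (Finset.ne_of_mem_erase ha').symm b hb b' (Finset.mem_of_mem_erase hb')
      (Finset.ne_of_mem_erase hb').symm)
  refine h1.congr fun x x' y y' _ _ => ?_
  simp only [Finset.sum_add_distrib]
  rw [← sum_pair_swap S fun a a' => ∑ b ∈ T, ∑ b' ∈ T.erase b, X a a' b b' x x' y y',
    ← sum_pair_swap S fun a a' => ∑ b ∈ T, ∑ b' ∈ T.erase b, X a a' b' b x x' y y']
  have e : ∀ a a', ∑ b ∈ T, ∑ b' ∈ T.erase b, X a a' b' b x x' y y' =
      ∑ b ∈ T, ∑ b' ∈ T.erase b, X a a' b b' x x' y y' := fun a a' =>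
    (sum_pair_swap T fun b b' => X a a' b b' x x' y y').symm
  simp only [e]
  ring

set_option maxRecDepth 4000 in
/-- The exchange property of two paths, by induction on the number of colours that they
can still visit. -/
theorem twoPath_exchange [CharZero K] {d : ℕ} : ∀ {ν : ℕ} {u u' v v' : K} (H : K → K)
    (Φ : (ℕ → Finset ℕ) → (ℕ → Finset ℕ) → K) {A B : ℕ → Finset ℕ}, SepFam c s A → SepFam c t B →
    (∀ a ∈ A (ν + 1), Sep c (s (ν + 1) a) u ∧ Sep c (s (ν + 1) a) u') →
    (∀ b ∈ B (ν + 1), Sep c (t (ν + 1) b) v ∧ Sep c (t (ν + 1) b) v') →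
    Exchange (cg c m (ν + 1)) u u' v v' (twoPath c m s t d ν H Φ A B) := by
  induction d with
  | zero =>
    intro ν u u' v v' H Φ A B _ _ _ _
    refine (Exchange.const _ _ _ _ _ ((fprod c m s (ν + 1) A u)⁻¹ *
      ((fprod c m s (ν + 1) A u')⁻¹ * Φ A B))).congr ?_
    intro x x' y y' hx _
    simp only [twoPath, pathSum]
    rcases hx with ⟨rfl, rfl⟩ | ⟨rfl, rfl⟩ <;> ring
  | succ d ih =>
    intro ν u u' v v' H Φ A B hA hB hu hv
    have hx : ∀ {x x'}, Swap u u' x x' → ∀ a ∈ A (ν + 1),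
        Sep c (s (ν + 1) a) x ∧ Sep c (s (ν + 1) a) x' := fun h a ha =>
      h.forall (p := fun x => Sep c (s (ν + 1) a) x) (hu a ha).1 (hu a ha).2
    have hy : ∀ {y y'}, Swap v v' y y' → ∀ b ∈ B (ν + 1),
        Sep c (t (ν + 1) b) y ∧ Sep c (t (ν + 1) b) y' := fun h b hb =>
      h.forall (p := fun x => Sep c (t (ν + 1) b) x) (hv b hb).1 (hv b hb).2
    refine Exchange.congr (F := fun x x' y y' => (fprod c m s (ν + 1) A u)⁻¹ *
      (fprod c m s (ν + 1) A u')⁻¹ * _) (Exchange.const_mul _ ?_) fun x x' y y' hx' hy' => by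
        rw [twoPath_succ fun a ha => ((hx hx' a ha).2).f_ne m (ν + 1)]
        have e : (fprod c m s (ν + 1) A x)⁻¹ * (fprod c m s (ν + 1) A x')⁻¹ =
            (fprod c m s (ν + 1) A u)⁻¹ * (fprod c m s (ν + 1) A u')⁻¹ := by
          rcases hx' with ⟨rfl, rfl⟩ | ⟨rfl, rfl⟩ <;> ring
        rw [e]
    refine Exchange.add (Exchange.add (Exchange.const _ _ _ _ _ _) ?_) ?_
    · refine Exchange.sum fun a ha => Exchange.sum fun b hb => Exchange.const_mul _ ?_
      refine ((exchange_one (cg c m (ν + 1)) u u' v v' (s (ν + 1) a) (t (ν + 1) b)).const_mul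
        (cg c m (ν + 1 + 1) * cg c m (ν + 1) * ((t (ν + 1) b - v + cg c m (ν + 1)) *
          (t (ν + 1) b - v' + cg c m (ν + 1)) * (s (ν + 1) a - u) * (s (ν + 1) a - u'))⁻¹)).congr ?_
      intro x x' y y' hx' hy'
      obtain ⟨h1, h2⟩ := hx hx' a ha
      obtain ⟨h3, h4⟩ := hy hy' b hb
      rw [oneCoef_eq h1 h2 h3 h4]
      congr 3
      rcases hx' with ⟨rfl, rfl⟩ | ⟨rfl, rfl⟩ <;> rcases hy' with ⟨rfl, rfl⟩ | ⟨rfl, rfl⟩ <;> ring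
    · refine Exchange.sum_pairs fun a ha a' ha' hne b hb b' hb' hne' => ?_
      have IH := ih (ν := ν + 1) (u := s (ν + 1) a) (u' := s (ν + 1) a') (v := t (ν + 1) b)
        (v' := t (ν + 1) b') (lowerWt c m t (ν + 1) (del (del B (ν + 1) b) (ν + 1) b')) Φ
        ((hA.del (ν + 1) a).del (ν + 1) a') ((hB.del (ν + 1) b).del (ν + 1) b') (by
          intro a'' ha''
          rw [mem_del, mem_del] at ha''
          exact ⟨hA _ _ ha''.1.1 _ _ ha (by simp), hA _ _ ha''.1.1 _ _ ha' (by simp)⟩) (by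
          intro a'' ha''
          rw [mem_del, mem_del] at ha''
          exact ⟨hB _ _ ha''.1.1 _ _ hb (by simp), hB _ _ ha''.1.1 _ _ hb' (by simp)⟩)
      have key := exchange_pair u u' v v' (hA.of_ne ha ha' hne).1 (hB.of_ne hb hb' hne').1 IH
      refine (key.const_mul ((gamL c m t (ν + 1) (del B (ν + 1) b') b *
        gamL c m t (ν + 1) (del B (ν + 1) b) b' *
        (gamR c m s (ν + 1) (del A (ν + 1) a') a * gamR c m s (ν + 1) (del A (ν + 1) a) a') *
        (H (t (ν + 1) b) * H (t (ν + 1) b'))) *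
        (cg c m (ν + 1 + 1) ^ 2 * cg c m (ν + 1) ^ 2 *
        ((t (ν + 1) b - v + cg c m (ν + 1)) * (t (ν + 1) b - v' + cg c m (ν + 1)) *
          (t (ν + 1) b' - v + cg c m (ν + 1)) * (t (ν + 1) b' - v' + cg c m (ν + 1)) *
          ((s (ν + 1) a - u) * (s (ν + 1) a - u') * (s (ν + 1) a' - u) *
            (s (ν + 1) a' - u')))⁻¹))).congr ?_
      intro x x' y y' hx' hy'
      obtain ⟨h1, h2⟩ := hx hx' a ha
      obtain ⟨h3, h4⟩ := hx hx' a' ha'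
      obtain ⟨h5, h6⟩ := hy hy' b hb
      obtain ⟨h7, h8⟩ := hy hy' b' hb'
      have e : ((t (ν + 1) b - v + cg c m (ν + 1)) * (t (ν + 1) b - v' + cg c m (ν + 1)) *
          (t (ν + 1) b' - v + cg c m (ν + 1)) * (t (ν + 1) b' - v' + cg c m (ν + 1)) *
          ((s (ν + 1) a - u) * (s (ν + 1) a - u') * (s (ν + 1) a' - u) *
            (s (ν + 1) a' - u'))) =
          ((t (ν + 1) b - y + cg c m (ν + 1)) * (t (ν + 1) b - y' + cg c m (ν + 1)) *
          (t (ν + 1) b' - y + cg c m (ν + 1)) * (t (ν + 1) b' - y' + cg c m (ν + 1)) *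
          ((s (ν + 1) a - x) * (s (ν + 1) a - x') * (s (ν + 1) a' - x) *
            (s (ν + 1) a' - x'))) := by
        rcases hx' with ⟨rfl, rfl⟩ | ⟨rfl, rfl⟩ <;> rcases hy' with ⟨rfl, rfl⟩ | ⟨rfl, rfl⟩ <;> ring
      have p1 := pairCoef_eq (m := m) (i := ν + 1) h1 h2 h3 h4 h5 h6 h7 h8
      have p2 := pairCoef_eq (m := m) (i := ν + 1) h3 h4 h1 h2 h5 h6 h7 h8
      have p3 := pairCoef_eq (m := m) (i := ν + 1) h1 h2 h3 h4 h7 h8 h5 h6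
      have p4 := pairCoef_eq (m := m) (i := ν + 1) h3 h4 h1 h2 h7 h8 h5 h6
      rw [e, gamL_del hb' hne', gamL_del hb hne'.symm, gamR_del ha' hne, gamR_del ha hne.symm,
        del_comm A (ν + 1) a' (ν + 1) a, del_comm B (ν + 1) b' (ν + 1) b]
      set R := gamL c m t (ν + 1) (del B (ν + 1) b') b * gamL c m t (ν + 1) (del B (ν + 1) b) b' *
        (gamR c m s (ν + 1) (del A (ν + 1) a') a * gamR c m s (ν + 1) (del A (ν + 1) a) a') *
        (H (t (ν + 1) b) * H (t (ν + 1) b')) with hR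
      set G := twoPath c m s t d (ν + 1)
        (lowerWt c m t (ν + 1) (del (del B (ν + 1) b) (ν + 1) b')) Φ
        (del (del A (ν + 1) a) (ν + 1) a') (del (del B (ν + 1) b) (ν + 1) b') with hG
      linear_combination
        R * G (s (ν + 1) a) (s (ν + 1) a') (t (ν + 1) b) (t (ν + 1) b') * p1 +
        R * G (s (ν + 1) a') (s (ν + 1) a) (t (ν + 1) b) (t (ν + 1) b') * p2 +
        R * G (s (ν + 1) a) (s (ν + 1) a') (t (ν + 1) b') (t (ν + 1) b) * p3 +
        R * G (s (ν + 1) a') (s (ν + 1) a) (t (ν + 1) b') (t (ν + 1) b) * p4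

end

/-! ### Two identities for the first colour -/

section
variable {K : Type*} [Field K] {c : K} {m : ℕ} {s t : ℕ → ℕ → K}

/-- One factor of `oddFactor`. -/
def odd1 (c : K) (m : ℕ) (a x : K) : K := if m = 1 then g c m 1 a x / f c m 1 a x else 1

/-- The part of the two-step recursion that depends on the pairs of labels. -/
def startPair (c : K) (m : ℕ) (x x' b b' : K) : K :=
  odd1 c m x' x * (gam c m 1 b b' * g c m 2 b x * f c m 1 b' x * g c m 2 b' x')

theorem cg_two_of_ne (c : K) (h : m ≠ 1) : cg c m 2 = cg c m 1 := cg_succ c h.symm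

/-- The exchange property makes the sum over two steps of the recursion independent of their
order. -/
theorem startPair_symm {x x' b b' : K} {F : K → K → K → K → K}
    (hF : Exchange (cg c m 2) x x' b b' F) (hx : Sep c x x') (hb : Sep c b b') (hbx : Sep c b x)
    (hbx' : Sep c b x') (hbx2 : Sep c b' x) (hbx2' : Sep c b' x') :
    startPair c m x x' b b' * F x x' b b' + startPair c m x x' b' b * F x x' b' b =
    startPair c m x' x b b' * F x' x b b' + startPair c m x' x b' b * F x' x b' b := by
  obtain ⟨α, β, h⟩ := hF
  rw [h _ _ _ _ (Swap.refl _ _) (Swap.refl _ _), h _ _ _ _ (Swap.swap _ _) (Swap.refl _ _),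
    h _ _ _ _ (Swap.refl _ _) (Swap.swap _ _), h _ _ _ _ (Swap.swap _ _) (Swap.swap _ _)]
  have h1 := hb.1
  have h2 := hbx.1
  have h3 := hbx'.1
  have h4 := hbx2.1
  have h5 := hbx2'.1
  have h6 := hx.1
  by_cases hm : m = 1
  · subst hm
    have h7 := hx.sub_add_ne 1 1
    have h8 := hx.symm.sub_add_ne 1 1
    simp only [startPair, odd1, if_true, gam, g, f_eq hx.1, f_eq hx.symm.1, f_eq h2, f_eq h3,
      f_eq h4, f_eq h5, show cg c 1 2 = -c from cg_succ_self c 1, cg_self] at h7 h8 ⊢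
    rw [show b' - b = -(b - b') by ring, show x' - x = -(x - x') by ring] at *
    field_simp
    ring
  · simp only [startPair, odd1, if_neg hm, gam, if_neg (Ne.symm hm), f_eq h1, f_eq hb.symm.1,
      f_eq h2, f_eq h3, f_eq h4, f_eq h5, g, cg_two_of_ne c hm]
    rw [show b' - b = -(b - b') by ring]
    field_simp
    ring

/-- The rational identity behind the inductive step of `fprod_sub_mul_Z`. -/
theorem startPair_star {x a b b' y : K} {F : K → K → K → K → K}
    (hF : Exchange (cg c m 2) x a b b' F) (hx : Sep c x a) (hb : Sep c b b') (hbx : Sep c b x)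
    (hbx2 : Sep c b' x)
    (hxy : Sep c x y) (hay : Sep c a y) (hby : Sep c b y) (hby' : Sep c b' y) :
    (odd1 c m a x * gam c m 1 b b' * (g c m 2 b x * f c m 1 x y * f c m 1 b' x * g c m 1 a y *
        g c m 2 b' y - g c m 1 x y * g c m 2 b y * f c m 1 b' y * g c m 1 a x * g c m 2 b' x) *
        F x a b b' - g c m 1 a y * g c m 2 b y * f c m 1 b' y * gam c m 1 x a * gam c m 1 b b' *
        g c m 2 b' x * F a x b b') +
    (odd1 c m a x * gam c m 1 b' b * (g c m 2 b' x * f c m 1 x y * f c m 1 b x * g c m 1 a y *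
        g c m 2 b y - g c m 1 x y * g c m 2 b' y * f c m 1 b y * g c m 1 a x * g c m 2 b x) *
        F x a b' b - g c m 1 a y * g c m 2 b' y * f c m 1 b y * gam c m 1 x a * gam c m 1 b' b *
        g c m 2 b x * F a x b' b) = 0 := by
  obtain ⟨α, β, h⟩ := hF
  rw [h _ _ _ _ (Swap.refl _ _) (Swap.refl _ _), h _ _ _ _ (Swap.swap _ _) (Swap.refl _ _),
    h _ _ _ _ (Swap.refl _ _) (Swap.swap _ _), h _ _ _ _ (Swap.swap _ _) (Swap.swap _ _)]
  have h1 := hb.1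
  have h2 := hbx.1
  have h4 := hbx2.1
  have h6 := hx.1
  have h9 := hxy.1
  have h10 := hay.1
  have h11 := hby.1
  have h12 := hby'.1
  by_cases hm : m = 1
  · subst hm
    have h8 := hx.symm.sub_add_ne 1 1
    simp only [odd1, if_true, gam, g, f_eq hx.symm.1, f_eq h2,
      f_eq h4, f_eq h9, f_eq h11, f_eq h12,
      show cg c 1 2 = -c from cg_succ_self c 1, cg_self] at h8 ⊢
    rw [show b' - b = -(b - b') by ring, show a - x = -(x - a) by ring] at *
    field_simp
    ring
  · simp only [odd1, if_neg hm, gam, if_neg (Ne.symm hm), f_eq h1, f_eq hb.symm.1,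
      f_eq h2, f_eq h4, f_eq h6, f_eq h9, f_eq h11, f_eq h12, g, cg_two_of_ne c hm]
    rw [show b' - b = -(b - b') by ring, show a - x = -(x - a) by ring]
    field_simp
    ring

end

/-! ### Symmetry of the recursion -/

section
variable {K : Type*} [Field K] {c : K} {m n : ℕ} {s t : ℕ → ℕ → K} {A B : ℕ → Finset ℕ}

theorem Generic.mono {A' B' : ℕ → Finset ℕ} (h : Generic c s t A B) (hA : ∀ ν, A' ν ⊆ A ν)
    (hB : ∀ ν, B' ν ⊆ B ν) : Generic c s t A' B' :=
  ⟨SepFam.mono h.1 hA, SepFam.mono h.2.1 hB,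
    fun ν a ha ν' b hb => h.2.2 ν a (hA _ ha) ν' b (hB _ hb)⟩

/-- The hypotheses under which the recursion for the highest coefficient is symmetric: the
parameters are generic, there are equally many `s` and `t` of each colour, and none of a colour above
`N = m + n - 1`. -/
structure Valid (c : K) (m n : ℕ) (s t : ℕ → ℕ → K) (A B : ℕ → Finset ℕ) : Prop where
  gen : Generic c s t A B
  card : ∀ ν, (A ν).card = (B ν).card
  supp : ∀ ν, m + n - 1 < ν → A ν = ∅

theorem Valid.del (h : Valid c m n s t A B) {μ i k : ℕ} (hi : i ∈ A μ) (hk : k ∈ B μ) :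
    Valid c m n s t (del A μ i) (del B μ k) where
  gen := h.gen.mono (fun ν => del_subset _ _ _ ν) (fun ν => del_subset _ _ _ ν)
  card := card_del_eq h.card hi hk
  supp ν hν := Finset.subset_empty.mp ((del_subset A μ i ν).trans_eq (h.supp ν hν))

theorem Valid.below (h : Valid c m n s t A B) {ν : ℕ} {A' B' : ℕ → Finset ℕ}
    (hb : Below ν A B A' B') : Valid c m n s t A' B' where
  gen := h.gen.mono hb.subA hb.subB
  card := hb.card_eq h.card
  supp ν hν := Finset.subset_empty.mp ((hb.subA ν).trans_eq (h.supp ν hν))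

theorem oddFactor_del {x x' : ℕ} (hx' : x' ∈ A 1) (hne : x ≠ x') :
    oddFactor c m s A x = odd1 c m (s 1 x') (s 1 x) * oddFactor c m s (del A 1 x') x := by
  simp only [oddFactor, del_same, Finset.erase_right_comm (a := x')]
  exact (Finset.mul_prod_erase _ (fun a => if m = 1 then g c m 1 (s 1 a) (s 1 x) /
    f c m 1 (s 1 a) (s 1 x) else 1) (by simp [hx', hne.symm])).symm

theorem startWt_eq (b : ℕ) (u : K) :
    startWt c m t B b u = g c m 2 (t 1 b) u * gamL c m t 1 B b * fprod c m t 1 (del B 1 b) u := by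
  simp only [startWt, fprod, del_same]

/-- The part of the two-step recursion that does not depend on the order of the two steps: the
factors that involve labels other than those removed. -/
def spectators (c : K) (m : ℕ) (t : ℕ → ℕ → K) (B : ℕ → Finset ℕ) (b b' : ℕ) (u u' : K) : K :=
  gamL c m t 1 (del B 1 b') b * gamL c m t 1 (del B 1 b) b' *
    (fprod c m t 1 (del (del B 1 b) 1 b') u * fprod c m t 1 (del (del B 1 b) 1 b') u')

theorem spectators_comm (b b' : ℕ) (u u' : K) :
    spectators c m t B b b' u u' = spectators c m t B b' b u u' := by
  simp only [spectators, del_comm B 1 b 1 b']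
  ring

theorem startWt_mul_startWt {b b' : ℕ} (hb' : b' ∈ (B 1).erase b) (u u' : K) :
    startWt c m t B b u * startWt c m t (del B 1 b) b' u' = spectators c m t B b b' u u' *
      (gam c m 1 (t 1 b) (t 1 b') * g c m 2 (t 1 b) u * f c m 1 (t 1 b') u *
        g c m 2 (t 1 b') u') := by
  have h1 := Finset.mem_of_mem_erase hb'
  have h2 := (Finset.ne_of_mem_erase hb').symm
  rw [startWt_eq, startWt_eq, gamL_del h1 h2, fprod_del (show b' ∈ del B 1 b 1 by simpa using hb'),
    spectators]
  ring

/-- The sum over two paths that start with the labels `x`, `b` and `x'`, `b'` of colour `1`. -/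
def pairSum (c : K) (m n : ℕ) (s t : ℕ → ℕ → K) (A B : ℕ → Finset ℕ) (x x' b b' : ℕ) : K :=
  twoPath c m s t (m + n - 2) 1 (lowerWt c m t 1 (del (del B 1 b) 1 b')) (Z c m n s t)
    (del (del A 1 x) 1 x') (del (del B 1 b) 1 b') (s 1 x) (s 1 x') (t 1 b) (t 1 b')

/-- The sum over the first step, if the highest coefficient is expanded once more. -/
theorem pathSum_Z_eq {x x' b : ℕ} {w : K} (w' : ℕ → K) (hb : b ∈ B 1)
    (h : ∀ A' B', Below 1 (del A 1 x) (del B 1 b) A' B' → w * Z c m n s t A' B' =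
      ∑ b' ∈ B' 1, w' b' * pathSum c m s t (m + n - 2) 1 (s 1 x') (t 1 b') (lowerWt c m t 1 B')
        (Z c m n s t) (del A' 1 x') (del B' 1 b')) :
    w * pathSum c m s t (m + n - 2) 1 (s 1 x) (t 1 b) (lowerWt c m t 1 B) (Z c m n s t)
      (del A 1 x) (del B 1 b) =
    ∑ b' ∈ (B 1).erase b, w' b' * pairSum c m n s t A B x x' b b' := by
  rw [← pathSum_mul]
  have e : ∀ A' B', Below 1 (del A 1 x) (del B 1 b) A' B' → w * Z c m n s t A' B' =
      ∑ b' ∈ (B 1).erase b, w' b' * pathSum c m s t (m + n - 2) 1 (s 1 x') (t 1 b')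
        (lowerWt c m t 1 (del B 1 b)) (Z c m n s t) (del A' 1 x') (del B' 1 b') := by
    intro A' B' hAB
    have hB := hAB.eqB 1 le_rfl
    have h4 : lowerWt c m t 1 B' = lowerWt c m t 1 (del B 1 b) := by
      funext; simp only [lowerWt, hB]
    rw [h A' B' hAB, h4, hB, del_same]
  rw [pathSum_congr_right e, pathSum_sum]
  refine Finset.sum_congr rfl fun b' hb' => ?_
  rw [pathSum_mul, pathSum_pathSum_del _ _ _ _ hb hb', pairSum]

theorem sum_pairs_eq_zero [CharZero K] {S : Finset ℕ} {X : ℕ → ℕ → K}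
    (h : ∀ b ∈ S, ∀ b' ∈ S, b ≠ b' → X b b' + X b' b = 0) :
    ∑ b ∈ S, ∑ b' ∈ S.erase b, X b b' = 0 := by
  have h2 : (2 : K) * ∑ b ∈ S, ∑ b' ∈ S.erase b, X b b' = 0 := by
    rw [two_mul]
    nth_rewrite 2 [sum_pair_swap]
    simp only [← Finset.sum_add_distrib]
    exact Finset.sum_eq_zero fun b hb => Finset.sum_eq_zero fun b' hb' =>
      h b hb b' (Finset.mem_of_mem_erase hb') (Finset.ne_of_mem_erase hb').symm
  simpa using h2

/-- The exchange property of `pairSum`, stated for `twoPath` because the starting values vary. -/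
theorem pairSum_exchange [CharZero K] (h : Valid c m n s t A B) {x x' b b' : ℕ} (hx : x ∈ A 1)
    (hx' : x' ∈ A 1) (hb : b ∈ B 1) (hb' : b' ∈ B 1) :
    Exchange (cg c m 2) (s 1 x) (s 1 x') (t 1 b) (t 1 b')
      (twoPath c m s t (m + n - 2) 1 (lowerWt c m t 1 (del (del B 1 b) 1 b')) (Z c m n s t)
        (del (del A 1 x) 1 x') (del (del B 1 b) 1 b')) := by
  refine twoPath_exchange _ _ ((SepFam.del h.gen.1 1 x).del 1 x')
    ((SepFam.del h.gen.2.1 1 b).del 1 b') ?_ ?_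
  · intro a ha
    rw [mem_del, mem_del] at ha
    exact ⟨h.gen.1 _ _ ha.1.1 _ _ hx (by simp), h.gen.1 _ _ ha.1.1 _ _ hx' (by simp)⟩
  · intro a ha
    rw [mem_del, mem_del] at ha
    exact ⟨h.gen.2.1 _ _ ha.1.1 _ _ hb (by simp), h.gen.2.1 _ _ ha.1.1 _ _ hb' (by simp)⟩

theorem pairSum_swap (x x' b b' : ℕ) : pairSum c m n s t A B x' x b b' =
      twoPath c m s t (m + n - 2) 1 (lowerWt c m t 1 (del (del B 1 b) 1 b')) (Z c m n s t)
        (del (del A 1 x) 1 x') (del (del B 1 b) 1 b') (s 1 x') (s 1 x) (t 1 b) (t 1 b') := by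
  rw [pairSum, del_comm A 1 x 1 x']

theorem pairSum_swap_right (x x' b b' : ℕ) : pairSum c m n s t A B x x' b' b =
      twoPath c m s t (m + n - 2) 1 (lowerWt c m t 1 (del (del B 1 b) 1 b')) (Z c m n s t)
        (del (del A 1 x) 1 x') (del (del B 1 b) 1 b') (s 1 x) (s 1 x') (t 1 b') (t 1 b) := by
  rw [pairSum, del_comm B 1 b 1 b']

/-- The recursion with `x` followed by the recursion with `x'`. -/
theorem recRHS_eq_sum_pairSum {x x' : ℕ} (hx' : x' ∈ A 1) (hne : x ≠ x')
    (h : ∀ b ∈ B 1, ∀ A' B', Below 1 (del A 1 x) (del B 1 b) A' B' →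
      Z c m n s t A' B' = recRHS c m n s t A' B' x') :
    recRHS c m n s t A B x =
      oddFactor c m s (del A 1 x') x * oddFactor c m s (del A 1 x) x' *
      ∑ b ∈ B 1, ∑ b' ∈ (B 1).erase b, spectators c m t B b b' (s 1 x) (s 1 x') *
        (startPair c m (s 1 x) (s 1 x') (t 1 b) (t 1 b') * pairSum c m n s t A B x x' b b') := by
  rw [recRHS, oddFactor_del hx' hne, Finset.mul_sum, Finset.mul_sum]
  refine Finset.sum_congr rfl fun b hb => ?_
  have e := pathSum_Z_eq (A := A) (x := x) (x' := x') (w := (1 : K)) (fun b' =>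
    oddFactor c m s (del A 1 x) x' * startWt c m t (del B 1 b) b' (s 1 x')) hb (by
      intro A' B' hAB
      have hA := hAB.eqA 1 le_rfl
      have hB := hAB.eqB 1 le_rfl
      have h1 : oddFactor c m s A' x' = oddFactor c m s (del A 1 x) x' := by
        simp only [oddFactor, hA]
      rw [one_mul, h b hb A' B' hAB, recRHS, Finset.mul_sum, h1]
      refine Finset.sum_congr rfl fun b' hb' => ?_
      have h2 : startWt c m t B' b' (s 1 x') = startWt c m t (del B 1 b) b' (s 1 x') := by
        simp only [startWt, gamL, hB]
      rw [h2, mul_assoc])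
  rw [one_mul] at e
  rw [e, Finset.mul_sum, Finset.mul_sum, Finset.mul_sum]
  refine Finset.sum_congr rfl fun b' hb' => ?_
  have e2 := startWt_mul_startWt (c := c) (m := m) (t := t) hb' (s 1 x) (s 1 x')
  rw [startPair]
  linear_combination odd1 c m (s 1 x') (s 1 x) * oddFactor c m s (del A 1 x') x *
    oddFactor c m s (del A 1 x) x' * pairSum c m n s t A B x x' b b' * e2

/-- If the recursion holds for all parameters of colour `1` once a label has been removed, then its
right-hand sides for `x` and `x'` agree. -/
theorem recRHS_swap [CharZero K] (hv : Valid c m n s t A B) {x x' : ℕ} (hx : x ∈ A 1)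
    (hx' : x' ∈ A 1) (hne : x ≠ x')
    (h : ∀ b ∈ B 1, ∀ A' B', Below 1 (del A 1 x) (del B 1 b) A' B' →
      Z c m n s t A' B' = recRHS c m n s t A' B' x')
    (h' : ∀ b ∈ B 1, ∀ A' B', Below 1 (del A 1 x') (del B 1 b) A' B' →
      Z c m n s t A' B' = recRHS c m n s t A' B' x) :
    recRHS c m n s t A B x = recRHS c m n s t A B x' := by
  rw [recRHS_eq_sum_pairSum hx' hne h, recRHS_eq_sum_pairSum hx hne.symm h',
    mul_comm (oddFactor c m s (del A 1 x) x')]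
  congr 1
  rw [← sub_eq_zero, ← Finset.sum_sub_distrib]
  simp only [← Finset.sum_sub_distrib]
  refine sum_pairs_eq_zero fun b hb b' hb' hbb => ?_
  have key := startPair_symm (m := m) (pairSum_exchange hv hx hx' hb hb')
    (SepFam.of_ne hv.gen.1 hx hx' hne) (SepFam.of_ne hv.gen.2.1 hb hb' hbb)
    (hv.gen.2.2 _ _ hx _ _ hb).symm (hv.gen.2.2 _ _ hx' _ _ hb).symm
    (hv.gen.2.2 _ _ hx _ _ hb').symm (hv.gen.2.2 _ _ hx' _ _ hb').symm
  have hs : ∀ u u', spectators c m t B b b' u' u = spectators c m t B b b' u u' := by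
    intro u u'; simp only [spectators]; ring
  rw [spectators_comm b' b, spectators_comm b' b, hs (s 1 x) (s 1 x'), pairSum_swap_right x x' b b',
    pairSum_swap x x' b b', pairSum_swap x x' b' b, del_comm B 1 b' 1 b, pairSum]
  linear_combination spectators c m t B b b' (s 1 x) (s 1 x') * key

theorem Z_one_one : Z c 1 1 s t A B = ∏ a ∈ A 1, ∏ b ∈ B 1, g c 1 1 (s 1 a) (t 1 b) := by
  rw [Z]; simp

open Polynomial in
/-- Lagrange interpolation at the nodes `y b` of the polynomial `∏ (x a - w)` in `w`. -/
theorem prod_sub_eq_sum {ι κ : Type*} [DecidableEq κ] (S : Finset ι) (T : Finset κ) (x : ι → K)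
    (y : κ → K) (hy : Set.InjOn y T) (hcard : S.card < T.card) (w : K) :
    ∏ a ∈ S, (x a - w) =
      ∑ b ∈ T, (∏ a ∈ S, (x a - y b)) * ∏ b' ∈ T.erase b, ((w - y b') / (y b - y b')) := by
  set p : K[X] := ∏ a ∈ S, (C (x a) - X) with hp
  have hev : ∀ w, p.eval w = ∏ a ∈ S, (x a - w) := fun w => by simp [hp, eval_prod]
  have hdeg : p.degree < T.card := by
    refine lt_of_le_of_lt (degree_prod_le _ _)
      (lt_of_le_of_lt (Finset.sum_le_card_nsmul _ _ 1 ?_) ?_)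
    · intro a _
      exact (degree_sub_le _ _).trans (max_le (degree_C_le.trans (by norm_num)) degree_X_le)
    · simpa using hcard
  have h := Lagrange.eq_interpolate hy hdeg
  have h2 := congrArg (eval w) h
  rw [hev, Lagrange.interpolate_apply, eval_finsetSum] at h2
  rw [h2]
  refine Finset.sum_congr rfl fun b _ => ?_
  rw [eval_mul, eval_C, hev, Lagrange.basis, eval_prod]
  congr 1
  refine Finset.prod_congr rfl fun b' _ => ?_
  simp [Lagrange.basisDivisor]
  ring

/-- For `m = n = 1`, where the highest coefficient is defined by a product, the recursion is the
Lagrange interpolation formula at the point `s^1_x - c` with the nodes `t^1_b`. -/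
theorem Z_one_one_eq_recRHS (hc : c ≠ 0) (h : Valid c 1 1 s t A B) {x : ℕ} (hx : x ∈ A 1) :
    Z c 1 1 s t A B = recRHS c 1 1 s t A B x := by
  have hA2 : A 2 = ∅ := h.supp 2 (by norm_num)
  have hxb : ∀ b ∈ B 1, Sep c (s 1 x) (t 1 b) := fun b hb => h.gen.2.2 _ _ hx _ _ hb
  have hax : ∀ a ∈ (A 1).erase x, Sep c (s 1 a) (s 1 x) := fun a ha =>
    SepFam.of_ne h.gen.1 (Finset.mem_of_mem_erase ha) hx (Finset.ne_of_mem_erase ha)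
  have hL := prod_sub_eq_sum ((A 1).erase x) (B 1) (s 1) (t 1) (fun b hb b' hb' e => by
      by_contra hne
      exact (SepFam.of_ne h.gen.2.1 hb hb' hne).ne e) (by
      rw [← h.card 1]; exact Finset.card_erase_lt_of_mem hx) (s 1 x - c)
  have hodd : oddFactor c 1 s A x = c ^ ((A 1).erase x).card *
      (∏ a ∈ (A 1).erase x, (s 1 a - (s 1 x - c)))⁻¹ := by
    rw [oddFactor, ← Finset.prod_inv_distrib, ← Finset.prod_const, ← Finset.prod_mul_distrib]
    refine Finset.prod_congr rfl fun a ha => ?_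
    have h1 := (hax a ha).1
    have h2 := (hax a ha).sub_add_ne 1 1
    rw [cg_self] at h2
    have h3 : s 1 a - (s 1 x - c) ≠ 0 := by rwa [← sub_add]
    rw [if_pos rfl, f_eq h1, g, cg_self]
    field_simp
    ring
  have hP0 : ∏ a ∈ (A 1).erase x, (s 1 a - (s 1 x - c)) ≠ 0 := by
    refine Finset.prod_ne_zero_iff.mpr fun a ha => ?_
    have h2 := (hax a ha).sub_add_ne 1 1
    rw [cg_self] at h2
    rwa [← sub_add]
  have hterm : ∀ b ∈ B 1, startWt c 1 t B b (s 1 x) *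
      pathSum c 1 s t (1 + 1 - 2) 1 (s 1 x) (t 1 b) (lowerWt c 1 t 1 B) (Z c 1 1 s t) (del A 1 x)
        (del B 1 b) = Z c 1 1 s t A B * (c ^ ((A 1).erase x).card)⁻¹ *
        ((∏ a ∈ (A 1).erase x, (s 1 a - t 1 b)) *
          ∏ b' ∈ (B 1).erase b, ((s 1 x - c - t 1 b') / (t 1 b - t 1 b'))) := by
    intro b hb
    have e1 : fprod c 1 s 2 (del A 1 x) (s 1 x) = 1 := by
      simp only [fprod, del_of_ne A x (show 2 ≠ 1 by norm_num), hA2, Finset.prod_empty]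
    rw [show 1 + 1 - 2 = 0 by rfl, pathSum, e1, Z_one_one, Z_one_one, del_same, del_same,
      ← Finset.mul_prod_erase _ _ hx, ← Finset.mul_prod_erase _ _ hb, inv_one, one_mul]
    have e2 : ∏ a ∈ (A 1).erase x, ∏ b ∈ B 1, g c 1 1 (s 1 a) (t 1 b) =
        (∏ a ∈ (A 1).erase x, g c 1 1 (s 1 a) (t 1 b)) *
        ∏ a ∈ (A 1).erase x, ∏ b ∈ (B 1).erase b, g c 1 1 (s 1 a) (t 1 b) := by
      rw [← Finset.prod_mul_distrib]
      exact Finset.prod_congr rfl fun a _ => (Finset.mul_prod_erase _ _ hb).symm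
    have e3 : (∏ a ∈ (A 1).erase x, g c 1 1 (s 1 a) (t 1 b)) * (c ^ ((A 1).erase x).card)⁻¹ *
        ∏ a ∈ (A 1).erase x, (s 1 a - t 1 b) = 1 := by
      rw [← inv_pow, ← Finset.prod_const, ← Finset.prod_mul_distrib, ← Finset.prod_mul_distrib]
      refine Finset.prod_eq_one fun a ha => ?_
      have := (h.gen.2.2 _ _ (Finset.mem_of_mem_erase ha) _ _ hb).1
      rw [g, cg_self]
      field_simp
    have e4 : gamL c 1 t 1 B b * ∏ b' ∈ (B 1).erase b, f c 1 1 (t 1 b') (s 1 x) =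
        (∏ b' ∈ (B 1).erase b, g c 1 1 (s 1 x) (t 1 b')) *
          ∏ b' ∈ (B 1).erase b, ((s 1 x - c - t 1 b') / (t 1 b - t 1 b')) := by
      rw [gamL, ← Finset.prod_mul_distrib, ← Finset.prod_mul_distrib]
      refine Finset.prod_congr rfl fun b' hb' => ?_
      have h1 := (SepFam.of_ne h.gen.2.1 hb (Finset.mem_of_mem_erase hb')
        (Finset.ne_of_mem_erase hb').symm).1
      have h2 := (hxb b' (Finset.mem_of_mem_erase hb')).1
      have h3 := (hxb b' (Finset.mem_of_mem_erase hb')).symm.1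
      rw [gam, if_pos rfl, f_eq h3, g, g, cg_self, show t 1 b' - s 1 x = -(s 1 x - t 1 b') by ring]
      field_simp
      ring
    have e5 : g c 1 2 (t 1 b) (s 1 x) = g c 1 1 (s 1 x) (t 1 b) := by
      have h2 := (hxb b hb).1
      rw [g, g, cg_self, show cg c 1 2 = -c from cg_succ_self c 1,
        show t 1 b - s 1 x = -(s 1 x - t 1 b) by ring, neg_div_neg_eq]
    rw [startWt, mul_assoc (g c 1 2 _ _), e4, e5, e2]
    linear_combination (-(g c 1 1 (s 1 x) (t 1 b) *
      (∏ b' ∈ (B 1).erase b, g c 1 1 (s 1 x) (t 1 b')) *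
      (∏ a ∈ (A 1).erase x, ∏ b ∈ (B 1).erase b, g c 1 1 (s 1 a) (t 1 b)) *
      ∏ b' ∈ (B 1).erase b, ((s 1 x - c - t 1 b') / (t 1 b - t 1 b')))) * e3
  rw [recRHS, Finset.sum_congr rfl hterm, ← Finset.mul_sum, ← hL, hodd]
  have hcp : c ^ ((A 1).erase x).card ≠ 0 := pow_ne_zero _ hc
  field_simp

/-- The recursion holds for every parameter of the first colour in place of the one with the least
label. -/
theorem Z_eq_recRHS [CharZero K] (hc : c ≠ 0) (hmn : 2 ≤ m + n) (h : Valid c m n s t A B) {x : ℕ}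
    (hx : x ∈ A 1) : Z c m n s t A B = recRHS c m n s t A B x := by
  by_cases h11 : m = 1 ∧ n = 1
  · obtain ⟨rfl, rfl⟩ := h11
    exact Z_one_one_eq_recRHS hc h hx
  induction hr : (A 1).card using Nat.strong_induction_on generalizing A B x with
  | _ r ih =>
    have hne : (A 1).Nonempty := ⟨x, hx⟩
    rw [Z_eq_recRHS_min hmn h11 hne]
    set x₀ := (A 1).min' hne with hx₀
    have hx₀A : x₀ ∈ A 1 := Finset.min'_mem _ _
    by_cases hxx : x₀ = x
    · rw [hxx]
    -- by induction, the recursion holds for all labels after the first step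
    have key : ∀ y ∈ A 1, ∀ y' ∈ A 1, y ≠ y' → ∀ b ∈ B 1, ∀ A' B',
        Below 1 (del A 1 y) (del B 1 b) A' B' →
        Z c m n s t A' B' = recRHS c m n s t A' B' y' := by
      intro y hy y' hy' hyy b hb A' B' hAB
      have e := hAB.eqA 1 le_rfl
      refine ih (A' 1).card ?_ ((h.del hy hb).below hAB) ?_ rfl
      · rw [← hr, e, del_same]
        exact Finset.card_erase_lt_of_mem hy
      · rw [e, del_same]
        exact Finset.mem_erase.mpr ⟨hyy.symm, hy'⟩
    exact recRHS_swap h hx₀A hx hxx (key _ hx₀A _ hx hxx) (key _ hx _ hx₀A (Ne.symm hxx))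

end

/-! ### Paths from an additional colour -/

section
variable {K : Type*} [Field K] {c : K} {m n : ℕ} {s t : ℕ → ℕ → K} {A B : ℕ → Finset ℕ}

/-- The sum over all paths that start from an additional colour `0`, where both parameters have the
value `y`, and that remove at least one pair of labels, multiplied by `f_1(s̄^1, y) f_1(t̄^1, y)` to
clear denominators. -/
def virtualSum (c : K) (m n : ℕ) (s t : ℕ → ℕ → K) (A B : ℕ → Finset ℕ) (y : K) : K :=
  ∑ a ∈ A 1, g c m 1 (s 1 a) y * gamR c m s 1 A a * ∑ b ∈ B 1, startWt c m t B b y *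
    pathSum c m s t (m + n - 2) 1 (s 1 a) (t 1 b) (lowerWt c m t 1 B) (Z c m n s t)
      (del A 1 a) (del B 1 b)

/-- For `m = 1` the factor `γ_1 = g_1` is split as `(g_1 / f_1) f_1`; otherwise `γ_1 = f_1`, and
`oddFactor` is `1`. -/
theorem gamR_one {x : ℕ} (h : ∀ a ∈ (A 1).erase x, f c m 1 (s 1 a) (s 1 x) ≠ 0) :
    gamR c m s 1 A x = oddFactor c m s A x * fprod c m s 1 (del A 1 x) (s 1 x) := by
  rw [gamR, oddFactor, fprod, del_same, ← Finset.prod_mul_distrib]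
  refine Finset.prod_congr rfl fun a ha => ?_
  by_cases hm : m = 1
  · subst hm
    rw [gam, if_pos rfl, if_pos rfl, div_mul_cancel₀ _ (h a ha)]
  · rw [gam, if_neg (Ne.symm hm), if_neg hm, one_mul]

/-- `virtualSum` with the second step expanded; the inductive step of `fprod_sub_mul_Z`. -/
theorem mul_pathSum_eq_sum_pairSum {x b : ℕ} (hb : b ∈ B 1) (y : K)
    (h : ∀ A' B', Below 1 (del A 1 x) (del B 1 b) A' B' →
      (fprod c m s 1 A' y - fprod c m t 1 B' y) * Z c m n s t A' B' =
        virtualSum c m n s t A' B' y) :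
    (fprod c m s 1 (del A 1 x) y - fprod c m t 1 (del B 1 b) y) *
      pathSum c m s t (m + n - 2) 1 (s 1 x) (t 1 b) (lowerWt c m t 1 B) (Z c m n s t)
        (del A 1 x) (del B 1 b) =
      ∑ a ∈ (A 1).erase x, ∑ b' ∈ (B 1).erase b, g c m 1 (s 1 a) y * gamR c m s 1 (del A 1 x) a *
        startWt c m t (del B 1 b) b' y * pairSum c m n s t A B x a b b' := by
  rw [← pathSum_mul]
  have e : ∀ A' B', Below 1 (del A 1 x) (del B 1 b) A' B' →
      (fprod c m s 1 (del A 1 x) y - fprod c m t 1 (del B 1 b) y) * Z c m n s t A' B' =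
      ∑ a ∈ (A 1).erase x, ∑ b' ∈ (B 1).erase b, g c m 1 (s 1 a) y * gamR c m s 1 (del A 1 x) a *
        startWt c m t (del B 1 b) b' y * pathSum c m s t (m + n - 2) 1 (s 1 a) (t 1 b')
        (lowerWt c m t 1 (del B 1 b)) (Z c m n s t) (del A' 1 a) (del B' 1 b') := by
    intro A' B' hAB
    have hA := hAB.eqA 1 le_rfl
    have hB := hAB.eqB 1 le_rfl
    have h0 := h A' B' hAB
    have h4 : lowerWt c m t 1 B' = lowerWt c m t 1 (del B 1 b) := by
      funext; simp only [lowerWt, hB]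
    have h1 : fprod c m s 1 A' y = fprod c m s 1 (del A 1 x) y := by simp only [fprod, hA]
    have h2 : fprod c m t 1 B' y = fprod c m t 1 (del B 1 b) y := by simp only [fprod, hB]
    rw [h1, h2] at h0
    rw [h0, virtualSum, hA, hB, del_same, del_same, h4]
    refine Finset.sum_congr rfl fun a _ => ?_
    rw [Finset.mul_sum]
    refine Finset.sum_congr rfl fun b' _ => ?_
    have h5 : gamR c m s 1 A' a = gamR c m s 1 (del A 1 x) a := by simp only [gamR, hA]
    have h6 : startWt c m t B' b' y = startWt c m t (del B 1 b) b' y := by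
      simp only [startWt, gamL, hB]
    rw [h5, h6]
    ring
  rw [pathSum_congr_right e, pathSum_sum]
  refine Finset.sum_congr rfl fun a _ => ?_
  rw [pathSum_sum]
  refine Finset.sum_congr rfl fun b' hb' => ?_
  rw [pathSum_mul, pathSum_pathSum_del _ _ _ _ hb hb', pairSum]

/-- Paths from an additional colour `0` with equal values `y` of both parameters multiply the
highest coefficient by a simple factor.  The proof is by induction on the number of parameters of
colour `1`: expand `Z` on the left, and on the right the coefficients in all terms that have not
removed `x`, by the recursion for `x`; the difference is a sum over two paths, which cancels in
pairs by `startPair_star`. -/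
theorem fprod_sub_mul_Z [CharZero K] (hc : c ≠ 0) (hmn : 2 ≤ m + n) (h : Valid c m n s t A B)
    {y : K} (hy : ∀ a ∈ A 1, Sep c (s 1 a) y) (hy' : ∀ b ∈ B 1, Sep c (t 1 b) y) :
    (fprod c m s 1 A y - fprod c m t 1 B y) * Z c m n s t A B = virtualSum c m n s t A B y := by
  induction hr : (A 1).card using Nat.strong_induction_on generalizing A B y with
  | _ r ih =>
  rcases (A 1).eq_empty_or_nonempty with hA | ⟨x, hx⟩
  · have hB : B 1 = ∅ := by rw [← Finset.card_eq_zero, ← h.card 1, hA, Finset.card_empty]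
    simp [virtualSum, fprod, hA, hB]
  have IH : ∀ b ∈ B 1, ∀ y, (∀ a ∈ (A 1).erase x, Sep c (s 1 a) y) →
      (∀ b ∈ B 1, Sep c (t 1 b) y) → ∀ A' B',
      Below 1 (del A 1 x) (del B 1 b) A' B' →
      (fprod c m s 1 A' y - fprod c m t 1 B' y) * Z c m n s t A' B' =
        virtualSum c m n s t A' B' y := by
    intro b hb y hy hy' A' B' hAB
    have eA := hAB.eqA 1 le_rfl
    have eB := hAB.eqB 1 le_rfl
    rw [del_same] at eA eB
    refine ih (A' 1).card ?_ ((h.del hx hb).below hAB) ?_ ?_ rfl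
    · rw [← hr, eA]
      exact Finset.card_erase_lt_of_mem hx
    · intro a ha
      rw [eA] at ha
      exact hy a ha
    · intro b' hb'
      rw [eB] at hb'
      exact hy' b' (Finset.mem_of_mem_erase hb')
  have hxs : ∀ a ∈ (A 1).erase x, Sep c (s 1 a) (s 1 x) := fun a ha =>
    SepFam.of_ne h.gen.1 (Finset.mem_of_mem_erase ha) hx (Finset.ne_of_mem_erase ha)
  have hxt : ∀ b ∈ B 1, Sep c (t 1 b) (s 1 x) := fun b hb => (h.gen.2.2 _ _ hx _ _ hb).symm
  have hgR := gamR_one (c := c) (m := m) (s := s) (A := A) (x := x)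
    fun a ha => (hxs a ha).f_ne m 1
  -- the terms with `a ≠ x` on the right-hand side
  have hrest : ∀ a ∈ (A 1).erase x, g c m 1 (s 1 a) y * gamR c m s 1 A a *
      ∑ b ∈ B 1, startWt c m t B b y *
        pathSum c m s t (m + n - 2) 1 (s 1 a) (t 1 b) (lowerWt c m t 1 B) (Z c m n s t)
          (del A 1 a) (del B 1 b) =
      ∑ b ∈ B 1, ∑ b' ∈ (B 1).erase b, g c m 1 (s 1 a) y * gamR c m s 1 A a *
        startWt c m t B b y *
        (oddFactor c m s (del A 1 a) x * startWt c m t (del B 1 b) b' (s 1 x)) *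
        pairSum c m n s t A B a x b b' := by
    intro a ha
    rw [Finset.mul_sum]
    refine Finset.sum_congr rfl fun b hb => ?_
    have haA := Finset.mem_of_mem_erase ha
    have e := pathSum_Z_eq (A := A) (x := a) (x' := x) (w := (1 : K)) (fun b' =>
      oddFactor c m s (del A 1 a) x * startWt c m t (del B 1 b) b' (s 1 x)) hb (by
        intro A' B' hAB
        have hA := hAB.eqA 1 le_rfl
        have hB := hAB.eqB 1 le_rfl
        have h1 : oddFactor c m s A' x = oddFactor c m s (del A 1 a) x := by
          simp only [oddFactor, hA]
        rw [one_mul, Z_eq_recRHS hc hmn ((h.del haA hb).below hAB) (x := x) (by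
          rw [hA, del_same]; exact Finset.mem_erase.mpr ⟨(Finset.ne_of_mem_erase ha).symm, hx⟩),
          recRHS, Finset.mul_sum, h1]
        refine Finset.sum_congr rfl fun b' hb' => ?_
        have h2 : startWt c m t B' b' (s 1 x) = startWt c m t (del B 1 b) b' (s 1 x) := by
          simp only [startWt, gamL, hB]
        rw [h2, mul_assoc])
    rw [one_mul] at e
    rw [e, Finset.mul_sum, Finset.mul_sum]
    exact Finset.sum_congr rfl fun b' _ => by ring
  -- the remaining terms
  have hmain : ∀ b ∈ B 1, (fprod c m s 1 A y - fprod c m t 1 B y) * (oddFactor c m s A x *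
      (startWt c m t B b (s 1 x) * pathSum c m s t (m + n - 2) 1 (s 1 x) (t 1 b)
        (lowerWt c m t 1 B) (Z c m n s t) (del A 1 x) (del B 1 b))) -
      g c m 1 (s 1 x) y * gamR c m s 1 A x * (startWt c m t B b y *
        pathSum c m s t (m + n - 2) 1 (s 1 x) (t 1 b) (lowerWt c m t 1 B) (Z c m n s t)
          (del A 1 x) (del B 1 b)) =
      ∑ a ∈ (A 1).erase x, ∑ b' ∈ (B 1).erase b, oddFactor c m s A x * gamL c m t 1 B b *
        gamR c m s 1 (del A 1 x) a *
        (g c m 2 (t 1 b) (s 1 x) * fprod c m t 1 (del B 1 b) (s 1 x) * f c m 1 (s 1 x) y *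
          (g c m 1 (s 1 a) y * startWt c m t (del B 1 b) b' y) -
        g c m 1 (s 1 x) y * g c m 2 (t 1 b) y * fprod c m t 1 (del B 1 b) y *
          (g c m 1 (s 1 a) (s 1 x) * startWt c m t (del B 1 b) b' (s 1 x))) *
        pairSum c m n s t A B x a b b' := by
    intro b hb
    have Qy := mul_pathSum_eq_sum_pairSum hb y (IH b hb y
      (fun a ha => hy a (Finset.mem_of_mem_erase ha)) hy')
    have Qx := mul_pathSum_eq_sum_pairSum hb (s 1 x) (IH b hb (s 1 x) hxs hxt)
    set P := pathSum c m s t (m + n - 2) 1 (s 1 x) (t 1 b) (lowerWt c m t 1 B) (Z c m n s t)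
      (del A 1 x) (del B 1 b)
    have hsplit : ∑ a ∈ (A 1).erase x, ∑ b' ∈ (B 1).erase b,
        oddFactor c m s A x * gamL c m t 1 B b * gamR c m s 1 (del A 1 x) a *
        (g c m 2 (t 1 b) (s 1 x) * fprod c m t 1 (del B 1 b) (s 1 x) * f c m 1 (s 1 x) y *
          (g c m 1 (s 1 a) y * startWt c m t (del B 1 b) b' y) -
        g c m 1 (s 1 x) y * g c m 2 (t 1 b) y * fprod c m t 1 (del B 1 b) y *
          (g c m 1 (s 1 a) (s 1 x) * startWt c m t (del B 1 b) b' (s 1 x))) *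
        pairSum c m n s t A B x a b b' =
        oddFactor c m s A x * gamL c m t 1 B b *
          (g c m 2 (t 1 b) (s 1 x) * fprod c m t 1 (del B 1 b) (s 1 x) * f c m 1 (s 1 x) y) *
          ((fprod c m s 1 (del A 1 x) y - fprod c m t 1 (del B 1 b) y) * P) -
        oddFactor c m s A x * gamL c m t 1 B b *
          (g c m 1 (s 1 x) y * g c m 2 (t 1 b) y * fprod c m t 1 (del B 1 b) y) *
          ((fprod c m s 1 (del A 1 x) (s 1 x) - fprod c m t 1 (del B 1 b) (s 1 x)) * P) := by
      rw [Qy, Qx, Finset.mul_sum, Finset.mul_sum, ← Finset.sum_sub_distrib]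
      refine Finset.sum_congr rfl fun a _ => ?_
      rw [Finset.mul_sum, Finset.mul_sum, ← Finset.sum_sub_distrib]
      exact Finset.sum_congr rfl fun b' _ => by ring
    rw [hsplit, hgR, startWt_eq, startWt_eq, fprod_del hx, fprod_del hb]
    have e : g c m 2 (t 1 b) (s 1 x) * (f c m 1 (s 1 x) y - f c m 1 (t 1 b) y) =
        g c m 1 (s 1 x) y * g c m 2 (t 1 b) y := by
      have h1 := (hxt b hb).1
      have h2 := (hy x hx).1
      have h3 := (hy' b hb).1
      simp only [f, g]
      field_simp
      ring
    linear_combination oddFactor c m s A x * gamL c m t 1 B b *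
      fprod c m t 1 (del B 1 b) (s 1 x) * fprod c m t 1 (del B 1 b) y * P * e
  rw [virtualSum, ← Finset.add_sum_erase _ _ hx, Finset.sum_congr rfl hrest, ← sub_eq_zero,
    ← sub_sub, Z_eq_recRHS hc hmn h hx, recRHS, Finset.mul_sum, Finset.mul_sum, Finset.mul_sum,
    ← Finset.sum_sub_distrib, Finset.sum_congr rfl hmain, Finset.sum_comm,
    ← Finset.sum_sub_distrib]
  refine Finset.sum_eq_zero fun a ha => ?_
  have haA := Finset.mem_of_mem_erase ha
  have hxa := (Finset.ne_of_mem_erase ha).symm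
  rw [← Finset.sum_sub_distrib]
  simp only [← Finset.sum_sub_distrib]
  refine sum_pairs_eq_zero fun b hb b' hb' hbb => ?_
  have key := startPair_star (m := m) (y := y) (pairSum_exchange h hx haA hb hb')
    (SepFam.of_ne h.gen.1 hx haA hxa) (SepFam.of_ne h.gen.2.1 hb hb' hbb) (hxt b hb) (hxt b' hb')
    (hy x hx) (hy a haA) (hy' b hb) (hy' b' hb')
  have hbm : b ∈ (B 1).erase b' := Finset.mem_erase.mpr ⟨hbb, hb⟩
  have hbm' : b' ∈ (B 1).erase b := Finset.mem_erase.mpr ⟨hbb.symm, hb'⟩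
  have hbm2 : b ∈ del B 1 b' 1 := by simpa using hbm
  have hbm2' : b' ∈ del B 1 b 1 := by simpa using hbm'
  rw [pairSum_swap_right x a b b', pairSum_swap x a b b', pairSum_swap x a b' b,
    oddFactor_del haA hxa, gamR_del hx hxa.symm, gamL_del hb' hbb, gamL_del hb hbb.symm]
  simp only [startWt_eq]
  rw [gamL_del hb' hbb, gamL_del hb hbb.symm, fprod_del hbm2, fprod_del hbm2, fprod_del hbm2',
    fprod_del hbm2', del_comm B 1 b' 1 b, pairSum]
  linear_combination oddFactor c m s (del A 1 a) x * gamR c m s 1 (del A 1 x) a *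
    (gamL c m t 1 (del B 1 b') b * gamL c m t 1 (del B 1 b) b' *
      (fprod c m t 1 (del (del B 1 b) 1 b') (s 1 x) *
        fprod c m t 1 (del (del B 1 b) 1 b') y)) * key

end

/-! ### Simple poles -/

section
variable {w : ℂ}

/-- Near `w` the function `F` has at most a simple pole at `w`, with residue `r`. -/
def HasRes (w : ℂ) (F : ℂ → ℂ) (r : ℂ) : Prop :=
  ∃ G : ℂ → ℂ, AnalyticAt ℂ G w ∧ G w = r ∧ ∀ᶠ z in 𝓝[≠] w, F z = G z / (z - w)

theorem HasRes.of_analyticAt {F : ℂ → ℂ} (h : AnalyticAt ℂ F w) : HasRes w F 0 := by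
  refine ⟨fun z => F z * (z - w), h.mul (analyticAt_id.sub analyticAt_const), by simp, ?_⟩
  filter_upwards [self_mem_nhdsWithin] with z hz
  rw [mul_div_cancel_right₀ _ (sub_ne_zero.mpr hz)]

theorem HasRes.congr {F F' : ℂ → ℂ} {r : ℂ} (h : HasRes w F r)
    (hF : ∀ᶠ z in 𝓝[≠] w, F' z = F z) : HasRes w F' r := by
  obtain ⟨G, h1, h2, h3⟩ := h
  refine ⟨G, h1, h2, ?_⟩
  filter_upwards [hF, h3] with z h4 h5
  rw [h4, h5]

theorem HasRes.add {F F' : ℂ → ℂ} {r r' : ℂ} (h : HasRes w F r) (h' : HasRes w F' r') :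
    HasRes w (fun z => F z + F' z) (r + r') := by
  obtain ⟨G, h1, h2, h3⟩ := h
  obtain ⟨G', h1', h2', h3'⟩ := h'
  refine ⟨fun z => G z + G' z, h1.add h1', by dsimp only; rw [h2, h2'], ?_⟩
  filter_upwards [h3, h3'] with z h4 h5
  rw [h4, h5, add_div]

theorem HasRes.sum {ι : Type*} {S : Finset ι} {F : ι → ℂ → ℂ} {r : ι → ℂ}
    (h : ∀ i ∈ S, HasRes w (F i) (r i)) : HasRes w (fun z => ∑ i ∈ S, F i z) (∑ i ∈ S, r i) := by
  classical
  induction S using Finset.induction_on with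
  | empty => simpa using HasRes.of_analyticAt (w := w) (analyticAt_const (v := (0 : ℂ)))
  | insert i S hi ih =>
    simp only [Finset.sum_insert hi]
    exact (h i (by simp)).add (ih fun j hj => h j (by simp [hj]))

theorem HasRes.mul {F Q : ℂ → ℂ} {r : ℂ} (hQ : AnalyticAt ℂ Q w) (h : HasRes w F r) :
    HasRes w (fun z => Q z * F z) (Q w * r) := by
  obtain ⟨G, h1, h2, h3⟩ := h
  refine ⟨fun z => Q z * G z, hQ.mul h1, by dsimp only; rw [h2], ?_⟩
  filter_upwards [h3] with z h4
  rw [h4, mul_div_assoc]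

theorem HasRes.const_mul {F : ℂ → ℂ} {r : ℂ} (q : ℂ) (h : HasRes w F r) :
    HasRes w (fun z => q * F z) (q * r) :=
  HasRes.mul analyticAt_const h

/-- A simple pole with residue `0` is removable. -/
theorem HasRes.exists_analyticAt {F : ℂ → ℂ} (h : HasRes w F 0) :
    ∃ R : ℂ → ℂ, AnalyticAt ℂ R w ∧ ∀ᶠ z in 𝓝[≠] w, F z = R z := by
  obtain ⟨G, ⟨p, hp⟩, h2, h3⟩ := h
  refine ⟨dslope G w, ⟨_, hp.has_fpower_series_dslope_fslope⟩, ?_⟩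
  filter_upwards [h3, self_mem_nhdsWithin] with z h4 hz
  rw [h4, dslope_of_ne _ hz, slope_def_field, h2, sub_zero]

theorem HasRes.meromorphicOrderAt_eq {F : ℂ → ℂ} {r : ℂ} (h : HasRes w F r) (hr : r ≠ 0) :
    meromorphicOrderAt F w = ((-1 : ℤ) : WithTop ℤ) := by
  obtain ⟨G, h1, h2, h3⟩ := h
  have e : F =ᶠ[𝓝[≠] w] fun z => (z - w) ^ (-1 : ℤ) • G z := by
    filter_upwards [h3] with z h4
    rw [h4, zpow_neg_one, smul_eq_mul, div_eq_inv_mul]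
  have hm : MeromorphicAt (fun z => (z - w) ^ (-1 : ℤ) • G z) w :=
    ((MeromorphicAt.id w).sub (MeromorphicAt.const w w)).zpow (-1) |>.smul h1.meromorphicAt
  rw [meromorphicOrderAt_congr e, meromorphicOrderAt_eq_int_iff hm]
  exact ⟨G, h1, by rwa [h2], Eventually.of_forall fun _ => rfl⟩

theorem hasRes_g (c w : ℂ) (m i : ℕ) : HasRes w (fun z => g c m i w z) (-cg c m i) := by
  refine ⟨fun _ => -cg c m i, analyticAt_const, rfl, Eventually.of_forall fun z => ?_⟩
  dsimp only
  rw [g, ← neg_sub z, div_neg, neg_div]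

variable {c : ℂ} {m n : ℕ}

theorem analyticAt_g {u v : ℂ → ℂ} {i : ℕ} (hu : AnalyticAt ℂ u w) (hv : AnalyticAt ℂ v w)
    (h : Sep c (u w) (v w)) : AnalyticAt ℂ (fun z => g c m i (u z) (v z)) w :=
  analyticAt_const.div (hu.sub hv) h.1

theorem analyticAt_f {u v : ℂ → ℂ} {i : ℕ} (hu : AnalyticAt ℂ u w) (hv : AnalyticAt ℂ v w)
    (h : Sep c (u w) (v w)) : AnalyticAt ℂ (fun z => f c m i (u z) (v z)) w :=
  analyticAt_const.add (analyticAt_g hu hv h)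

theorem analyticAt_gam {u v : ℂ → ℂ} {i : ℕ} (hu : AnalyticAt ℂ u w) (hv : AnalyticAt ℂ v w)
    (h : Sep c (u w) (v w)) : AnalyticAt ℂ (fun z => gam c m i (u z) (v z)) w := by
  unfold gam
  split_ifs
  · exact analyticAt_g hu hv h
  · exact analyticAt_f hu hv h

theorem fprod_ne_zero {s : ℕ → ℕ → ℂ} {ν : ℕ} {A : ℕ → Finset ℕ} {u : ℂ}
    (h : ∀ a ∈ A ν, Sep c (s ν a) u) : fprod c m s ν A u ≠ 0 :=
  Finset.prod_ne_zero_iff.mpr fun a ha => (h a ha).f_ne m ν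

variable {S : ℂ → ℕ → ℕ → ℂ} {t : ℕ → ℕ → ℂ}

theorem analyticAt_fprod_inv (hS : ∀ ν a, AnalyticAt ℂ (fun z => S z ν a) w) {u : ℂ → ℂ} {ν : ℕ}
    {A : ℕ → Finset ℕ} (hu : AnalyticAt ℂ u w) (h : ∀ a ∈ A ν, Sep c (S w ν a) (u w)) :
    AnalyticAt ℂ (fun z => (fprod c m (S z) ν A (u z))⁻¹) w :=
  AnalyticAt.inv (Finset.analyticAt_fun_prod _ fun a ha => analyticAt_f (hS ν a) hu (h a ha))
    (fprod_ne_zero h)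

theorem analyticAt_gamR (hS : ∀ ν a, AnalyticAt ℂ (fun z => S z ν a) w) {ν a : ℕ}
    {A : ℕ → Finset ℕ} (hA : SepFam c (S w) A) (ha : a ∈ A ν) :
    AnalyticAt ℂ (fun z => gamR c m (S z) ν A a) w :=
  Finset.analyticAt_fun_prod _ fun a' ha' => analyticAt_gam (hS ν a') (hS ν a)
    (hA.of_ne (Finset.mem_of_mem_erase ha') ha (Finset.ne_of_mem_erase ha'))

theorem analyticAt_pathSum {d : ℕ} (hS : ∀ ν a, AnalyticAt ℂ (fun z => S z ν a) w) :
    ∀ {ν : ℕ} {u : ℂ → ℂ} {v : ℂ} {h : ℂ → ℂ}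
    {Φ : ℂ → (ℕ → Finset ℕ) → (ℕ → Finset ℕ) → ℂ} {A B : ℕ → Finset ℕ}, SepFam c (S w) A →
    AnalyticAt ℂ u w → (∀ a ∈ A (ν + 1), Sep c (S w (ν + 1) a) (u w)) →
    (∀ A' B', Below ν A B A' B' → AnalyticAt ℂ (fun z => Φ z A' B') w) →
    AnalyticAt ℂ (fun z => pathSum c m (S z) t d ν (u z) v h (Φ z) A B) w := by
  induction d with
  | zero =>
    intro ν u v h Φ A B _ hu hAu hΦ
    simp only [pathSum]
    exact (analyticAt_fprod_inv hS hu hAu).mul (hΦ A B (Below.refl _ _ _))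
  | succ d ih =>
    intro ν u v h Φ A B hA hu hAu hΦ
    simp only [pathSum]
    refine (analyticAt_fprod_inv hS hu hAu).mul ((hΦ A B (Below.refl _ _ _)).add ?_)
    refine Finset.analyticAt_fun_sum _ fun a ha => Finset.analyticAt_fun_sum _ fun b hb => ?_
    refine AnalyticAt.mul (AnalyticAt.mul (AnalyticAt.mul (AnalyticAt.mul (AnalyticAt.mul
      analyticAt_const (analyticAt_g (hS _ _) hu (hAu a ha))) analyticAt_const)
      (analyticAt_gamR hS hA ha)) analyticAt_const) ?_
    refine ih (hA.del _ _) (hS _ _) (fun a' ha' => ?_) fun A' B' hAB => hΦ A' B' (hAB.step ha hb)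
    rw [mem_del] at ha'
    exact hA _ _ ha'.1 _ _ ha (by simp)

end

/-! ### Induction along the recursion -/

section
variable {w : ℂ} {c : ℂ} {m n : ℕ} {S : ℂ → ℕ → ℕ → ℂ} {t : ℕ → ℕ → ℂ}

theorem Z_eq_shift {K : Type*} [Field K] {c : K} {s t : ℕ → ℕ → K} {A B : ℕ → Finset ℕ}
    (hmn : 2 ≤ m + n) (h11 : ¬ (m = 1 ∧ n = 1)) (hA : A 1 = ∅) :
    Z c m n s t A B = Z c (m - 1) (if m = 0 then n - 1 else n) (fun ν => s (ν + 1))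
      (fun ν => t (ν + 1)) (fun ν => A (ν + 1)) (fun ν => B (ν + 1)) := by
  rw [Z, if_neg (by omega), if_neg h11, dif_neg (by simp [hA])]

theorem Z_eq_one {K : Type*} [Field K] {c : K} {s t : ℕ → ℕ → K} {A B : ℕ → Finset ℕ}
    (hmn : m + n ≤ 1) : Z c m n s t A B = 1 := by
  rw [Z, if_pos hmn]

/-- An induction principle that follows the definition of the highest coefficient. -/
theorem Z_induction {P : ℕ → ℕ → (ℕ → Finset ℕ) → (ℕ → Finset ℕ) → Prop}
    (h0 : ∀ m n A B, m + n ≤ 1 → P m n A B) (h11 : ∀ A B, P 1 1 A B)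
    (hshift : ∀ m n A B, 2 ≤ m + n → ¬ (m = 1 ∧ n = 1) → A 1 = ∅ →
      P (m - 1) (if m = 0 then n - 1 else n) (fun ν => A (ν + 1)) (fun ν => B (ν + 1)) →
      P m n A B)
    (hstep : ∀ m n A B, 2 ≤ m + n → ¬ (m = 1 ∧ n = 1) → (A 1).Nonempty →
      (∀ A' B', (A' 1).card < (A 1).card → P m n A' B') → P m n A B)
    (m n : ℕ) (A B : ℕ → Finset ℕ) : P m n A B := by
  induction hN : m + n using Nat.strong_induction_on generalizing m n A B with
  | _ N ihN =>
    induction hr : (A 1).card using Nat.strong_induction_on generalizing A B with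
    | _ r ih =>
      by_cases h : m + n ≤ 1
      · exact h0 m n A B h
      by_cases h' : m = 1 ∧ n = 1
      · obtain ⟨rfl, rfl⟩ := h'
        exact h11 A B
      rcases (A 1).eq_empty_or_nonempty with hA | hA
      · exact hshift m n A B (by omega) h' hA (ihN _ (by split_ifs <;> omega) _ _ _ _ rfl)
      · exact hstep m n A B (by omega) h' hA fun A' B' hlt => ih _ (by omega) A' B' rfl

theorem card_below_lt {A B A' B' : ℕ → Finset ℕ} {x b : ℕ} (hx : x ∈ A 1)
    (h : Below 1 (del A 1 x) (del B 1 b) A' B') : (A' 1).card < (A 1).card := by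
  rw [h.eqA 1 le_rfl, del_same]
  exact Finset.card_erase_lt_of_mem hx

theorem Generic.below {K : Type*} [Field K] {c : K} {s t : ℕ → ℕ → K} {A B A' B' : ℕ → Finset ℕ}
    {x b : ℕ} (h : Generic c s t A B) (hb : Below 1 (del A 1 x) (del B 1 b) A' B') :
    Generic c s t A' B' :=
  h.mono (fun ν => (hb.subA ν).trans (del_subset _ _ _ _))
    fun ν => (hb.subB ν).trans (del_subset _ _ _ _)

theorem Generic.shift {K : Type*} [Field K] {c : K} {s t : ℕ → ℕ → K} {A B : ℕ → Finset ℕ}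
    (h : Generic c s t A B) : Generic c (fun ν => s (ν + 1)) (fun ν => t (ν + 1))
      (fun ν => A (ν + 1)) (fun ν => B (ν + 1)) :=
  ⟨fun ν a ha ν' a' ha' hne => h.1 _ a ha _ a' ha' (by simpa using hne),
    fun ν a ha ν' a' ha' hne => h.2.1 _ a ha _ a' ha' (by simpa using hne),
    fun ν a ha ν' b hb => h.2.2 _ a ha _ b hb⟩

/-- The highest coefficient depends only on the parameters whose labels occur. -/
theorem Z_congr {K : Type*} [Field K] {c : K} (m n : ℕ) (A B : ℕ → Finset ℕ) :
    ∀ s t s' t' : ℕ → ℕ → K, (∀ ν, ∀ a ∈ A ν, s ν a = s' ν a) → (∀ ν, ∀ b ∈ B ν, t ν b = t' ν b) →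
    Z c m n s t A B = Z c m n s' t' A B := by
  induction m, n, A, B using Z_induction with
  | h0 m n A B h => intros; rw [Z_eq_one h, Z_eq_one h]
  | h11 A B =>
    intro s t s' t' hs ht
    rw [Z_one_one, Z_one_one]
    exact Finset.prod_congr rfl fun a ha => Finset.prod_congr rfl fun b hb => by
      rw [hs 1 a ha, ht 1 b hb]
  | hshift m n A B hmn h11 hA ih =>
    intro s t s' t' hs ht
    rw [Z_eq_shift hmn h11 hA, Z_eq_shift hmn h11 hA]
    exact ih _ _ _ _ (fun ν => hs (ν + 1)) fun ν => ht (ν + 1)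
  | hstep m n A B hmn h11 hA ih =>
    intro s t s' t' hs ht
    rw [Z_eq_recRHS_min hmn h11 hA, Z_eq_recRHS_min hmn h11 hA, recRHS, recRHS]
    have hx := Finset.min'_mem _ hA
    set x := (A 1).min' hA
    have e1 : oddFactor c m s A x = oddFactor c m s' A x :=
      Finset.prod_congr rfl fun a ha => by
        rw [hs 1 a (Finset.mem_of_mem_erase ha), hs 1 x hx]
    rw [e1, hs 1 x hx]
    congr 1
    refine Finset.sum_congr rfl fun b hb => ?_
    have e2 : ∀ u, startWt c m t B b u = startWt c m t' B b u := by
      intro u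
      simp only [startWt, gamL]
      rw [ht 1 b hb, Finset.prod_congr rfl fun b' hb' => by
          rw [ht 1 b' (Finset.mem_of_mem_erase hb')]]
      congr 1
      exact Finset.prod_congr rfl fun b' hb' => by rw [ht 1 b' (Finset.mem_of_mem_erase hb')]
    rw [e2, ht 1 b hb]
    congr 1
    refine pathSum_congr (fun σ _ a ha => hs σ a (del_subset _ _ _ _ ha))
      (fun σ _ a ha => ht σ a (del_subset _ _ _ _ ha)) ?_ ?_
    · intro b' hb'
      rw [ht _ b' (del_subset _ _ _ _ hb')]
      exact Finset.prod_congr rfl fun b hb => by rw [ht 1 b hb]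
    · intro A' B' hAB
      refine ih A' B' (card_below_lt hx hAB) _ _ _ _ (fun ν a ha => hs ν a ?_)
        fun ν b hb => ht ν b ?_
      · exact del_subset _ _ _ _ (hAB.subA ν ha)
      · exact del_subset _ _ _ _ (hAB.subB ν hb)

theorem analyticAt_oddFactor (hS : ∀ ν a, AnalyticAt ℂ (fun z => S z ν a) w)
    {A : ℕ → Finset ℕ} (hA : SepFam c (S w) A) {x : ℕ} (hx : x ∈ A 1) :
    AnalyticAt ℂ (fun z => oddFactor c m (S z) A x) w := by
  refine Finset.analyticAt_fun_prod _ fun a ha => ?_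
  have h := hA.of_ne (Finset.mem_of_mem_erase ha) hx (Finset.ne_of_mem_erase ha)
  split_ifs
  · exact (analyticAt_g (hS 1 a) (hS 1 x) h).div (analyticAt_f (hS 1 a) (hS 1 x) h) (h.f_ne _ _)
  · exact analyticAt_const

/-- The highest coefficient is analytic in the parameters `s` as long as these are generic. -/
theorem analyticAt_Z (m n : ℕ) (A B : ℕ → Finset ℕ) : ∀ (S : ℂ → ℕ → ℕ → ℂ) (t : ℕ → ℕ → ℂ),
    (∀ ν a, AnalyticAt ℂ (fun z => S z ν a) w) → Generic c (S w) t A B →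
    AnalyticAt ℂ (fun z => Z c m n (S z) t A B) w := by
  induction m, n, A, B using Z_induction with
  | h0 m n A B h => intros; simp only [Z_eq_one h]; exact analyticAt_const
  | h11 A B =>
    intro S t hS hg
    simp only [Z_one_one]
    exact Finset.analyticAt_fun_prod _ fun a ha => Finset.analyticAt_fun_prod _ fun b hb =>
      analyticAt_g (hS 1 a) analyticAt_const (hg.2.2 _ _ ha _ _ hb)
  | hshift m n A B hmn h11 hA ih =>
    intro S t hS hg
    simp only [Z_eq_shift hmn h11 hA]
    exact ih _ _ (fun ν => hS (ν + 1)) hg.shift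
  | hstep m n A B hmn h11 hA ih =>
    intro S t hS hg
    simp only [Z_eq_recRHS_min hmn h11 hA]
    have hx := Finset.min'_mem _ hA
    set x := (A 1).min' hA
    refine (analyticAt_oddFactor hS hg.1 hx).mul (Finset.analyticAt_fun_sum _ fun b hb => ?_)
    refine AnalyticAt.mul ?_ ?_
    · exact ((analyticAt_g analyticAt_const (hS 1 x) (hg.2.2 _ _ hx _ _ hb).symm).mul
        analyticAt_const).mul (Finset.analyticAt_fun_prod _ fun b' hb' =>
        analyticAt_f analyticAt_const (hS 1 x)
          (hg.2.2 _ _ hx _ _ (Finset.mem_of_mem_erase hb')).symm)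
    · refine analyticAt_pathSum hS (SepFam.del hg.1 _ _) (hS 1 x) ?_ ?_
      · intro a ha
        exact hg.1 _ _ (del_subset _ _ _ _ ha) _ _ hx (by simp)
      · intro A' B' hAB
        exact ih A' B' (card_below_lt hx hAB) S t hS (hg.below hAB)

end

/-! ### Residues of sums over paths -/

theorem setParam_self {K : Type*} (s : ℕ → ℕ → K) (μ i : ℕ) (z : K) : setParam s μ i z μ i = z := by
  simp [setParam]

theorem setParam_of_ne {K : Type*} (s : ℕ → ℕ → K) {μ i ν a : ℕ} (z : K) (h : ¬ (ν = μ ∧ a = i)) :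
    setParam s μ i z ν a = s ν a := by
  unfold setParam
  by_cases hν : ν = μ
  · subst hν
    rw [Function.update_self, Function.update_of_ne (by tauto)]
  · rw [Function.update_of_ne hν]

theorem setParam_of_mem_del {K : Type*} {s : ℕ → ℕ → K} {A : ℕ → Finset ℕ} {μ i ν a : ℕ}
    (h : a ∈ del A μ i ν) (z : K) :
    setParam s μ i z ν a = s ν a :=
  setParam_of_ne s z (mem_del.mp h).2

section
variable {K : Type*} [Field K] {c : K} {m : ℕ} {s t : ℕ → ℕ → K} {A B : ℕ → Finset ℕ}

/-- `resFactor` without its first factor `g_[μ+1](t^μ_k, z)`, which carries the pole. -/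
def resRest (c : K) (m : ℕ) (s t : ℕ → ℕ → K) (A B : ℕ → Finset ℕ) (μ i k : ℕ) (z : K) : K :=
  ((∏ b ∈ (B μ).erase k, gam c m μ (t μ b) (t μ k)) *
      (∏ a ∈ (A μ).erase i, gam c m μ z (s μ a))) /
    (fprod c m t (μ + 1) B (t μ k) * ∏ a ∈ A (μ - 1), f c m μ z (s (μ - 1) a))

theorem resFactor_eq (μ i k : ℕ) (z : K) : resFactor c m s t A B μ i k z =
    g c m (μ + 1) (t μ k) z * resRest c m s t A B μ i k z := by
  rw [resFactor, resRest, mul_div_assoc, fprod]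

theorem resRest_del_self {μ i k a b : ℕ} (ha : a ∈ (A μ).erase i) (hb : b ∈ (B μ).erase k)
    (hμ : 1 ≤ μ) (z : K) : resRest c m s t A B μ i k z =
      gam c m μ (t μ b) (t μ k) * gam c m μ z (s μ a) *
        resRest c m s t (del A μ a) (del B μ b) μ i k z := by
  simp only [resRest, fprod, del_same, del_of_ne _ _ (show μ + 1 ≠ μ by omega),
    del_of_ne _ _ (show μ - 1 ≠ μ by omega)]
  rw [← Finset.mul_prod_erase _ (fun b => gam c m μ (t μ b) (t μ k)) hb,
    ← Finset.mul_prod_erase _ (fun a => gam c m μ z (s μ a)) ha,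
    Finset.erase_right_comm (a := i), Finset.erase_right_comm (a := k)]
  ring

theorem resRest_del_succ {μ i k a b : ℕ} (hb : b ∈ B (μ + 1))
    (hf : f c m (μ + 1) (t (μ + 1) b) (t μ k) ≠ 0) (z : K) :
    resRest c m s t (del A (μ + 1) a) (del B (μ + 1) b) μ i k z =
      resRest c m s t A B μ i k z * f c m (μ + 1) (t (μ + 1) b) (t μ k) := by
  simp only [resRest, del_of_ne _ _ (show μ ≠ μ + 1 by omega),
    del_of_ne _ _ (show μ - 1 ≠ μ + 1 by omega)]
  rw [fprod_del hb]
  field_simp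

theorem resRest_del_pred {μ i k a b : ℕ} (hμ : 1 ≤ μ) (ha : a ∈ A (μ - 1)) {z : K}
    (hf : f c m μ z (s (μ - 1) a) ≠ 0) :
    resRest c m s t (del A (μ - 1) a) (del B (μ - 1) b) μ i k z =
      resRest c m s t A B μ i k z * f c m μ z (s (μ - 1) a) := by
  simp only [resRest, fprod, del_of_ne _ _ (show μ ≠ μ - 1 by omega),
    del_of_ne _ _ (show μ + 1 ≠ μ - 1 by omega), del_same]
  rw [← Finset.mul_prod_erase _ (fun a => f c m μ z (s (μ - 1) a)) ha]
  field_simp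

theorem resRest_del_of_ne {μ σ i k a b : ℕ} (h1 : σ ≠ μ) (h2 : σ ≠ μ + 1) (h3 : σ ≠ μ - 1) (z : K) :
    resRest c m s t (del A σ a) (del B σ b) μ i k z = resRest c m s t A B μ i k z := by
  simp only [resRest, fprod, del_of_ne _ _ h1.symm, del_of_ne _ _ h2.symm, del_of_ne _ _ h3.symm]

theorem fprod_setParam {μ i ν : ℕ} (hν : ν ≠ μ) (z u : K) :
    fprod c m (setParam s μ i z) ν A u = fprod c m s ν A u :=
  Finset.prod_congr rfl fun a _ => by rw [setParam_of_ne s z (by tauto)]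

theorem fprod_setParam_self {μ i : ℕ} (hi : i ∈ A μ) (z u : K) :
    fprod c m (setParam s μ i z) μ A u = f c m μ z u * fprod c m s μ (del A μ i) u := by
  rw [fprod_del hi, setParam_self, mul_comm]
  congr 1
  exact Finset.prod_congr rfl fun a ha => by rw [setParam_of_mem_del ha]

theorem gamR_setParam {μ i ν a : ℕ} (hν : ν ≠ μ) (z : K) :
    gamR c m (setParam s μ i z) ν A a = gamR c m s ν A a :=
  Finset.prod_congr rfl fun a' _ => by
    rw [setParam_of_ne s z (by tauto), setParam_of_ne s z (by tauto)]

theorem gamR_setParam_self {μ i a : ℕ} (hi : i ∈ A μ) (hne : a ≠ i) (z : K) :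
    gamR c m (setParam s μ i z) μ A a = gam c m μ z (s μ a) * gamR c m s μ (del A μ i) a := by
  rw [gamR_del hi hne, setParam_self, setParam_of_ne s z (by tauto)]
  congr 1
  exact Finset.prod_congr rfl fun a' ha' => by
    rw [setParam_of_mem_del (Finset.mem_of_mem_erase ha'), setParam_of_ne s z (by tauto)]

end

section
variable {c : ℂ} {m : ℕ} {s t : ℕ → ℕ → ℂ}

theorem analyticAt_setParam (s : ℕ → ℕ → ℂ) (μ i : ℕ) (w : ℂ) (ν a : ℕ) :
    AnalyticAt ℂ (fun z => setParam s μ i z ν a) w := by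
  by_cases h : ν = μ ∧ a = i
  · obtain ⟨rfl, rfl⟩ := h
    simp only [setParam_self]
    exact analyticAt_id
  · simp only [setParam_of_ne s _ h]
    exact analyticAt_const

/-- The residue of a sum over paths.  If the function `Φ` of the remaining labels has the residue `C
· resRest · Ψ` (`Ψ` being evaluated without the labels `i` and `k` of colour `μ`), then so has the
sum over paths, up to the two factors that connect the labels `i`, `k` with the place from which the
path starts: for `μ = ν + 1` the factor `1 / f_μ(w, u)`, for `μ = ν` a factor of the weight `h`. -/
theorem hasRes_pathSum {μ i k : ℕ} (hμ : 1 ≤ μ) (C : ℂ)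
    {Φ : ℂ → (ℕ → Finset ℕ) → (ℕ → Finset ℕ) → ℂ} {Ψ : (ℕ → Finset ℕ) → (ℕ → Finset ℕ) → ℂ}
    {d : ℕ} : ∀ {ν : ℕ} {u v : ℂ} {h h' : ℂ → ℂ} {A B : ℕ → Finset ℕ}, i ∈ A μ → k ∈ B μ →
    SepFam c (setParam s μ i (t μ k)) A → SepFam c t B →
    (∀ a ∈ A (ν + 1), Sep c (setParam s μ i (t μ k) (ν + 1) a) u) →
    (∀ b ∈ B (ν + 1), h (t (ν + 1) b) = h' (t (ν + 1) b) *
      if ν = μ then (f c m (ν + 1) (t (ν + 1) b) (t μ k))⁻¹ else 1) →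
    (∀ A' B', Below ν A B A' B' → i ∈ A' μ → k ∈ B' μ → HasRes (t μ k) (fun z => Φ z A' B')
      (C * resRest c m s t A' B' μ i k (t μ k) * Ψ (del A' μ i) (del B' μ k))) →
    (∀ A' B', Below ν A B A' B' → ¬ (i ∈ A' μ ∧ k ∈ B' μ) →
      AnalyticAt ℂ (fun z => Φ z A' B') (t μ k)) →
    HasRes (t μ k) (fun z => pathSum c m (setParam s μ i z) t d ν u v h (Φ z) A B)
      (C * resRest c m s t A B μ i k (t μ k) * (if ν + 1 = μ then (f c m μ (t μ k) u)⁻¹ else 1) *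
        pathSum c m s t d ν u v h' Ψ (del A μ i) (del B μ k)) := by
  have hSan := analyticAt_setParam s μ i (t μ k)
  -- the value of the common prefactor
  have hpre : ∀ {ν : ℕ} {u : ℂ} {A : ℕ → Finset ℕ}, i ∈ A μ →
      (fprod c m (setParam s μ i (t μ k)) (ν + 1) A u)⁻¹ =
        (if ν + 1 = μ then (f c m μ (t μ k) u)⁻¹ else 1) *
          (fprod c m s (ν + 1) (del A μ i) u)⁻¹ := by
    intro ν u A hi
    split_ifs with hν
    · subst hν
      rw [fprod_setParam_self hi, mul_inv]
    · rw [fprod_setParam hν, one_mul]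
      simp only [fprod, del_of_ne A i hν]
  induction d with
  | zero =>
    intro ν u v h h' A B hi hk hA hB hu hh hΦ hΦ'
    have h1 := HasRes.mul (analyticAt_fprod_inv (m := m) hSan analyticAt_const hu)
      (hΦ A B (Below.refl _ _ _) hi hk)
    simp only [pathSum]
    rw [hpre hi] at h1
    convert h1 using 1
    ring
  | succ d ih =>
    intro ν u v h h' A B hi hk hA hB hu hh hΦ hΦ'
    simp only [pathSum]
    set w := t μ k with hw
    set r := resRest c m s t A B μ i k w with hr
    -- the residues of the individual terms
    have hterm : ∀ a ∈ A (ν + 1), ∀ b ∈ B (ν + 1), HasRes w (fun z =>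
        (g c m (ν + 2) (t (ν + 1) b) v * g c m (ν + 1) (setParam s μ i z (ν + 1) a) u *
          gamL c m t (ν + 1) B b * gamR c m (setParam s μ i z) (ν + 1) A a * h (t (ν + 1) b)) *
        pathSum c m (setParam s μ i z) t d (ν + 1) (setParam s μ i z (ν + 1) a) (t (ν + 1) b)
          (lowerWt c m t (ν + 1) B) (Φ z) (del A (ν + 1) a) (del B (ν + 1) b))
        (if a ∈ del A μ i (ν + 1) ∧ b ∈ del B μ k (ν + 1) then C * r *
          ((g c m (ν + 2) (t (ν + 1) b) v * g c m (ν + 1) (s (ν + 1) a) u *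
          gamL c m t (ν + 1) (del B μ k) b * gamR c m s (ν + 1) (del A μ i) a * h' (t (ν + 1) b)) *
          pathSum c m s t d (ν + 1) (s (ν + 1) a) (t (ν + 1) b) (lowerWt c m t (ν + 1) (del B μ k))
          Ψ (del (del A μ i) (ν + 1) a) (del (del B μ k) (ν + 1) b)) else 0) := by
      intro a ha b hb
      have hcoef : AnalyticAt ℂ (fun z => g c m (ν + 2) (t (ν + 1) b) v *
          g c m (ν + 1) (setParam s μ i z (ν + 1) a) u * gamL c m t (ν + 1) B b *
          gamR c m (setParam s μ i z) (ν + 1) A a * h (t (ν + 1) b)) w :=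
        AnalyticAt.mul (AnalyticAt.mul (AnalyticAt.mul (AnalyticAt.mul analyticAt_const
          (analyticAt_g (hSan _ _) analyticAt_const (hu a ha))) analyticAt_const)
          (analyticAt_gamR hSan hA ha)) analyticAt_const
      have hsepA : ∀ a' ∈ del A (ν + 1) a (ν + 1 + 1), Sep c (setParam s μ i w (ν + 1 + 1) a')
          (setParam s μ i w (ν + 1) a) := fun a' ha' =>
        hA _ _ (del_subset _ _ _ _ ha') _ _ ha (by simp)
      split_ifs with hab
      · have hai := (mem_del.mp hab.1).2
        have hbk := (mem_del.mp hab.2).2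
        have hsa : ∀ z, setParam s μ i z (ν + 1) a = s (ν + 1) a := fun z =>
          setParam_of_mem_del hab.1 z
        rw [hsa] at hsepA
        simp only [hsa] at hcoef ⊢
        have IH := ih (ν := ν + 1) (u := s (ν + 1) a) (v := t (ν + 1) b)
          (h := lowerWt c m t (ν + 1) B) (h' := lowerWt c m t (ν + 1) (del B μ k))
          (A := del A (ν + 1) a) (B := del B (ν + 1) b)
          (mem_del.mpr ⟨hi, fun h => hai ⟨h.1.symm, h.2.symm⟩⟩)
          (mem_del.mpr ⟨hk, fun h => hbk ⟨h.1.symm, h.2.symm⟩⟩) (hA.del _ _) (hB.del _ _) hsepA (by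
            intro b' hb'
            split_ifs with hν
            · subst hν
              exact lowerWt_del hk _
            · rw [mul_one]
              simp only [lowerWt, del_of_ne B k hν])
          (fun A' B' hAB => hΦ A' B' (hAB.step ha hb))
          (fun A' B' hAB => hΦ' A' B' (hAB.step ha hb))
        have key := HasRes.mul hcoef IH
        convert key using 1
        rw [del_comm A μ i, del_comm B μ k, hh b hb]
        by_cases h1 : ν + 1 = μ
        · subst h1
          rw [if_neg (by omega), if_neg (by omega), gamR_setParam_self hi (by tauto),
            gamL_del hk (by tauto), hr,
            resRest_del_self (show a ∈ (A (ν + 1)).erase i by simpa using hab.1)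
              (show b ∈ (B (ν + 1)).erase k by simpa using hab.2) hμ]
          ring
        · have e1 : gamL c m t (ν + 1) (del B μ k) b = gamL c m t (ν + 1) B b := by
            simp only [gamL, del_of_ne B k h1]
          have e2 : gamR c m s (ν + 1) (del A μ i) a = gamR c m s (ν + 1) A a := by
            simp only [gamR, del_of_ne A i h1]
          rw [e1, e2, gamR_setParam h1]
          by_cases h2 : ν = μ
          · subst h2
            have hf : f c m (ν + 1) (t (ν + 1) b) (t ν k) ≠ 0 :=
              (hB _ _ hb _ _ hk (by simp)).f_ne _ _
            rw [if_pos rfl, if_neg (by omega), resRest_del_succ hb hf, hr, hw]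
            field_simp
          · rw [if_neg h2]
            by_cases h3 : ν + 1 + 1 = μ
            · subst h3
              have hf : f c m (ν + 1 + 1) w (s (ν + 1) a) ≠ 0 := by
                have := hsepA i (mem_del.mpr ⟨hi, by simp⟩)
                rw [setParam_self] at this
                exact this.f_ne _ _
              have e3 := resRest_del_pred (c := c) (m := m) (s := s) (t := t) (A := A) (B := B)
                (i := i) (k := k) (a := a) (b := b) (μ := ν + 1 + 1) hμ ha hf
              rw [Nat.add_sub_cancel] at e3
              rw [if_pos rfl, e3, hr]
              field_simp
            · rw [if_neg h3, resRest_del_of_ne h1 (by omega) (by omega), hr]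
              ring
      · have hreg : AnalyticAt ℂ (fun z => pathSum c m (setParam s μ i z) t d (ν + 1)
            (setParam s μ i z (ν + 1) a) (t (ν + 1) b) (lowerWt c m t (ν + 1) B) (Φ z)
            (del A (ν + 1) a) (del B (ν + 1) b)) w := by
          refine analyticAt_pathSum hSan (hA.del _ _) (hSan _ _) hsepA fun A' B' hAB =>
            hΦ' A' B' (hAB.step ha hb) fun hik => hab ?_
          have h1 := (mem_del.mp (hAB.subA _ hik.1)).2
          have h2 := (mem_del.mp (hAB.subB _ hik.2)).2
          exact ⟨mem_del.mpr ⟨ha, fun h => h1 ⟨h.1.symm, h.2.symm⟩⟩,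
            mem_del.mpr ⟨hb, fun h => h2 ⟨h.1.symm, h.2.symm⟩⟩⟩
        exact HasRes.of_analyticAt (hcoef.mul hreg)
    have hsum := HasRes.mul (analyticAt_fprod_inv (m := m) hSan analyticAt_const hu)
      ((hΦ A B (Below.refl _ _ _) hi hk).add
      (HasRes.sum fun a ha => HasRes.sum fun b hb => hterm a ha b hb))
    convert hsum using 1
    simp only [hpre hi]
    -- the terms with `a = i` or `b = k` have no residue
    have e : ∀ X : ℕ → ℕ → ℂ, (∑ a ∈ A (ν + 1), ∑ b ∈ B (ν + 1),
        if a ∈ del A μ i (ν + 1) ∧ b ∈ del B μ k (ν + 1) then X a b else 0) =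
        ∑ a ∈ del A μ i (ν + 1), ∑ b ∈ del B μ k (ν + 1), X a b := by
      intro X
      rw [← Finset.sum_subset (del_subset A μ i (ν + 1))]
      · refine Finset.sum_congr rfl fun a ha => ?_
        rw [← Finset.sum_subset (del_subset B μ k (ν + 1))]
        · exact Finset.sum_congr rfl fun b hb => if_pos ⟨ha, hb⟩
        · intro b _ hb
          exact if_neg fun h => hb h.2
      · intro a _ ha
        exact Finset.sum_eq_zero fun b _ => if_neg fun h => ha h.1
    rw [e]
    simp only [← Finset.mul_sum]
    ring

end

/-! ### Dropping the first colour -/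

section
variable {K : Type*} [Field K] {c : K} {m n : ℕ} {s t : ℕ → ℕ → K} {A B : ℕ → Finset ℕ}

theorem cg_shift (c : K) (m : ℕ) {i : ℕ} (hi : 1 ≤ i) : cg c (m - 1) i = cg c m (i + 1) := by
  unfold cg
  by_cases h : i + 1 ≤ m
  · rw [if_pos h, if_pos (by omega)]
  · rw [if_neg h, if_neg (by omega)]

theorem g_shift (c : K) (m : ℕ) {i : ℕ} (hi : 1 ≤ i) : g c (m - 1) i = g c m (i + 1) := by
  funext u v
  rw [g, g, cg_shift c m hi]

theorem f_shift (c : K) (m : ℕ) {i : ℕ} (hi : 1 ≤ i) : f c (m - 1) i = f c m (i + 1) := by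
  funext u v
  rw [f, f, g_shift c m hi]

theorem gam_shift (c : K) (m : ℕ) {i : ℕ} (hi : 1 ≤ i) : gam c (m - 1) i = gam c m (i + 1) := by
  funext u v
  rw [gam, gam, f_shift c m hi, g_shift c m hi]
  by_cases h : i + 1 = m
  · rw [if_pos h, if_pos (by omega)]
  · rw [if_neg h, if_neg (by omega)]

theorem del_shift (A : ℕ → Finset ℕ) (μ i : ℕ) :
    (fun ν => del A (μ + 1) i (ν + 1)) = del (fun ν => A (ν + 1)) μ i := by
  funext ν; ext a; simp only [mem_del]; simp

theorem setParam_shift {K : Type*} (s : ℕ → ℕ → K) (μ i : ℕ) (z : K) :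
    (fun ν => setParam s (μ + 1) i z (ν + 1)) = setParam (fun ν => s (ν + 1)) μ i z := by
  funext ν a
  by_cases h : ν = μ ∧ a = i
  · obtain ⟨rfl, rfl⟩ := h
    rw [setParam_self, setParam_self]
  · rw [setParam_of_ne _ z h, setParam_of_ne _ z (by omega)]

theorem resRest_shift {μ i k : ℕ} (hμ : 1 ≤ μ) (z : K) :
    resRest c (m - 1) (fun ν => s (ν + 1)) (fun ν => t (ν + 1)) (fun ν => A (ν + 1))
      (fun ν => B (ν + 1)) μ i k z = resRest c m s t A B (μ + 1) i k z := by
  simp only [resRest, fprod, gam_shift c m hμ, f_shift c m hμ,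
    f_shift c m (show 1 ≤ μ + 1 by omega), Nat.add_sub_cancel, Nat.sub_add_cancel hμ]

/-- Dropping a first colour that the paths do not visit. -/
theorem pathSum_shift {d : ℕ} : ∀ {ν : ℕ} {u v : K} {h : K → K}
    {Φ Φ' : (ℕ → Finset ℕ) → (ℕ → Finset ℕ) → K} {A B : ℕ → Finset ℕ},
    (∀ A' B', Below (ν + 1) A B A' B' →
      Φ A' B' = Φ' (fun ν => A' (ν + 1)) (fun ν => B' (ν + 1))) →
    pathSum c m s t d (ν + 1) u v h Φ A B =
      pathSum c (m - 1) (fun ν => s (ν + 1)) (fun ν => t (ν + 1)) d ν u v h Φ'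
        (fun ν => A (ν + 1)) (fun ν => B (ν + 1)) := by
  induction d with
  | zero =>
    intro ν u v h Φ Φ' A B hΦ
    simp only [pathSum, fprod, f_shift c m (show 1 ≤ ν + 1 by omega), hΦ A B (Below.refl _ _ _)]
  | succ d ih =>
    intro ν u v h Φ Φ' A B hΦ
    simp only [pathSum, fprod, f_shift c m (show 1 ≤ ν + 1 by omega), hΦ A B (Below.refl _ _ _)]
    congr 2
    refine Finset.sum_congr rfl fun a ha => Finset.sum_congr rfl fun b hb => ?_
    rw [ih (Φ' := Φ') fun A' B' hAB => hΦ A' B' (hAB.step ha hb), del_shift, del_shift]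
    simp only [g_shift c m (show 1 ≤ ν + 1 by omega), g_shift c m (show 1 ≤ ν + 2 by omega), gamL,
      gamR, gam_shift c m (show 1 ≤ ν + 1 by omega)]
    congr 1
    congr 1
    funext w
    simp only [lowerWt, f_shift c m (show 1 ≤ ν + 1 + 1 by omega)]

theorem Valid.shift (h : Valid c m n s t A B) :
    Valid c (m - 1) (if m = 0 then n - 1 else n) (fun ν => s (ν + 1)) (fun ν => t (ν + 1))
      (fun ν => A (ν + 1)) (fun ν => B (ν + 1)) where
  gen := h.gen.shift
  card ν := h.card (ν + 1)
  supp ν hν := h.supp (ν + 1) (by split_ifs at hν <;> omega)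

/-- If the first colour is empty, the sum over the paths that start from it with equal values `y`
of both parameters is a multiple of the highest coefficient. -/
theorem pathSum_virtual [CharZero K] (hc : c ≠ 0) (hmn : 2 ≤ m + n) (h : Valid c m n s t A B)
    (hA : A 1 = ∅) {y : K} (hy : ∀ a ∈ A 2, Sep c (s 2 a) y) (hy' : ∀ b ∈ B 2, Sep c (t 2 b) y) :
    pathSum c m s t (m + n - 2) 1 y y (fun w => (f c m 2 w y)⁻¹) (Z c m n s t) A B =
      (fprod c m t 2 B y)⁻¹ * Z c m n s t A B := by
  -- for `m + n = 2` there is no second colour; otherwise drop the first colour, which becomes the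
  -- additional colour of `fprod_sub_mul_Z`
  rcases hmn.eq_or_lt with hmn2 | hmn3
  · have hA2 : A 2 = ∅ := h.supp 2 (by omega)
    have hB2 : B 2 = ∅ := by rw [← Finset.card_eq_zero, ← h.card 2, hA2, Finset.card_empty]
    rw [← hmn2]
    simp [pathSum, fprod, hA2, hB2]
  have h11 : ¬ (m = 1 ∧ n = 1) := by omega
  have hv := fprod_sub_mul_Z hc (by split_ifs <;> omega) h.shift (y := y) hy hy'
  set m' := m - 1 with hm'
  set n' := if m = 0 then n - 1 else n with hn'
  have hmn' : m' + n' + 1 = m + n := by rw [hm', hn']; split_ifs <;> omega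
  rw [← Z_eq_shift hmn h11 hA] at hv
  rw [pathSum_shift (m := m) (s := s) (t := t) (ν := 0) (Φ' := Z c m' n' (fun ν => s (ν + 1))
      fun ν => t (ν + 1)) fun A' B' hAB => by
        rw [Z_eq_shift hmn h11 (by rw [hAB.eqA 1 le_rfl, hA])],
    show m + n - 2 = (m' + n' - 2) + 1 by omega]
  have hf : fprod c m' (fun ν => t (ν + 1)) 1 (fun ν => B (ν + 1)) y ≠ 0 :=
    Finset.prod_ne_zero_iff.mpr fun b hb => (hy' b hb).f_ne _ _
  have hf' : fprod c m' (fun ν => s (ν + 1)) 1 (fun ν => A (ν + 1)) y ≠ 0 :=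
    Finset.prod_ne_zero_iff.mpr fun a ha => (hy a ha).f_ne _ _
  have hff : fprod c m t 2 B y = fprod c m' (fun ν => t (ν + 1)) 1 (fun ν => B (ν + 1)) y := by
    simp only [fprod, hm', f_shift c m le_rfl]
  rw [pathSum, hff, ← Z_eq_shift hmn h11 hA]
  have e : ∑ a ∈ A (0 + 1 + 1), ∑ b ∈ B (0 + 1 + 1),
      (g c m' (0 + 2) (t (0 + 1 + 1) b) y * g c m' (0 + 1) (s (0 + 1 + 1) a) y *
        gamL c m' (fun ν => t (ν + 1)) (0 + 1) (fun ν => B (ν + 1)) b *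
        gamR c m' (fun ν => s (ν + 1)) (0 + 1) (fun ν => A (ν + 1)) a *
        (f c m 2 (t (0 + 1 + 1) b) y)⁻¹) *
      pathSum c m' (fun ν => s (ν + 1)) (fun ν => t (ν + 1)) (m' + n' - 2) (0 + 1)
        (s (0 + 1 + 1) a) (t (0 + 1 + 1) b)
        (lowerWt c m' (fun ν => t (ν + 1)) (0 + 1) fun ν => B (ν + 1))
        (Z c m' n' (fun ν => s (ν + 1)) fun ν => t (ν + 1)) (del (fun ν => A (ν + 1)) (0 + 1) a)
        (del (fun ν => B (ν + 1)) (0 + 1) b) =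
      (fprod c m' (fun ν => t (ν + 1)) 1 (fun ν => B (ν + 1)) y)⁻¹ *
      virtualSum c m' n' (fun ν => s (ν + 1)) (fun ν => t (ν + 1)) (fun ν => A (ν + 1))
        (fun ν => B (ν + 1)) y := by
    rw [virtualSum, Finset.mul_sum]
    refine Finset.sum_congr rfl fun a _ => ?_
    rw [Finset.mul_sum, Finset.mul_sum]
    refine Finset.sum_congr rfl fun b hb => ?_
    have hb1 : f c m' 1 (t (1 + 1) b) y ≠ 0 := (hy' b hb).f_ne _ _
    have hb2 : fprod c m' (fun ν => t (ν + 1)) 1 (del (fun ν => B (ν + 1)) 1 b) y ≠ 0 :=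
      Finset.prod_ne_zero_iff.mpr fun b' hb' =>
        (hy' b' (del_subset (fun ν => B (ν + 1)) 1 b 1 hb')).f_ne _ _
    rw [startWt_eq, fprod_del (A := fun ν => B (ν + 1)) hb, hm', ← f_shift c m le_rfl, ← hm']
    simp only [zero_add]
    field_simp
  rw [e, ← hv]
  simp only [zero_add, ← hm']
  field_simp
  ring

end

/-! ### Genericity near the pole -/

section
variable {c : ℂ} {m n : ℕ} {s t : ℕ → ℕ → ℂ} {A B : ℕ → Finset ℕ} {μ i k : ℕ}

/-- A further parameter of value `z` keeps the family generic if `z` is separated from all the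
others. -/
theorem generic_setParam {z : ℂ} (h : Generic c s t (del A μ i) B)
    (hs : ∀ ν, ∀ a ∈ del A μ i ν, Sep c z (s ν a)) (ht : ∀ ν, ∀ b ∈ B ν, Sep c z (t ν b)) :
    Generic c (setParam s μ i z) t A B := by
  have hdel : ∀ {ν a}, a ∈ A ν → ¬ (ν = μ ∧ a = i) → a ∈ del A μ i ν := fun h1 h2 =>
    mem_del.mpr ⟨h1, h2⟩
  refine ⟨fun ν a ha ν' a' ha' hne => ?_, h.2.1, fun ν a ha ν' b hb => ?_⟩
  · by_cases h1 : ν = μ ∧ a = i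
    · have h2 : ¬ (ν' = μ ∧ a' = i) := fun h2 => hne (by rw [h1.1, h1.2, h2.1, h2.2])
      obtain ⟨rfl, rfl⟩ := h1
      rw [setParam_self, setParam_of_ne _ _ h2]
      exact hs _ _ (hdel ha' h2)
    · rw [setParam_of_ne _ _ h1]
      by_cases h2 : ν' = μ ∧ a' = i
      · obtain ⟨rfl, rfl⟩ := h2
        rw [setParam_self]
        exact (hs _ _ (hdel ha h1)).symm
      · rw [setParam_of_ne _ _ h2]
        exact h.1 _ _ (hdel ha h1) _ _ (hdel ha' h2) hne
  · by_cases h1 : ν = μ ∧ a = i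
    · obtain ⟨rfl, rfl⟩ := h1
      rw [setParam_self]
      exact ht _ _ hb
    · rw [setParam_of_ne _ _ h1]
      exact h.2.2 _ _ (hdel ha h1) _ _ hb

/-- At the collision, the parameters remain generic if one of the two that collide is removed. -/
theorem generic_setParam_pole (h : Generic c s t (del A μ i) B) (hk : k ∈ B μ)
    {A' B' : ℕ → Finset ℕ} (hA : ∀ ν, A' ν ⊆ A ν) (hB : ∀ ν, B' ν ⊆ B ν)
    (hik : ¬ (i ∈ A' μ ∧ k ∈ B' μ)) : Generic c (setParam s μ i (t μ k)) t A' B' := by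
  have hsub : ∀ ν, del A' μ i ν ⊆ del A μ i ν := fun ν a ha => by
    rw [mem_del] at ha ⊢
    exact ⟨hA ν ha.1, ha.2⟩
  by_cases hi : i ∈ A' μ
  · refine generic_setParam (h.mono hsub hB) (fun ν a ha => ?_) fun ν b hb => ?_
    · exact (h.2.2 _ _ (hsub _ ha) _ _ hk).symm
    · refine h.2.1 _ _ hk _ _ (hB _ hb) fun e => hik ⟨hi, ?_⟩
      obtain ⟨rfl, rfl⟩ := Prod.mk.inj e
      exact hb
  · have hdel : ∀ {ν a}, a ∈ A' ν → a ∈ del A' μ i ν := fun ha =>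
      mem_del.mpr ⟨ha, fun h => hi (by rw [← h.1, ← h.2]; exact ha)⟩
    have hg : Generic c s t A' B' := h.mono (fun ν a ha => hsub ν (hdel ha)) hB
    refine ⟨fun ν a ha ν' a' ha' hne => ?_, hg.2.1, fun ν a ha ν' b hb => ?_⟩
    · rw [setParam_of_mem_del (hdel ha), setParam_of_mem_del (hdel ha')]
      exact hg.1 _ _ ha _ _ ha' hne
    · rw [setParam_of_mem_del (hdel ha)]
      exact hg.2.2 _ _ ha _ _ hb

theorem eventually_sep (c w v : ℂ) : ∀ᶠ z in 𝓝[≠] w, Sep c z v := by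
  have h : ∀ x : ℂ, ∀ᶠ z in 𝓝[≠] w, z ≠ x := by
    intro x
    by_cases hx : w = x
    · subst hx
      exact self_mem_nhdsWithin
    · exact (eventually_ne_nhds hx).filter_mono nhdsWithin_le_nhds
  filter_upwards [h v, h (v + c), h (v - c)] with z h1 h2 h3
  exact ⟨sub_ne_zero.mpr h1, fun e => h2 (by linear_combination e),
    fun e => h3 (by linear_combination e)⟩

theorem eventually_generic_setParam (h : Generic c s t (del A μ i) B) (N : ℕ)
    (hA : ∀ ν, N < ν → A ν = ∅) (hB : ∀ ν, N < ν → B ν = ∅) (w : ℂ) :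
    ∀ᶠ z in 𝓝[≠] w, Generic c (setParam s μ i z) t A B := by
  have h1 : ∀ᶠ z in 𝓝[≠] w, ∀ ν ∈ Finset.range (N + 1), ∀ a ∈ A ν, Sep c z (s ν a) := by
    simp only [Filter.eventually_all_finset]
    exact fun ν _ a _ => eventually_sep c w _
  have h2 : ∀ᶠ z in 𝓝[≠] w, ∀ ν ∈ Finset.range (N + 1), ∀ b ∈ B ν, Sep c z (t ν b) := by
    simp only [Filter.eventually_all_finset]
    exact fun ν _ a _ => eventually_sep c w _
  filter_upwards [h1, h2] with z h1 h2
  refine generic_setParam h (fun ν a ha => ?_) fun ν b hb => ?_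
  · by_cases hν : N < ν
    · simpa [hA ν hν] using del_subset _ _ _ _ ha
    · exact h1 ν (by simp; omega) a (del_subset _ _ _ _ ha)
  · by_cases hν : N < ν
    · simp [hB ν hν] at hb
    · exact h2 ν (by simp; omega) b hb

end

/-! ### The residue formula -/

/-- For generic parameters, the highest coefficient with the labels `A`, `B` has at most a simple
pole where two parameters `s^μ_i`, `t^μ_k` collide, with the expected residue.  (The factor
`g_[μ+1](t^μ_k, z)` has the residue `-c_[μ+1]` at `z = t^μ_k`.) -/
def ResidueFormula (c : ℂ) (m n : ℕ) (A B : ℕ → Finset ℕ) : Prop :=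
  ∀ (s t : ℕ → ℕ → ℂ) (μ i k : ℕ), (∀ ν, (A ν).card = (B ν).card) →
    (∀ ν, m + n - 1 < ν → A ν = ∅) → A 0 = ∅ → 1 ≤ μ → i ∈ A μ → k ∈ B μ →
    Generic c s t (del A μ i) B →
    HasRes (t μ k) (fun z => Z c m n (setParam s μ i z) t A B)
      (-cg c m (μ + 1) * resRest c m s t A B μ i k (t μ k) *
        Z c m n s t (del A μ i) (del B μ k))

section
variable {c : ℂ} {m n : ℕ} {s t : ℕ → ℕ → ℂ} {A B : ℕ → Finset ℕ} {μ i k : ℕ}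

theorem odd1_mul_f {a x : ℂ} (h : f c m 1 a x ≠ 0) :
    odd1 c m a x * f c m 1 a x = gam c m 1 a x := by
  by_cases hm : m = 1
  · subst hm
    rw [odd1, gam, if_pos rfl, if_pos rfl, div_mul_cancel₀ _ h]
  · rw [odd1, gam, if_neg hm, if_neg (Ne.symm hm), one_mul]

theorem eventually_valid_setParam (hcard : ∀ ν, (A ν).card = (B ν).card)
    (hsupp : ∀ ν, m + n - 1 < ν → A ν = ∅) (hg : Generic c s t (del A μ i) B) (w : ℂ) :
    ∀ᶠ z in 𝓝[≠] w, Valid c m n (setParam s μ i z) t A B := by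
  filter_upwards [eventually_generic_setParam hg (m + n - 1) hsupp (fun ν hν => by
    rw [← Finset.card_eq_zero, ← hcard ν, hsupp ν hν, Finset.card_empty]) w] with z hz
  exact ⟨hz, hcard, hsupp⟩

theorem valid_del (hcard : ∀ ν, (A ν).card = (B ν).card) (hsupp : ∀ ν, m + n - 1 < ν → A ν = ∅)
    (hg : Generic c s t (del A μ i) B) (hi : i ∈ A μ) (hk : k ∈ B μ) :
    Valid c m n s t (del A μ i) (del B μ k) where
  gen := hg.mono (fun _ => subset_rfl) fun ν => del_subset _ _ _ ν
  card := card_del_eq hcard hi hk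
  supp ν hν := Finset.subset_empty.mp ((del_subset A μ i ν).trans_eq (hsupp ν hν))

/-- The coefficient of the residue of one term of the recursion for a parameter `s^1_x` that does
not collide.  On the left is the product of the factors of the first colour with the residue of the
path; on the right are the prefactor of the claimed residue and the first factors of the recursion
after `s^μ_i`, `t^μ_k` have been removed. -/
theorem residue_coefficient (hμ : 1 ≤ μ) (hi : i ∈ A μ) (hk : k ∈ B μ) {x b : ℕ} (hx : x ∈ A 1)
    (hb : b ∈ B 1) (hxi : ¬ (1 = μ ∧ x = i)) (hbk : ¬ (1 = μ ∧ b = k))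
    (hg : Generic c s t (del A μ i) B) :
    oddFactor c m (setParam s μ i (t μ k)) A x * (startWt c m t B b (s 1 x) *
      (resRest c m s t (del A 1 x) (del B 1 b) μ i k (t μ k) *
        if 1 + 1 = μ then (f c m μ (t μ k) (s 1 x))⁻¹ else 1)) =
    resRest c m s t A B μ i k (t μ k) *
      (oddFactor c m s (del A μ i) x * startWt c m t (del B μ k) b (s 1 x)) := by
  have hxw : Sep c (t μ k) (s 1 x) := (hg.2.2 _ _ (mem_del.mpr ⟨hx, hxi⟩) _ _ hk).symm
  by_cases h1 : 1 = μ
  · subst h1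
    have hxi' : x ≠ i := by tauto
    have hbk' : b ≠ k := by tauto
    have hkb : k ∈ del B 1 b 1 := mem_del.mpr ⟨hk, by tauto⟩
    have e : oddFactor c m (setParam s 1 i (t 1 k)) (del A 1 i) x =
        oddFactor c m s (del A 1 i) x :=
      Finset.prod_congr rfl fun a ha => by
        rw [setParam_of_mem_del (Finset.mem_of_mem_erase ha), setParam_of_ne _ _ hxi]
    rw [oddFactor_del hi hxi', e, setParam_self, setParam_of_ne _ _ hxi,
      resRest_del_self (A := A) (B := B) (Finset.mem_erase.mpr ⟨hxi', hx⟩)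
        (Finset.mem_erase.mpr ⟨hbk', hb⟩) le_rfl, startWt_eq, startWt_eq, gamL_del hk hbk',
      fprod_del hkb, del_comm B 1 b 1 k, if_neg (by norm_num), ← odd1_mul_f (hxw.f_ne m 1)]
    ring
  · have e : oddFactor c m (setParam s μ i (t μ k)) A x = oddFactor c m s (del A μ i) x := by
      simp only [oddFactor, del_of_ne A i h1]
      exact Finset.prod_congr rfl fun a ha => by
        rw [setParam_of_ne _ _ (by tauto), setParam_of_ne _ _ hxi]
    have e' : startWt c m t (del B μ k) b (s 1 x) = startWt c m t B b (s 1 x) := by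
      simp only [startWt, gamL, del_of_ne B k h1]
    rw [e, e']
    by_cases h2 : 1 + 1 = μ
    · subst h2
      have hf := hxw.f_ne m (1 + 1)
      have e3 := resRest_del_pred (c := c) (m := m) (s := s) (t := t) (A := A) (B := B)
        (i := i) (k := k) (a := x) (b := b) (μ := 1 + 1) hμ hx hf
      rw [Nat.add_sub_cancel] at e3
      rw [if_pos rfl, e3]
      field_simp
    · rw [if_neg h2, resRest_del_of_ne h1 (by omega) (by omega)]
      ring

/-- The inductive step, by means of the recursion for a parameter `s^1_x` that does not collide. -/
theorem hasRes_of_ne (hc : c ≠ 0) (hmn : 2 ≤ m + n)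
    (ih : ∀ A' B', (A' 1).card < (A 1).card → ResidueFormula c m n A' B')
    (hcard : ∀ ν, (A ν).card = (B ν).card) (hsupp : ∀ ν, m + n - 1 < ν → A ν = ∅) (hA0 : A 0 = ∅)
    (hμ : 1 ≤ μ) (hi : i ∈ A μ) (hk : k ∈ B μ) (hg : Generic c s t (del A μ i) B) {x : ℕ}
    (hx : x ∈ A 1) (hxi : ¬ (1 = μ ∧ x = i)) :
    HasRes (t μ k) (fun z => Z c m n (setParam s μ i z) t A B)
      (-cg c m (μ + 1) * resRest c m s t A B μ i k (t μ k) *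
        Z c m n s t (del A μ i) (del B μ k)) := by
  have hS := analyticAt_setParam s μ i (t μ k)
  have hsx : ∀ z, setParam s μ i z 1 x = s 1 x := fun z => setParam_of_ne s z hxi
  have hsep : SepFam c (setParam s μ i (t μ k)) A :=
    (generic_setParam_pole hg hk (fun _ => subset_rfl) (fun ν => del_subset B μ k ν)
      (fun h => by simpa using h.2)).1
  refine HasRes.congr (F := fun z => recRHS c m n (setParam s μ i z) t A B x) ?_ (by
    filter_upwards [eventually_valid_setParam hcard hsupp hg (t μ k)] with z hz
    exact Z_eq_recRHS hc hmn hz hx)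
  rw [Z_eq_recRHS hc hmn (valid_del hcard hsupp hg hi hk) (mem_del.mpr ⟨hx, hxi⟩)]
  simp only [recRHS, hsx]
  set C := -cg c m (μ + 1) with hC
  have hsepA : ∀ a ∈ del A 1 x (1 + 1), Sep c (setParam s μ i (t μ k) (1 + 1) a) (s 1 x) := by
    intro a ha
    have := hsep _ _ (del_subset _ _ _ _ ha) _ _ hx (by simp)
    rwa [hsx] at this
  have hAn : ∀ b A' B', Below 1 (del A 1 x) (del B 1 b) A' B' → ¬ (i ∈ A' μ ∧ k ∈ B' μ) →
      AnalyticAt ℂ (fun z => Z c m n (setParam s μ i z) t A' B') (t μ k) := fun b A' B' hAB hik =>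
    analyticAt_Z m n A' B' _ t hS (generic_setParam_pole hg hk
      (fun ν => (hAB.subA ν).trans (del_subset _ _ _ _))
      (fun ν => (hAB.subB ν).trans (del_subset _ _ _ _)) hik)
  have hterm : ∀ b ∈ B 1, HasRes (t μ k) (fun z => startWt c m t B b (s 1 x) *
      pathSum c m (setParam s μ i z) t (m + n - 2) 1 (s 1 x) (t 1 b) (lowerWt c m t 1 B)
        (Z c m n (setParam s μ i z) t) (del A 1 x) (del B 1 b))
      (if b ∈ del B μ k 1 then startWt c m t B b (s 1 x) *
        (C * resRest c m s t (del A 1 x) (del B 1 b) μ i k (t μ k) *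
        (if 1 + 1 = μ then (f c m μ (t μ k) (s 1 x))⁻¹ else 1) *
        pathSum c m s t (m + n - 2) 1 (s 1 x) (t 1 b) (lowerWt c m t 1 (del B μ k))
          (Z c m n s t) (del (del A 1 x) μ i) (del (del B 1 b) μ k)) else 0) := by
    intro b hb
    by_cases hbk : b ∈ del B μ k 1
    · have hbk' := (mem_del.mp hbk).2
      rw [if_pos hbk]
      have key := hasRes_pathSum (s := s) (t := t) (m := m) (d := m + n - 2) (ν := 1) (u := s 1 x)
        (v := t 1 b) (h := lowerWt c m t 1 B) (h' := lowerWt c m t 1 (del B μ k))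
        (Φ := fun z => Z c m n (setParam s μ i z) t) (Ψ := Z c m n s t) hμ C
        (mem_del.mpr ⟨hi, fun h => hxi ⟨h.1.symm, h.2.symm⟩⟩)
        (mem_del.mpr ⟨hk, fun h => hbk' ⟨h.1.symm, h.2.symm⟩⟩) (hsep.del _ _)
        (SepFam.del hg.2.1 _ _) hsepA
      refine HasRes.const_mul _ (key ?_ ?_ (hAn b))
      · intro b' hb'
        split_ifs with hν
        · subst hν
          exact lowerWt_del hk _
        · rw [mul_one]
          simp only [lowerWt, del_of_ne B k hν]
      · intro A' B' hAB hi' hk'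
        refine ih A' B' (card_below_lt hx hAB) s t μ i k
          (hAB.card_eq (card_del_eq hcard hx hb)) (fun ν hν => ?_) ?_ hμ hi' hk'
          (hg.mono (fun ν a ha => ?_) fun ν => (hAB.subB ν).trans (del_subset _ _ _ _))
        · exact Finset.subset_empty.mp
            (((hAB.subA ν).trans (del_subset _ _ _ _)).trans_eq (hsupp ν hν))
        · rw [hAB.eqA 0 (by norm_num), del_of_ne _ _ (by norm_num), hA0]
        · rw [mem_del] at ha ⊢
          exact ⟨del_subset _ _ _ _ (hAB.subA ν ha.1), ha.2⟩
    · have hbk' : 1 = μ ∧ b = k := by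
        by_contra h
        exact hbk (mem_del.mpr ⟨hb, h⟩)
      obtain ⟨rfl, rfl⟩ := hbk'
      rw [if_neg hbk]
      -- the first step removes `t^1_k`, so that no pole is left
      refine HasRes.of_analyticAt (analyticAt_const.mul
        (analyticAt_pathSum
        (Φ := fun z => Z c m n (setParam s 1 i z) t) hS (hsep.del _ _) analyticAt_const hsepA
        fun A' B' hAB => hAn b A' B' hAB fun h => ?_))
      simpa using hAB.subB _ h.2
  have h := HasRes.mul (analyticAt_oddFactor (m := m) hS hsep hx) (HasRes.sum hterm)
  convert h using 1
  rw [← Finset.sum_subset (del_subset B μ k 1) (fun b _ hb => if_neg hb), Finset.mul_sum,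
    Finset.mul_sum, Finset.mul_sum]
  refine Finset.sum_congr rfl fun b hb => ?_
  have hb' := mem_del.mp hb
  rw [if_pos hb, del_comm A 1 x, del_comm B 1 b]
  have e := residue_coefficient (m := m) hμ hi hk hx hb'.1 hxi hb'.2 hg
  linear_combination -C * pathSum c m s t (m + n - 2) 1 (s 1 x) (t 1 b)
    (lowerWt c m t 1 (del B μ k)) (Z c m n s t) (del (del A μ i) 1 x) (del (del B μ k) 1 b) * e

/-- The inductive step, if the parameters that collide are the only ones of the first colour. -/
theorem hasRes_of_singleton (hc : c ≠ 0) (hmn : 2 ≤ m + n)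
    (hcard : ∀ ν, (A ν).card = (B ν).card) (hsupp : ∀ ν, m + n - 1 < ν → A ν = ∅) (hA0 : A 0 = ∅)
    (hA : A 1 = {i}) (hB : B 1 = {k}) (hg : Generic c s t (del A 1 i) B) :
    HasRes (t 1 k) (fun z => Z c m n (setParam s 1 i z) t A B)
      (-cg c m (1 + 1) * resRest c m s t A B 1 i k (t 1 k) *
        Z c m n s t (del A 1 i) (del B 1 k)) := by
  have hi : i ∈ A 1 := by simp [hA]
  have hk : k ∈ B 1 := by simp [hB]
  have hV : Valid c m n s t (del A 1 i) (del B 1 k) := valid_del hcard hsupp hg hi hk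
  -- the recursion without its pole factor `g_2(t^1_k, z)`
  set Q : ℂ → ℂ := fun z => pathSum c m s t (m + n - 2) 1 z (t 1 k)
    (fun w => (f c m 2 w (t 1 k))⁻¹) (Z c m n s t) (del A 1 i) (del B 1 k) with hQ
  have hsep2 : ∀ a ∈ del A 1 i 2, Sep c (s 2 a) (t 1 k) := fun a ha => hg.2.2 _ _ ha _ _ hk
  have hQa : AnalyticAt ℂ Q (t 1 k) :=
    analyticAt_pathSum (S := fun _ => s) (Φ := fun _ => Z c m n s t) (fun _ _ => analyticAt_const)
      hV.gen.1 analyticAt_id hsep2 fun _ _ _ => analyticAt_const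
  have hQw : Q (t 1 k) = (fprod c m t 2 B (t 1 k))⁻¹ * Z c m n s t (del A 1 i) (del B 1 k) := by
    have e := pathSum_virtual hc hmn hV (by simp [hA]) hsep2 (fun b hb => by
      exact hg.2.1 _ _ (del_subset _ _ _ _ hb) _ _ hk (by simp))
    rw [hQ]
    dsimp only
    rw [e]
    simp only [fprod, del_of_ne B k (show 2 ≠ 1 by norm_num)]
  have h := HasRes.mul hQa (hasRes_g c (t 1 k) m 2)
  refine HasRes.congr (F := fun z => Q z * g c m 2 (t 1 k) z) ?_ ?_
  · convert h using 1
    rw [hQw, resRest]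
    simp [hA, hB, hA0]
    ring
  · filter_upwards [eventually_valid_setParam hcard hsupp hg (t 1 k)] with z hz
    rw [Z_eq_recRHS hc hmn hz hi, recRHS, oddFactor, hA, hB, setParam_self]
    rw [Finset.sum_singleton, startWt, gamL, hB]
    have e : pathSum c m (setParam s 1 i z) t (m + n - 2) 1 z (t 1 k) (lowerWt c m t 1 B)
        (Z c m n (setParam s 1 i z) t) (del A 1 i) (del B 1 k) = Q z := by
      refine pathSum_congr (fun σ _ a ha => setParam_of_mem_del ha z) (fun _ _ _ _ => rfl)
        (fun b _ => ?_) fun A' B' hAB => ?_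
      · simp [lowerWt, hB]
      · exact Z_congr _ _ _ _ _ _ _ _ (fun ν a ha => setParam_of_mem_del (hAB.subA ν ha) z)
          fun _ _ _ => rfl
    rw [e]
    simp [mul_comm]

/-- The inductive step for the residue formula: choose a parameter of colour `1` that does not
collide, if there is one. -/
theorem residueFormula_step (hc : c ≠ 0) (hmn : 2 ≤ m + n) (hA : (A 1).Nonempty)
    (ih : ∀ A' B', (A' 1).card < (A 1).card → ResidueFormula c m n A' B') :
    ResidueFormula c m n A B := by
  intro s t μ i k hcard hsupp hA0 hμ hi hk hg
  by_cases h : ∃ x ∈ A 1, ¬ (1 = μ ∧ x = i)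
  · obtain ⟨x, hx, hxi⟩ := h
    exact hasRes_of_ne hc hmn ih hcard hsupp hA0 hμ hi hk hg hx hxi
  push Not at h
  obtain ⟨x, hx⟩ := hA
  obtain ⟨rfl, rfl⟩ := h x hx
  have hA1 : A 1 = {x} := Finset.eq_singleton_iff_unique_mem.mpr ⟨hx, fun y hy => (h y hy).2⟩
  have hB1 : B 1 = {k} := by
    obtain ⟨y, hy⟩ := Finset.card_eq_one.mp (show (B 1).card = 1 by rw [← hcard 1, hA1]; simp)
    rw [hy] at hk ⊢
    rw [Finset.mem_singleton.mp hk]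
  exact hasRes_of_singleton hc hmn hcard hsupp hA0 hA1 hB1 hg

theorem residueFormula (hc : c ≠ 0) (m n : ℕ) (A B : ℕ → Finset ℕ) : ResidueFormula c m n A B := by
  induction m, n, A, B using Z_induction with
  | h0 m n A B h =>
    intro s t μ i k _ hsupp _ hμ hi
    rw [hsupp μ (by omega)] at hi
    simp at hi
  | h11 A B =>
    -- the recursion holds for `m = n = 1`, too, so that the same step applies
    induction hr : (A 1).card using Nat.strong_induction_on generalizing A B with
    | _ r ih =>
      rcases (A 1).eq_empty_or_nonempty with hA | hA
      · intro s t μ i k _ hsupp _ hμ hi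
        by_cases h1 : μ = 1
        · rw [h1, hA] at hi
          simp at hi
        · rw [hsupp μ (by omega)] at hi
          simp at hi
      · exact residueFormula_step hc le_rfl hA fun A' B' h => ih _ (hr ▸ h) A' B' rfl
  | hshift m n A B hmn h11 hA ih =>
    intro s t μ i k hcard hsupp _ hμ hi hk hg
    -- the colour `1` is empty, hence the colliding parameters survive the shift
    obtain ⟨μ, rfl⟩ := Nat.exists_eq_add_of_le' hμ
    have hμ1 : 1 ≤ μ := by
      rcases Nat.eq_zero_or_pos μ with rfl | h
      · simp [hA] at hi
      · exact h
    have h := ih (fun ν => s (ν + 1)) (fun ν => t (ν + 1)) μ i k (fun ν => hcard (ν + 1))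
      (fun ν hν => hsupp (ν + 1) (by split_ifs at hν <;> omega)) hA hμ1 hi hk (by
        rw [← del_shift]; exact hg.shift)
    have hA' : del A (μ + 1) i 1 = ∅ := by rw [del_of_ne _ _ (by omega), hA]
    rw [resRest_shift hμ1, cg_shift c m (by omega)] at h
    simp only [Z_eq_shift hmn h11 hA, Z_eq_shift hmn h11 hA', setParam_shift, del_shift]
    exact h
  | hstep m n A B hmn h11 hA ih => exact residueFormula_step hc hmn hA ih

end

/-! ### Rationality -/

/-- The point with the coordinates `s ν a` at `(true, ν, a)` and `t ν b` at `(false, ν, b)`. -/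
def paramPoint (s t : ℕ → ℕ → ℂ) (v : Bool × ℕ × ℕ) : ℂ :=
  if v.1 then s v.2.1 v.2.2 else t v.2.1 v.2.2

/-- For all generic values of the parameters with labels in `A`, `B`, the value `F s t` is that of
one fraction of polynomials. -/
def IsRational (c : ℂ) (A B : ℕ → Finset ℕ) (F : (ℕ → ℕ → ℂ) → (ℕ → ℕ → ℂ) → ℂ) : Prop :=
  ∃ P Q : MvPolynomial (Bool × ℕ × ℕ) ℂ, ∀ s t, Generic c s t A B →
    Q.eval (paramPoint s t) ≠ 0 ∧ F s t = P.eval (paramPoint s t) / Q.eval (paramPoint s t)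

section
variable {c : ℂ} {m n : ℕ} {A B A' B' : ℕ → Finset ℕ} {F F' : (ℕ → ℕ → ℂ) → (ℕ → ℕ → ℂ) → ℂ}

theorem IsRational.const (r : ℂ) : IsRational c A B fun _ _ => r :=
  ⟨MvPolynomial.C r, 1, fun s t _ => by simp⟩

theorem IsRational.left (ν a : ℕ) : IsRational c A B fun s _ => s ν a :=
  ⟨MvPolynomial.X (true, ν, a), 1, fun s t _ => by simp [paramPoint]⟩

theorem IsRational.right (ν b : ℕ) : IsRational c A B fun _ t => t ν b :=
  ⟨MvPolynomial.X (false, ν, b), 1, fun s t _ => by simp [paramPoint]⟩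

theorem IsRational.add (h : IsRational c A B F) (h' : IsRational c A B F') :
    IsRational c A B fun s t => F s t + F' s t := by
  obtain ⟨P, Q, h⟩ := h
  obtain ⟨P', Q', h'⟩ := h'
  refine ⟨P * Q' + Q * P', Q * Q', fun s t hg => ?_⟩
  obtain ⟨h1, h2⟩ := h s t hg
  obtain ⟨h3, h4⟩ := h' s t hg
  simp only [map_mul, map_add]
  exact ⟨mul_ne_zero h1 h3, by rw [h2, h4, div_add_div _ _ h1 h3]⟩

theorem IsRational.mul (h : IsRational c A B F) (h' : IsRational c A B F') :
    IsRational c A B fun s t => F s t * F' s t := by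
  obtain ⟨P, Q, h⟩ := h
  obtain ⟨P', Q', h'⟩ := h'
  refine ⟨P * P', Q * Q', fun s t hg => ?_⟩
  obtain ⟨h1, h2⟩ := h s t hg
  obtain ⟨h3, h4⟩ := h' s t hg
  simp only [map_mul]
  exact ⟨mul_ne_zero h1 h3, by rw [h2, h4, div_mul_div_comm]⟩

theorem IsRational.inv (h : IsRational c A B F) (hF : ∀ s t, Generic c s t A B → F s t ≠ 0) :
    IsRational c A B fun s t => (F s t)⁻¹ := by
  obtain ⟨P, Q, h⟩ := h
  refine ⟨Q, P, fun s t hg => ?_⟩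
  obtain ⟨h1, h2⟩ := h s t hg
  refine ⟨fun h0 => hF s t hg ?_, by simp only [h2, inv_div]⟩
  rw [h2, h0, zero_div]

theorem IsRational.sum {ι : Type*} {S : Finset ι} {F : ι → (ℕ → ℕ → ℂ) → (ℕ → ℕ → ℂ) → ℂ}
    (h : ∀ i ∈ S, IsRational c A B (F i)) : IsRational c A B fun s t => ∑ i ∈ S, F i s t := by
  classical
  induction S using Finset.induction_on with
  | empty => simpa using IsRational.const 0
  | insert i S hi ih =>
    simp only [Finset.sum_insert hi]
    exact (h i (by simp)).add (ih fun j hj => h j (by simp [hj]))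

theorem IsRational.prod {ι : Type*} {S : Finset ι} {F : ι → (ℕ → ℕ → ℂ) → (ℕ → ℕ → ℂ) → ℂ}
    (h : ∀ i ∈ S, IsRational c A B (F i)) : IsRational c A B fun s t => ∏ i ∈ S, F i s t := by
  classical
  induction S using Finset.induction_on with
  | empty => simpa using IsRational.const 1
  | insert i S hi ih =>
    simp only [Finset.prod_insert hi]
    exact (h i (by simp)).mul (ih fun j hj => h j (by simp [hj]))

theorem IsRational.mono (h : IsRational c A' B' F) (hA : ∀ ν, A' ν ⊆ A ν) (hB : ∀ ν, B' ν ⊆ B ν) :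
    IsRational c A B F := by
  obtain ⟨P, Q, h⟩ := h
  exact ⟨P, Q, fun s t hg => h s t (hg.mono hA hB)⟩

/-- Renumbering the colours of the parameters renames the variables of the polynomials. -/
theorem IsRational.shift (h : IsRational c (fun ν => A (ν + 1)) (fun ν => B (ν + 1)) F) :
    IsRational c A B fun s t => F (fun ν => s (ν + 1)) fun ν => t (ν + 1) := by
  obtain ⟨P, Q, h⟩ := h
  refine ⟨MvPolynomial.rename (fun v => (v.1, v.2.1 + 1, v.2.2)) P,
    MvPolynomial.rename (fun v => (v.1, v.2.1 + 1, v.2.2)) Q, fun s t hg => ?_⟩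
  have e : paramPoint s t ∘ (fun v => (v.1, v.2.1 + 1, v.2.2)) =
      paramPoint (fun ν => s (ν + 1)) fun ν => t (ν + 1) := rfl
  rw [MvPolynomial.eval_rename, MvPolynomial.eval_rename, e]
  exact h _ _ hg.shift

variable {u v : (ℕ → ℕ → ℂ) → (ℕ → ℕ → ℂ) → ℂ}

theorem isRational_g (i : ℕ) (hu : IsRational c A B u) (hv : IsRational c A B v)
    (h : ∀ s t, Generic c s t A B → Sep c (u s t) (v s t)) :
    IsRational c A B fun s t => g c m i (u s t) (v s t) := by
  have h' : IsRational c A B fun s t => (u s t + -1 * v s t)⁻¹ :=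
    (hu.add ((IsRational.const (-1)).mul hv)).inv fun s t hg => by
      have := (h s t hg).1
      rwa [neg_one_mul, ← sub_eq_add_neg]
  convert (IsRational.const (cg c m i)).mul h' using 3
  rw [g, div_eq_mul_inv, neg_one_mul, ← sub_eq_add_neg]

theorem isRational_f (i : ℕ) (hu : IsRational c A B u) (hv : IsRational c A B v)
    (h : ∀ s t, Generic c s t A B → Sep c (u s t) (v s t)) :
    IsRational c A B fun s t => f c m i (u s t) (v s t) :=
  (IsRational.const 1).add (isRational_g i hu hv h)

theorem isRational_f_inv (i : ℕ) (hu : IsRational c A B u) (hv : IsRational c A B v)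
    (h : ∀ s t, Generic c s t A B → Sep c (u s t) (v s t)) :
    IsRational c A B fun s t => (f c m i (u s t) (v s t))⁻¹ :=
  (isRational_f i hu hv h).inv fun s t hg => (h s t hg).f_ne _ _

theorem isRational_gam (i : ℕ) (hu : IsRational c A B u) (hv : IsRational c A B v)
    (h : ∀ s t, Generic c s t A B → Sep c (u s t) (v s t)) :
    IsRational c A B fun s t => gam c m i (u s t) (v s t) := by
  unfold gam
  split_ifs
  · exact isRational_g i hu hv h
  · exact isRational_f i hu hv h

theorem isRational_pathSum {d : ℕ} : ∀ {ν : ℕ} {u v : (ℕ → ℕ → ℂ) → (ℕ → ℕ → ℂ) → ℂ}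
    {h : (ℕ → ℕ → ℂ) → (ℕ → ℕ → ℂ) → ℂ → ℂ}
    {Φ : (ℕ → ℕ → ℂ) → (ℕ → ℕ → ℂ) → (ℕ → Finset ℕ) → (ℕ → Finset ℕ) → ℂ}
    {A' B' : ℕ → Finset ℕ}, (∀ ν, A' ν ⊆ A ν) → (∀ ν, B' ν ⊆ B ν) →
    IsRational c A B u → IsRational c A B v →
    (∀ s t, Generic c s t A B → ∀ a ∈ A' (ν + 1), Sep c (s (ν + 1) a) (u s t)) →
    (∀ s t, Generic c s t A B → ∀ b ∈ B' (ν + 1), Sep c (t (ν + 1) b) (v s t)) →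
    (∀ b ∈ B' (ν + 1), IsRational c A B fun s t => h s t (t (ν + 1) b)) →
    (∀ A'' B'', Below ν A' B' A'' B'' → IsRational c A B fun s t => Φ s t A'' B'') →
    IsRational c A B fun s t => pathSum c m s t d ν (u s t) (v s t) (h s t) (Φ s t) A' B' := by
  have hpre : ∀ {ν : ℕ} {u : (ℕ → ℕ → ℂ) → (ℕ → ℕ → ℂ) → ℂ} {A' : ℕ → Finset ℕ},
      IsRational c A B u →
      (∀ s t, Generic c s t A B → ∀ a ∈ A' (ν + 1), Sep c (s (ν + 1) a) (u s t)) →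
      IsRational c A B fun s t => (fprod c m s (ν + 1) A' (u s t))⁻¹ := by
    intro ν u A' hu hsu
    exact (IsRational.prod fun a ha => isRational_f (ν + 1) (IsRational.left _ a) hu
      fun s t hg => hsu s t hg a ha).inv fun s t hg => fprod_ne_zero (hsu s t hg)
  induction d with
  | zero =>
    intro ν u v h Φ A' B' hA hB hu hv hsu htv hh hΦ
    simp only [pathSum]
    exact (hpre hu hsu).mul (hΦ A' B' (Below.refl _ _ _))
  | succ d ih =>
    intro ν u v h Φ A' B' hA hB hu hv hsu htv hh hΦ
    simp only [pathSum]
    refine (hpre hu hsu).mul ((hΦ A' B' (Below.refl _ _ _)).add (IsRational.sum fun a ha =>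
      IsRational.sum fun b hb => ?_))
    have hgL : IsRational c A B fun _ t => gamL c m t (ν + 1) B' b :=
      IsRational.prod fun b' hb' => isRational_gam (ν + 1) (IsRational.right _ b)
        (IsRational.right _ b') fun s t hg => SepFam.of_ne hg.2.1 (hB _ hb)
        (hB _ (Finset.mem_of_mem_erase hb')) (Finset.ne_of_mem_erase hb').symm
    have hgR : IsRational c A B fun s _ => gamR c m s (ν + 1) A' a :=
      IsRational.prod fun a' ha' => isRational_gam (ν + 1) (IsRational.left _ a')
        (IsRational.left _ a) fun s t hg => SepFam.of_ne hg.1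
        (hA _ (Finset.mem_of_mem_erase ha')) (hA _ ha) (Finset.ne_of_mem_erase ha')
    refine IsRational.mul (IsRational.mul (IsRational.mul (IsRational.mul (IsRational.mul
      (isRational_g _ (IsRational.right _ b) hv fun s t hg => htv s t hg b hb)
      (isRational_g _ (IsRational.left _ a) hu fun s t hg => hsu s t hg a ha)) hgL) hgR)
      (hh b hb)) ?_
    refine ih (u := fun s _ => s (ν + 1) a) (v := fun _ t => t (ν + 1) b)
      (h := fun _ t => lowerWt c m t (ν + 1) B') (Φ := Φ)
      (fun σ => (del_subset _ _ _ _).trans (hA σ)) (fun σ => (del_subset _ _ _ _).trans (hB σ))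
      (IsRational.left _ a) (IsRational.right _ b) (fun s t hg a' ha' => ?_)
      (fun s t hg b' hb' => ?_) (fun b' hb' => ?_) fun A'' B'' hAB => hΦ A'' B'' (hAB.step ha hb)
    · exact hg.1 _ _ (hA _ (del_subset _ _ _ _ ha')) _ _ (hA _ ha) (by simp)
    · exact hg.2.1 _ _ (hB _ (del_subset _ _ _ _ hb')) _ _ (hB _ hb) (by simp)
    · exact IsRational.prod fun b'' hb'' => isRational_f_inv _ (IsRational.right _ b')
        (IsRational.right _ b'') fun s t hg =>
        hg.2.1 _ _ (hB _ (del_subset _ _ _ _ hb')) _ _ (hB _ hb'') (by simp)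

theorem isRational_Z (m n : ℕ) (A B : ℕ → Finset ℕ) :
    IsRational c A B fun s t => Z c m n s t A B := by
  induction m, n, A, B using Z_induction with
  | h0 m n A B h =>
    simp only [Z_eq_one h]
    exact IsRational.const 1
  | h11 A B =>
    simp only [Z_one_one]
    exact IsRational.prod fun a ha => IsRational.prod fun b hb => isRational_g _
      (IsRational.left _ a) (IsRational.right _ b) fun s t hg => hg.2.2 _ _ ha _ _ hb
  | hshift m n A B hmn h11 hA ih =>
    simp only [Z_eq_shift hmn h11 hA]
    exact ih.shift
  | hstep m n A B hmn h11 hA ih =>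
    simp only [Z_eq_recRHS_min hmn h11 hA]
    have hx := Finset.min'_mem _ hA
    set x := (A 1).min' hA
    refine IsRational.mul (IsRational.prod fun a ha => ?_) (IsRational.sum fun b hb =>
      IsRational.mul (IsRational.mul (IsRational.mul ?_ (IsRational.prod fun b' hb' => ?_))
        (IsRational.prod fun b' hb' => ?_)) ?_)
    · have hax : ∀ s t, Generic c s t A B → Sep c (s 1 a) (s 1 x) := fun s t hg =>
        SepFam.of_ne hg.1 (Finset.mem_of_mem_erase ha) hx (Finset.ne_of_mem_erase ha)
      split_ifs
      · simp only [div_eq_mul_inv]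
        exact (isRational_g _ (IsRational.left _ a) (IsRational.left _ x) hax).mul
          (isRational_f_inv _ (IsRational.left _ a) (IsRational.left _ x) hax)
      · exact IsRational.const 1
    · exact isRational_g _ (IsRational.right _ b) (IsRational.left _ x) fun s t hg =>
        (hg.2.2 _ _ hx _ _ hb).symm
    · exact isRational_gam _ (IsRational.right _ b) (IsRational.right _ b') fun s t hg =>
        SepFam.of_ne hg.2.1 hb (Finset.mem_of_mem_erase hb') (Finset.ne_of_mem_erase hb').symm
    · exact isRational_f _ (IsRational.right _ b') (IsRational.left _ x) fun s t hg =>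
        (hg.2.2 _ _ hx _ _ (Finset.mem_of_mem_erase hb')).symm
    · refine isRational_pathSum (u := fun s _ => s 1 x) (v := fun _ t => t 1 b)
        (h := fun _ t => lowerWt c m t 1 B) (Φ := fun s t => Z c m n s t)
        (fun ν => del_subset _ _ _ ν) (fun ν => del_subset _ _ _ ν) (IsRational.left _ x)
        (IsRational.right _ b) (fun s t hg a' ha' => ?_) (fun s t hg b' hb' => ?_)
        (fun b' hb' => ?_) fun A'' B'' hAB => ?_
      · exact hg.1 _ _ (del_subset _ _ _ _ ha') _ _ hx (by simp)
      · exact hg.2.1 _ _ (del_subset _ _ _ _ hb') _ _ hb (by simp)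
      · exact IsRational.prod fun b'' hb'' => isRational_f_inv _ (IsRational.right _ b')
          (IsRational.right _ b'') fun s t hg =>
          hg.2.1 _ _ (del_subset _ _ _ _ hb') _ _ hb'' (by simp)
      · exact (ih A'' B'' (card_below_lt hx hAB)).mono
          (fun ν => (hAB.subA ν).trans (del_subset _ _ _ _))
          fun ν => (hAB.subB ν).trans (del_subset _ _ _ _)

/-- Parameters outside the zero set of some nonzero polynomial are generic. -/
theorem exists_polynomial_generic (c : ℂ) (N : ℕ) (hA : ∀ ν, N < ν → A ν = ∅)
    (hB : ∀ ν, N < ν → B ν = ∅) : ∃ P : MvPolynomial (Bool × ℕ × ℕ) ℂ, P ≠ 0 ∧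
      ∀ s t, P.eval (paramPoint s t) ≠ 0 → Generic c s t A B := by
  classical
  set S : Finset (Bool × ℕ × ℕ) := (Finset.range (N + 1)).biUnion fun ν =>
    (A ν).image (fun a => (true, ν, a)) ∪ (B ν).image (fun b => (false, ν, b)) with hS
  have hSA : ∀ {ν a}, a ∈ A ν → (true, ν, a) ∈ S := by
    intro ν a ha
    have hν : ν < N + 1 := by
      by_contra h
      simp [hA ν (by omega)] at ha
    simp [hS, Nat.lt_succ_iff.mp hν, ha]
  have hSB : ∀ {ν b}, b ∈ B ν → (false, ν, b) ∈ S := by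
    intro ν b hb
    have hν : ν < N + 1 := by
      by_contra h
      simp [hB ν (by omega)] at hb
    simp [hS, Nat.lt_succ_iff.mp hν, hb]
  set L : (Bool × ℕ × ℕ) → (Bool × ℕ × ℕ) → ℂ → MvPolynomial (Bool × ℕ × ℕ) ℂ := fun x y d =>
    MvPolynomial.X x - MvPolynomial.X y - MvPolynomial.C d with hL
  have hL0 : ∀ x y d, x ≠ y → L x y d ≠ 0 := by
    intro x y d hxy h0
    have h1 := congrArg (MvPolynomial.eval (Function.update 0 x (1 + d))) h0
    simp [hL, hxy.symm] at h1
  refine ⟨∏ x ∈ S, ∏ y ∈ S.erase x, L x y 0 * L x y c * L x y (-c), ?_, fun s t h => ?_⟩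
  · refine Finset.prod_ne_zero_iff.mpr fun x _ => Finset.prod_ne_zero_iff.mpr fun y hy => ?_
    have hxy := (Finset.ne_of_mem_erase hy).symm
    exact mul_ne_zero (mul_ne_zero (hL0 _ _ _ hxy) (hL0 _ _ _ hxy)) (hL0 _ _ _ hxy)
  · have key : ∀ x ∈ S, ∀ y ∈ S, x ≠ y → Sep c (paramPoint s t x) (paramPoint s t y) := by
      intro x hx y hy hxy
      rw [map_prod, Finset.prod_ne_zero_iff] at h
      have h1 := h x hx
      rw [map_prod, Finset.prod_ne_zero_iff] at h1
      have h2 := h1 y (Finset.mem_erase.mpr ⟨hxy.symm, hy⟩)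
      simp only [hL, map_mul, map_sub, MvPolynomial.eval_X, MvPolynomial.eval_C, mul_ne_zero_iff,
        sub_zero] at h2
      exact ⟨h2.1.1, fun e => h2.1.2 (by rw [e, sub_self]), fun e => h2.2 (by rw [e, sub_self])⟩
    refine ⟨fun ν a ha ν' a' ha' hne => ?_, fun ν b hb ν' b' hb' hne => ?_,
      fun ν a ha ν' b hb => ?_⟩
    · exact key _ (hSA ha) _ (hSA ha') (by simpa using hne)
    · exact key _ (hSB hb) _ (hSB hb') (by simpa using hne)
    · exact key _ (hSA ha) _ (hSB hb) (by simp)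

end

/-! ### Nonvanishing and the order of the pole -/

section
variable {c : ℂ} {m n : ℕ} {s t : ℕ → ℕ → ℂ} {A B : ℕ → Finset ℕ} {μ i k : ℕ}

theorem Generic.symm (h : Generic c s t A B) : Generic c t s B A :=
  ⟨h.2.1, h.1, fun ν b hb ν' a ha => (h.2.2 ν' a ha ν b hb).symm⟩

theorem resRest_ne_zero (hc : c ≠ 0) (hμ : 1 ≤ μ) (hk : k ∈ B μ)
    (hg : Generic c s t (del A μ i) B) : resRest c m s t A B μ i k (t μ k) ≠ 0 := by
  have h1 : ∀ ν, ∀ a ∈ del A μ i ν, Sep c (t μ k) (s ν a) := fun ν a ha =>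
    (hg.2.2 _ _ ha _ _ hk).symm
  refine div_ne_zero (mul_ne_zero ?_ ?_) (mul_ne_zero ?_ ?_)
  · exact Finset.prod_ne_zero_iff.mpr fun b hb => (SepFam.of_ne hg.2.1 (Finset.mem_of_mem_erase hb)
      hk (Finset.ne_of_mem_erase hb)).gam_ne hc _ _
  · exact Finset.prod_ne_zero_iff.mpr fun a ha => (h1 _ a (by simpa using ha)).gam_ne hc _ _
  · exact fprod_ne_zero fun b hb => hg.2.1 _ _ hb _ _ hk (by simp)
  · exact Finset.prod_ne_zero_iff.mpr fun a ha =>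
      (h1 _ a (by rwa [del_of_ne _ _ (by omega)])).f_ne _ _

theorem analyticAt_resRest (hμ : 1 ≤ μ) (hk : k ∈ B μ) (hg : Generic c s t (del A μ i) B) :
    AnalyticAt ℂ (fun z => resRest c m s t A B μ i k z) (t μ k) := by
  have h1 : ∀ ν, ∀ a ∈ del A μ i ν, Sep c (t μ k) (s ν a) := fun ν a ha =>
    (hg.2.2 _ _ ha _ _ hk).symm
  have h2 : ∀ a ∈ A (μ - 1), Sep c (t μ k) (s (μ - 1) a) := fun a ha =>
    h1 _ a (by rwa [del_of_ne _ _ (by omega)])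
  refine AnalyticAt.div (analyticAt_const.mul (Finset.analyticAt_fun_prod _ fun a ha =>
      analyticAt_gam analyticAt_id analyticAt_const (h1 _ a (by simpa using ha))))
    (analyticAt_const.mul (Finset.analyticAt_fun_prod _ fun a ha =>
      analyticAt_f analyticAt_id analyticAt_const (h2 a ha))) (mul_ne_zero ?_ ?_)
  · exact fprod_ne_zero fun b hb => hg.2.1 _ _ hb _ _ hk (by simp)
  · exact Finset.prod_ne_zero_iff.mpr fun a ha => (h2 a ha).f_ne _ _

theorem Z_of_empty (m n : ℕ) (A B : ℕ → Finset ℕ) :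
    ∀ s t : ℕ → ℕ → ℂ, (∀ ν, A ν = ∅) → Z c m n s t A B = 1 := by
  induction m, n, A, B using Z_induction with
  | h0 m n A B h => intros; exact Z_eq_one h
  | h11 A B =>
    intro s t hA
    rw [Z_one_one, hA 1, Finset.prod_empty]
  | hshift m n A B hmn h11 hA1 ih =>
    intro s t hA
    rw [Z_eq_shift hmn h11 hA1]
    exact ih _ _ fun ν => hA _
  | hstep m n A B hmn h11 hA1 ih =>
    intro s t hA
    simp [hA 1] at hA1

/-- The highest coefficient does not vanish identically: it has a pole with a residue that is, by
induction on the number of parameters, not identically zero. -/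
theorem exists_generic_Z_ne_zero (hc : c ≠ 0) (hcard : ∀ ν, (A ν).card = (B ν).card)
    (hsupp : ∀ ν, m + n - 1 < ν → A ν = ∅) (hA0 : A 0 = ∅) :
    ∃ s t, Generic c s t A B ∧ Z c m n s t A B ≠ 0 := by
  induction hr : ∑ ν ∈ Finset.range (m + n), (A ν).card using Nat.strong_induction_on
    generalizing A B with
  | _ r ih =>
  have hBe : ∀ {ν}, A ν = ∅ → B ν = ∅ := fun {ν} h => by
    rw [← Finset.card_eq_zero, ← hcard ν, h, Finset.card_empty]
  by_cases hA : ∀ ν, A ν = ∅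
  · refine ⟨0, 0, ⟨fun ν a ha => ?_, fun ν b hb => ?_, fun ν a ha => ?_⟩, ?_⟩
    · simp [hA ν] at ha
    · simp [hBe (hA ν)] at hb
    · simp [hA ν] at ha
    · rw [Z_of_empty _ _ _ _ _ _ hA]
      exact one_ne_zero
  push Not at hA
  obtain ⟨μ, i, hi⟩ := hA
  obtain ⟨k, hk⟩ : (B μ).Nonempty := by
    rw [← Finset.card_pos, ← hcard μ]
    exact Finset.card_pos.mpr ⟨i, hi⟩
  have hμ : 1 ≤ μ := by
    rcases Nat.eq_zero_or_pos μ with rfl | h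
    · simp [hA0] at hi
    · exact h
  have hμN : μ ≤ m + n - 1 := by
    by_contra h
    simp [hsupp μ (by omega)] at hi
  have hsub : ∀ ν, del A μ i ν ⊆ A ν := del_subset A μ i
  obtain ⟨s, t, hg, hZ⟩ := ih (∑ ν ∈ Finset.range (m + n), (del A μ i ν).card) (by
      rw [← hr]
      refine Finset.sum_lt_sum (fun ν _ => Finset.card_le_card (hsub ν)) ⟨μ, by simp; omega, ?_⟩
      have := card_del_add_one hi
      omega) (card_del_eq hcard hi hk)
    (fun ν hν => Finset.subset_empty.mp ((hsub ν).trans_eq (hsupp ν hν)))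
    (Finset.subset_empty.mp ((hsub 0).trans_eq hA0)) rfl
  -- give first `t^μ_k` and then `s^μ_i` a suitable value
  obtain ⟨y, hy⟩ := (eventually_generic_setParam hg.symm (m + n - 1)
    (fun ν hν => hBe (hsupp ν hν)) (fun ν hν => Finset.subset_empty.mp
      ((hsub ν).trans_eq (hsupp ν hν))) 0).exists
  set t' := setParam t μ k y with ht'
  have hg' : Generic c s t' (del A μ i) B := hy.symm
  have hZ' : Z c m n s t' (del A μ i) (del B μ k) ≠ 0 := by
    rwa [Z_congr m n _ _ s t' s t (fun _ _ _ => rfl) fun ν b hb => setParam_of_mem_del hb y]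
  have hres := residueFormula hc m n A B s t' μ i k hcard hsupp hA0 hμ hi hk hg'
  obtain ⟨G, hG, hGw, hF⟩ := hres
  have hG0 : G (t' μ k) ≠ 0 := by
    rw [hGw]
    exact mul_ne_zero (mul_ne_zero (neg_ne_zero.mpr (cg_ne_zero hc _ _))
      (resRest_ne_zero hc hμ hk hg')) hZ'
  have hGe : ∀ᶠ z in 𝓝[≠] (t' μ k), G z ≠ 0 :=
    (hG.continuousAt.eventually_ne hG0).filter_mono nhdsWithin_le_nhds
  obtain ⟨z, h1, h2, h3, h4⟩ := (hF.and (hGe.and (eventually_mem_nhdsWithin.and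
    (eventually_valid_setParam (n := n) (m := m) hcard hsupp hg' (t' μ k))))).exists
  exact ⟨setParam s μ i z, t', h4.gen, h1.trans_ne (div_ne_zero h2 (sub_ne_zero.mpr h3))⟩

end
end BetheHC

theorem mainTheorem2 (c : ℂ) (hc : c ≠ 0) (m n : ℕ) (A B : ℕ → Finset ℕ)
    (hcard : ∀ ν, (A ν).card = (B ν).card)
    (hsupp : ∀ ν, ν ∉ Finset.Icc 1 (m + n - 1) → A ν = ∅)
    (μ i k : ℕ) (hi : i ∈ A μ) (hk : k ∈ B μ) :
    (∀ s t : ℕ → ℕ → ℂ, BetheHC.Generic c s t (BetheHC.del A μ i) B →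
      ∃ reg : ℂ → ℂ, AnalyticAt ℂ reg (t μ k) ∧
        ∀ᶠ z in 𝓝[≠] (t μ k),
          BetheHC.Z c m n (BetheHC.setParam s μ i z) t A B =
            BetheHC.resFactor c m s t A B μ i k z *
              BetheHC.Z c m n s t (BetheHC.del A μ i) (BetheHC.del B μ k) + reg z) ∧
    (∃ P : MvPolynomial (Bool × ℕ × ℕ) ℂ, P ≠ 0 ∧
      ∀ s t : ℕ → ℕ → ℂ,
        MvPolynomial.eval (fun v => if v.1 then s v.2.1 v.2.2 else t v.2.1 v.2.2) P ≠ 0 →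
        meromorphicOrderAt (fun z => BetheHC.Z c m n (BetheHC.setParam s μ i z) t A B) (t μ k) =
          ((-1 : ℤ) : WithTop ℤ)) := by
  -- colours outside `1, …, N` carry no parameters; in particular `μ ≥ 1`, and `s̄^{μ-1}` is empty
  -- for `μ = 1`, where the natural number `μ - 1` is `0`
  have hsupp' : ∀ ν, m + n - 1 < ν → A ν = ∅ := fun ν hν => hsupp ν (by simp; omega)
  have hA0 : A 0 = ∅ := hsupp 0 (by simp)
  have hμ : 1 ≤ μ := by
    rcases Nat.eq_zero_or_pos μ with rfl | h
    · simp [hA0] at hi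
    · exact h
  have hres : ∀ s t : ℕ → ℕ → ℂ, BetheHC.Generic c s t (BetheHC.del A μ i) B → _ :=
    fun s t hg => BetheHC.residueFormula hc m n A B s t μ i k hcard hsupp' hA0 hμ hi hk hg
  have hsub : ∀ ν, BetheHC.del A μ i ν ⊆ A ν := BetheHC.del_subset A μ i
  have hempty : ∀ ν, m + n - 1 < ν → BetheHC.del A μ i ν = ∅ := fun ν hν =>
    Finset.subset_empty.mp ((hsub ν).trans_eq (hsupp' ν hν))
  refine ⟨fun s t hg => ?_, ?_⟩
  · set q := BetheHC.Z c m n s t (BetheHC.del A μ i) (BetheHC.del B μ k) with hq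
    -- the explicit term has the same residue, so that the difference is regular
    have h1 := BetheHC.HasRes.mul ((BetheHC.analyticAt_resRest (m := m) hμ hk hg).mul
      (analyticAt_const (v := -q))) (BetheHC.hasRes_g c (t μ k) m (μ + 1))
    obtain ⟨R, hR, hR'⟩ := BetheHC.HasRes.exists_analyticAt (w := t μ k)
      (F := fun z => BetheHC.Z c m n (BetheHC.setParam s μ i z) t A B -
        BetheHC.resFactor c m s t A B μ i k z * q) (by
      have h2 := (hres s t hg).add h1
      convert h2 using 1
      · funext z
        rw [BetheHC.resFactor_eq]
        simp only [Pi.mul_apply]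
        ring
      · simp only [Pi.mul_apply, ← hq]
        ring)
    refine ⟨R, hR, ?_⟩
    filter_upwards [hR'] with z hz
    rw [← hz]
    ring
  · -- `G` ensures genericity, and `P` is the numerator of the highest coefficient in the residue
    obtain ⟨G, hG, hG'⟩ := BetheHC.exists_polynomial_generic (A := BetheHC.del A μ i) (B := B) c
      (m + n - 1) hempty fun ν hν => by
        rw [← Finset.card_eq_zero, ← hcard ν, hsupp' ν hν, Finset.card_empty]
    obtain ⟨P, Q, hPQ⟩ := BetheHC.isRational_Z (c := c) m n (BetheHC.del A μ i) (BetheHC.del B μ k)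
    beta_reduce at hPQ
    obtain ⟨s₀, t₀, hg₀, hZ₀⟩ := BetheHC.exists_generic_Z_ne_zero (m := m) (n := n) hc
      (BetheHC.card_del_eq hcard hi hk) hempty (Finset.subset_empty.mp ((hsub 0).trans_eq hA0))
    have hP : P ≠ 0 := by
      rintro rfl
      apply hZ₀
      rw [(hPQ _ _ hg₀).2, map_zero, zero_div]
    refine ⟨G * P, mul_ne_zero hG hP, fun s t h => ?_⟩
    change MvPolynomial.eval (BetheHC.paramPoint s t) (G * P) ≠ 0 at h
    rw [map_mul, mul_ne_zero_iff] at h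
    have hg := hG' s t h.1
    obtain ⟨h1, h2⟩ := hPQ s t (hg.mono (fun _ => subset_rfl) (BetheHC.del_subset B μ k))
    refine (hres s t hg).meromorphicOrderAt_eq (mul_ne_zero (mul_ne_zero
      (neg_ne_zero.mpr (BetheHC.cg_ne_zero hc _ _)) (BetheHC.resRest_ne_zero hc hμ hk hg)) ?_)
    rw [h2]
    exact div_ne_zero h.2 h1
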